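/- Let $|\cdot|$ denote Lebesgue measure of a subset of $\mathbb R^N$ and also the cardinality of a finite set, and let $B^N_r\subset\mathbb R^N$ be the ball of radius $r$ centered at the origin. For a subspace $V\subset\mathbb R^N$, the cylinder of height $h>0$ over a set $K\subset V$ is $\{x+y : x\in K,\ y\in V^\perp,\ |y|\le h\}$. A uniformly distributed random $n$-dimensional subspace of $\mathbb R^N$ is $V=g\,\mathbb R^n$, where $\mathbb R^n\subset\mathbb R^N$ is spanned by the first $n$ standard basis vectors and $g\in SO(N)$ is distributed according to normalized Haar measure. There is an absolute constant $A>0$ such that for every $N\ge 1$, every $\kappa\in(0,1)$ and every $L>0$ there is a constant $C=C(N,\kappa,L)>0$ with the following property. Let $0\le n\le N$, let $R>1$, and let $V\subset\mathbb R^N$ be a uniformly distributed random $n$-dimensional subspace. Then with probability at least $\kappa$ (that is, for all $g$ in a Borel set $E\subset SO(N)$ of Haar probability at least $\kappa$) the following holds: for every convex set $K\subset V$ and every $h>0$, if the cylinder $S$ of height $h$ over $K$ contains some open ball of radius $1/(LR)$, is contained in the open ball $B^N_{LR}$, and satisfies $|S|\ge 1$, then $S\cap\mathbb Z^N$ is finite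 and $$\frac{|S\cap\mathbb Z^N|}{|S|}\le C\,R^{A n^2/N}.$$ -/

import Mathlib

open MeasureTheory

/-- The special orthogonal group `SO(N)`. -/
abbrev SO (N : ℕ) : Type := Matrix.specialOrthogonalGroup (Fin N) ℝ

instance SO.instIsTopologicalGroup (N : ℕ) : IsTopologicalGroup (SO N) where
  continuous_inv := by
    refine Continuous.subtype_mk ?_ _
    exact continuous_star.comp continuous_subtype_val

instance SO.instCompactSpace (N : ℕ) : CompactSpace (SO N) := by
  refine (isCompact_iff_compactSpace (s := (Matrix.specialOrthogonalGroup (Fin N) ℝ :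
    Set (Matrix (Fin N) (Fin N) ℝ)))).mp ?_
  have hK : IsCompact (Set.univ.pi fun _ : Fin N => Set.univ.pi fun _ : Fin N =>
      Set.Icc (-1 : ℝ) 1) :=
    isCompact_univ_pi fun _ => isCompact_univ_pi fun _ => isCompact_Icc
  have hclosed : IsClosed {A : Matrix (Fin N) (Fin N) ℝ | A * star A = 1 ∧ A.det = 1} := by
    apply IsClosed.inter
    · exact isClosed_eq (continuous_id.mul continuous_star) continuous_const
    · exact isClosed_eq (continuous_id.matrix_det) continuous_const
  have hset : {A : Matrix (Fin N) (Fin N) ℝ | A * star A = 1 ∧ A.det = 1}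
      = (Matrix.specialOrthogonalGroup (Fin N) ℝ : Set (Matrix (Fin N) (Fin N) ℝ)) := by
    ext A
    simp [Matrix.mem_specialOrthogonalGroup_iff, Matrix.mem_orthogonalGroup_iff,
      Matrix.star_eq_conjTranspose]
  rw [← hset]
  have hrow : ∀ A : Matrix (Fin N) (Fin N) ℝ, A * star A = 1 → ∀ i,
      ∑ k, A i k * A i k = 1 := by
    intro A hA i
    have h0 : (A * star A) i i = 1 := by rw [hA, Matrix.one_apply_eq]
    rw [Matrix.mul_apply] at h0
    simpa only [Matrix.star_apply, star_trivial] using h0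
  refine hK.of_isClosed_subset hclosed ?_
  rintro A ⟨hA, -⟩ i - j -
  have h : ∑ k, A i k * A i k = 1 := hrow A hA i
  have h1 : A i j * A i j ≤ 1 := by
    rw [← h]
    exact Finset.single_le_sum (f := fun k => A i k * A i k)
      (fun k _ => mul_self_nonneg _) (Finset.mem_univ j)
  exact abs_le.mp (abs_le_one_iff_mul_self_le_one.mpr h1)

instance SO.instMeasurableSpace (N : ℕ) : MeasurableSpace (SO N) := borel _

instance SO.instBorelSpace (N : ℕ) : BorelSpace (SO N) := ⟨rfl⟩

/-- The uniform distribution on `SO(N)`: Haar measure, normalized to have total mass `1`. -/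
noncomputable def uniformSO (N : ℕ) : Measure (SO N) :=
  Measure.haarMeasure ⊤

/-- The `n`-dimensional subspace `g ℝⁿ` of `ℝᴺ`, where `ℝⁿ` is spanned by the first `n` standard
basis vectors. When `g` is uniformly distributed in `SO(N)`, it is a uniformly distributed random
`n`-dimensional subspace (`n ≤ N`). -/
noncomputable def rotatedSubspace {N : ℕ} (n : ℕ) (g : SO N) :
    Submodule ℝ (EuclideanSpace ℝ (Fin N)) :=
  Submodule.span ℝ ((fun i : Fin N =>
    Matrix.toEuclideanLin (g : Matrix (Fin N) (Fin N) ℝ) (EuclideanSpace.single i 1)) ''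
      {i | (i : ℕ) < n})

/-- The cylinder of height `h` over a subset `K` of a subspace `V`: the points `x + y` with
`x ∈ K`, `y ⟂ V` and `‖y‖ ≤ h`. -/
def subspaceCylinder {N : ℕ} (V : Submodule ℝ (EuclideanSpace ℝ (Fin N)))
    (K : Set (EuclideanSpace ℝ (Fin N))) (h : ℝ) : Set (EuclideanSpace ℝ (Fin N)) :=
  {z | ∃ x ∈ K, ∃ y ∈ Vᗮ, ‖y‖ ≤ h ∧ z = x + y}

/-- The integer lattice `ℤᴺ` in `ℝᴺ`. -/
def integerLattice (N : ℕ) : Set (EuclideanSpace ℝ (Fin N)) :=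
  {x | ∀ i, ∃ m : ℤ, x i = m}

/-! The value `A = 16` serves. For `4 * n > N` the exponent `16 n² / N` is at least `N`, so counting
all integer points of the ball of radius `L * R` suffices; for `n = 0` a bound independent of `R`
holds for every `g`. The content is `1 ≤ n ≤ N / 4`; put `m = N - n`.

Normalization (`exists_normalized_box`). A simplex of almost maximal determinant inscribed in `K`
makes `S` comparable to a parallelepiped with matrix `t` along `V` and side `h` across `V`. Changing
`h` to `h₁` with `|det t| h₁ ^ m = 1` and cutting `S` into `O(|S|)` cells, differences of integer
points in one cell lie in a centred box of determinant `1`. It remains to bound the number `f` of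
integer points of that box.

Counting (`exists_card_mul_prod_le`, `exists_integer_frame`). Let `W` be the span of these points,
`k` its dimension, and `P` the product of the successive minima of the lattice `W ∩ ℤᴺ`. Packing
gives `f P ≲ D`, where `D` is the volume spanned by `k` of the points. Let `s₁`, `s₂` be the volumes
of the projections to `Wᗮ` and to `W` of an orthonormal frame of `V`. Then `D s₁ ≲ h₁ ^ k`, because
`D s₁` is the volume of a projection to `Vᗮ`, and `D s₂ ≲ |det t| h₁ ^ (k - n) = h₁ ^ (-(N - k))`
when `n ≤ k`.

Transversality (`exists_good_event`). Outside an event of probability at most `1 - κ`, all integer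
tuples spanning such a `W` satisfy `s₁ ^ a s₂ ^ b ≳ P ^ (-(N + 1))`, where `a = N - n - k` and `b =
k - n` are truncated at `0`. This follows from negative moments of `s₁` and `s₂` that are bounded
uniformly in `W`, Markov's inequality, and a union bound, which converges because `‖z‖ ^ (-(N + 1))`
is summable over nonzero integer vectors.

Combination (`card_pow_le_of_bounds`). In `(f P) ^ (a + b) ≲ P ^ (N + 1) (D s₁) ^ a (D s₂) ^ b` the
powers of `h₁` cancel up to an exponent at most `n N` in absolute value, and the powers of `P` up to
an exponent at most `3 n`. Since `P`, `h₁ ^ m` and `h₁ ^ (-m)` are all at most a constant times `R ^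
O(n)`, this gives `f ^ (N - 2 n) ≲ R ^ (8 n²)`, and `N - 2 n ≥ N / 2` yields the exponent `16 n² /
N`. -/

/-! ### Almost maximal determinants and lattice packing. -/

/-- A spanning set on which a determinant is bounded contains a basis of almost maximal
determinant; the coordinates of its elements in this basis are at most `2`. -/
lemma exists_almost_maximal_det {ι V : Type*} [Fintype ι] [DecidableEq ι] [AddCommGroup V]
    [Module ℝ V] (b : Module.Basis ι ℝ V) (A : Set V) (hspan : Submodule.span ℝ A = ⊤) (B : ℝ)
    (hB : ∀ u : ι → V, (∀ i, u i ∈ A) → |b.det u| ≤ B) :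
    ∃ u : ι → V, (∀ i, u i ∈ A) ∧ b.det u ≠ 0 ∧
      (∀ u' : ι → V, (∀ i, u' i ∈ A) → |b.det u'| ≤ 2 * |b.det u|) ∧
      ∀ f ∈ A, ∃ c : ι → ℝ, (∀ i, |c i| ≤ 2) ∧ f = ∑ i, c i • u i := by
  obtain ⟨s, hsA, hs1, hs2⟩ := exists_linearIndependent ℝ A
  rw [hspan] at hs1
  let b' : Module.Basis s ℝ V := Module.Basis.mk hs2 (by rw [Subtype.range_coe, hs1])
  let e := b'.indexEquiv b
  have hu0 : ∀ i, (fun i => ((e.symm i : s) : V)) i ∈ A := fun i => hsA (e.symm i).2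
  have hd0 : b.det (fun i => ((e.symm i : s) : V)) ≠ 0 := by
    have h := b.isUnit_det (b'.reindex e)
    have h2 : (⇑(b'.reindex e) : ι → V) = fun i => ((e.symm i : s) : V) := by
      ext i; simp [b']
    rw [h2] at h
    exact h.ne_zero
  set D : Set ℝ := {r | ∃ u : ι → V, (∀ i, u i ∈ A) ∧ |b.det u| = r} with hD
  have hbdd : BddAbove D := ⟨B, by rintro _ ⟨u, hu, rfl⟩; exact hB u hu⟩
  have hpos : 0 < sSup D :=
    lt_of_lt_of_le (abs_pos.mpr hd0) (le_csSup hbdd ⟨_, hu0, rfl⟩)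
  -- The supremum need not be attained, since `A` is not assumed closed; accepting half of it is the
  -- source of the factor `2`.
  obtain ⟨_, ⟨u, hu, rfl⟩, hlt⟩ := exists_lt_of_lt_csSup (s := D) ⟨_, _, hu0, rfl⟩
    (half_lt_self hpos)
  have hmax : ∀ u' : ι → V, (∀ i, u' i ∈ A) → |b.det u'| ≤ 2 * |b.det u| := fun u' hu' => by
    have := le_csSup hbdd (⟨u', hu', rfl⟩ : |b.det u'| ∈ D)
    linarith
  have hne : b.det u ≠ 0 := abs_pos.mp (by linarith)
  refine ⟨u, hu, hne, hmax, fun f hf => ?_⟩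
  obtain ⟨hli, hsp⟩ := (Module.Basis.is_basis_iff_det b).mpr (isUnit_iff_ne_zero.mpr hne)
  let bu : Module.Basis ι ℝ V := Module.Basis.mk hli hsp.ge
  refine ⟨fun i => bu.repr f i, fun i => ?_, ?_⟩
  -- Cramer's rule: the `i`-th coordinate of `f` is the ratio of the determinant with `u i` replaced
  -- by `f` to that of `u`.
  · have h1 := congrArg (fun l => l f) (Module.Basis.det_smul_mk_coord_eq_det_update b hli hsp.ge i)
    simp only [LinearMap.smul_apply, smul_eq_mul, Module.Basis.coord_apply] at h1
    have h2 : |b.det (Function.update u i f)| ≤ 2 * |b.det u| := by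
      refine hmax _ fun j => ?_
      by_cases hj : j = i
      · subst hj; simpa using hf
      · simpa [hj] using hu j
    have h3 : b.det u * bu.repr f i = b.det (Function.update u i f) := h1
    rw [← h3, abs_mul] at h2
    have := abs_pos.mpr hne
    nlinarith
  · have := bu.sum_repr f
    simp only [bu, Module.Basis.mk_apply] at this
    exact this.symm

/-- Packing bound: if distinct points of a group `Λ` are separated by boxes of sides `δ`, then a
finite subset of `Λ` inside twice the parallelepiped of a basis contained in `Λ` is controlled by
the volume of that parallelepiped. -/
lemma card_mul_prod_le_det {ι : Type*} [Fintype ι] [DecidableEq ι] (Λ : AddSubgroup (ι → ℝ))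
    (δ : ι → ℝ) (hδ : ∀ i, 0 < δ i) (hsep : ∀ x ∈ Λ, x ≠ 0 → ∃ i, δ i ≤ |x i|)
    (b : Module.Basis ι ℝ (ι → ℝ)) (hb : ∀ i, b i ∈ Λ) (F : Finset (ι → ℝ))
    (hF : ∀ f ∈ F, f ∈ Λ ∧ ∀ i, |b.repr f i| ≤ 2) :
    (F.card : ℝ) * ∏ i, δ i ≤ 5 ^ Fintype.card ι * |(Matrix.of b).det| := by
  classical
  have hspan : ∀ y ∈ Submodule.span ℤ (Set.range b), y ∈ Λ := by
    intro y hy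
    have : Submodule.span ℤ (Set.range b) ≤ AddSubgroup.toIntSubmodule Λ := by
      rw [Submodule.span_le]
      rintro _ ⟨i, rfl⟩
      exact hb i
    exact this hy
  -- Residues of `F` modulo the sublattice spanned by `b`. Each class meets `F` in at most `5 ^ d`
  -- points, as the integer parts of their coordinates lie in `[-2, 2]`.
  set F' := F.image (ZSpan.fract b) with hF'
  have hfract : ∀ x ∈ F', x ∈ Λ ∧ ZSpan.fract b x = x := by
    intro x hx
    obtain ⟨f, hf, rfl⟩ := Finset.mem_image.mp hx
    exact ⟨Λ.sub_mem (hF f hf).1 (hspan _ (ZSpan.floor b f).2), ZSpan.fract_fract b f⟩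
  -- each residue class contains at most `5 ^ d` points of `F`
  have hcard : F.card ≤ F'.card * 5 ^ Fintype.card ι := by
    rw [mul_comm]
    refine Finset.card_le_mul_card_image F _ fun y _ => ?_
    have hinj : Set.InjOn (fun f : ι → ℝ => fun i => ⌊b.repr f i⌋)
        (F.filter fun f => ZSpan.fract b f = y : Finset _) := by
      intro f hf f' hf' h
      simp only [Finset.coe_filter, Set.mem_ofPred_eq] at hf hf'
      have h1 : ZSpan.floor b f = ZSpan.floor b f' := by
        simp only [ZSpan.floor]
        exact Finset.sum_congr rfl fun i _ => by
          have h5 : ⌊b.repr f i⌋ = ⌊b.repr f' i⌋ := congrFun h i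
          rw [h5]
      have h2 := hf.2.trans hf'.2.symm
      rw [ZSpan.fract_apply, ZSpan.fract_apply, h1] at h2
      exact sub_left_injective h2
    rw [← Finset.card_image_of_injOn hinj]
    have : (F.filter fun f => ZSpan.fract b f = y).image
        (fun f : ι → ℝ => fun i => ⌊b.repr f i⌋) ⊆
        Fintype.piFinset fun _ : ι => Finset.Icc (-2 : ℤ) 2 := by
      intro z hz
      obtain ⟨f, hf, rfl⟩ := Finset.mem_image.mp hz
      rw [Fintype.mem_piFinset]
      intro i
      have := abs_le.mp ((hF f (Finset.mem_filter.mp hf).1).2 i)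
      rw [Finset.mem_Icc]
      constructor
      · exact Int.le_floor.mpr (by push_cast; exact this.1)
      · have h3 : ((⌊b.repr f i⌋ : ℤ) : ℝ) ≤ 2 := (Int.floor_le _).trans this.2
        exact_mod_cast h3
    refine (Finset.card_le_card this).trans ?_
    simp [Fintype.card_piFinset]
  set B : Set (ι → ℝ) := Set.univ.pi fun i => Set.Ico 0 (δ i) with hBdef
  have hBm : MeasurableSet B := MeasurableSet.univ_pi fun i => measurableSet_Ico
  have hBB : ∀ p ∈ Λ, ∀ q ∈ Λ, ∀ x ∈ B, ∀ y ∈ B, p + x = q + y → p = q := by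
    intro p hp q hq x hx y hy h
    by_contra hne
    obtain ⟨i, hi⟩ := hsep (p - q) (Λ.sub_mem hp hq) (sub_ne_zero.mpr hne)
    have h1 : (p - q) i = y i - x i := by
      have := congrFun h i
      simp only [Pi.add_apply] at this
      simp only [Pi.sub_apply]; linarith
    rw [h1] at hi
    have hx' := hx i (Set.mem_univ i)
    have hy' := hy i (Set.mem_univ i)
    simp only [Set.mem_Ico] at hx' hy'
    have : |y i - x i| < δ i := by rw [abs_lt]; constructor <;> linarith
    linarith
  set s : Set (ι → ℝ) := ⋃ f ∈ F', (fun x => f + x) '' B with hs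
  have hsm : MeasurableSet s :=
    Finset.measurableSet_biUnion _ fun f _ => by
      exact (MeasurableEquiv.addLeft f).measurableSet_image.mpr hBm
  have hvs : volume s = F'.card * volume B := by
    rw [hs, measure_biUnion_finset]
    · simp
    · intro f hf f' hf' hne
      rw [Function.onFun, Set.disjoint_left]
      rintro _ ⟨x, hx, rfl⟩ ⟨y, hy, h⟩
      exact hne (hBB _ (hfract _ hf).1 _ (hfract _ hf').1 x hx y hy h.symm)
    · intro f _
      exact (MeasurableEquiv.addLeft f).measurableSet_image.mpr hBm
  -- Blichfeldt's argument: if the boxes placed at the residues had larger total volume than a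
  -- fundamental domain, two translates of their union by distinct sublattice vectors would meet;
  -- separation then identifies the residues, hence the vectors.
  have hle : volume s ≤ volume (ZSpan.fundamentalDomain b) := by
    by_contra hlt
    have : Countable (Submodule.span ℤ (Set.range b)).toAddSubgroup :=
      inferInstanceAs (Countable (Submodule.span ℤ (Set.range b)))
    obtain ⟨x, y, hxy, hnd⟩ := exists_pair_mem_lattice_not_disjoint_vadd
      (ZSpan.isAddFundamentalDomain' b volume) hsm.nullMeasurableSet (not_le.mp hlt)
    rw [Set.not_disjoint_iff] at hnd
    obtain ⟨z, ⟨z1, hz1, h1⟩, ⟨z2, hz2, h2⟩⟩ := hnd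
    simp only [hs, Set.mem_iUnion] at hz1 hz2
    obtain ⟨f1, hf1, b1, hb1, rfl⟩ := hz1
    obtain ⟨f2, hf2, b2, hb2, rfl⟩ := hz2
    have h1' : (x : ι → ℝ) + (f1 + b1) = z := h1
    have h2' : (y : ι → ℝ) + (f2 + b2) = z := h2
    have h3 := hBB (x + f1) (Λ.add_mem (hspan _ x.2) (hfract _ hf1).1) (y + f2)
      (Λ.add_mem (hspan _ y.2) (hfract _ hf2).1) b1 hb1 b2 hb2
      (by rw [add_assoc, h1', add_assoc, h2'])
    have h4 := congrArg (ZSpan.fract b) h3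
    rw [ZSpan.fract_zSpan_add b _ x.2, ZSpan.fract_zSpan_add b _ y.2, (hfract _ hf1).2,
      (hfract _ hf2).2] at h4
    rw [h4] at h3
    exact hxy (Subtype.ext (add_right_cancel h3))
  rw [hvs, ZSpan.volume_fundamentalDomain, hBdef, Real.volume_pi_Ico] at hle
  simp only [sub_zero] at hle
  rw [← ENNReal.ofReal_prod_of_nonneg fun i _ => (hδ i).le, ← ENNReal.ofReal_natCast,
    ← ENNReal.ofReal_mul (by positivity), ENNReal.ofReal_le_ofReal_iff (abs_nonneg _)] at hle
  have hP : 0 ≤ ∏ i, δ i := Finset.prod_nonneg fun i _ => (hδ i).le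
  calc (F.card : ℝ) * ∏ i, δ i ≤ (F'.card * 5 ^ Fintype.card ι : ℝ) * ∏ i, δ i := by
        gcongr; exact_mod_cast hcard
    _ = 5 ^ Fintype.card ι * (F'.card * ∏ i, δ i) := by ring
    _ ≤ _ := by gcongr
-- Integer vectors and successive minima.
/-- The vector with the given integer coordinates. -/
def intVec {N : ℕ} (z : Fin N → ℤ) : EuclideanSpace ℝ (Fin N) := WithLp.toLp 2 fun i => (z i : ℝ)

lemma intVec_apply {N : ℕ} (z : Fin N → ℤ) (i : Fin N) : intVec z i = z i := rfl

lemma intVec_injective {N : ℕ} : Function.Injective (intVec (N := N)) := by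
  intro z w h
  ext i
  have : (z i : ℝ) = w i := congrArg (fun x => x.ofLp i) h
  exact_mod_cast this

lemma integerLattice_eq_range (N : ℕ) : integerLattice N = Set.range intVec := by
  ext x
  constructor
  · intro h
    choose z hz using h
    exact ⟨z, by ext i; exact (hz i).symm⟩
  · rintro ⟨z, rfl⟩ i
    exact ⟨z i, rfl⟩

lemma intVec_sub {N : ℕ} (z w : Fin N → ℤ) : intVec (z - w) = intVec z - intVec w := by
  ext i; simp [intVec]

lemma one_le_norm_intVec {N : ℕ} {z : Fin N → ℤ} (hz : z ≠ 0) : 1 ≤ ‖intVec z‖ := by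
  obtain ⟨i, hi⟩ := Function.ne_iff.mp hz
  refine le_trans ?_ (PiLp.norm_apply_le (intVec z) i)
  rw [intVec_apply, Real.norm_eq_abs]
  exact_mod_cast Int.one_le_abs hi

lemma exists_min_norm_intVec {N : ℕ} (S : Set (Fin N → ℤ)) (hS : S.Nonempty) :
    ∃ z ∈ S, ∀ w ∈ S, ‖intVec z‖ ≤ ‖intVec w‖ := by
  -- Squared norms of integer vectors are natural numbers, so a minimum exists.
  obtain ⟨z, hz, hmin⟩ := WellFounded.has_min
    (InvImage.wf (fun z : Fin N → ℤ => (∑ i, z i ^ 2).toNat) Nat.lt_wfRel.wf) S hS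
  refine ⟨z, hz, fun w hw => ?_⟩
  have h1 : ¬ (∑ i, w i ^ 2).toNat < (∑ i, z i ^ 2).toNat := hmin w hw
  have h2 : ∑ i, z i ^ 2 ≤ ∑ i, w i ^ 2 := by
    have := Finset.sum_nonneg fun i (_ : i ∈ Finset.univ) => sq_nonneg (w i)
    omega
  rw [EuclideanSpace.norm_eq, EuclideanSpace.norm_eq]
  apply Real.sqrt_le_sqrt
  simp only [intVec_apply, Real.norm_eq_abs, sq_abs]
  exact_mod_cast h2

/-- Successive minima of the integer points of a subspace spanned by integer points. -/
lemma exists_successive_minima {N : ℕ} (W : Submodule ℝ (EuclideanSpace ℝ (Fin N)))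
    (hW : W = Submodule.span ℝ {x | x ∈ W ∧ ∃ z, intVec z = x}) (j : ℕ)
    (hj : j ≤ Module.finrank ℝ W) :
    ∃ v : Fin j → Fin N → ℤ, (∀ i, intVec (v i) ∈ W) ∧
      LinearIndependent ℝ (fun i => intVec (v i)) ∧
      ∀ i z, intVec z ∈ W →
        intVec z ∉ Submodule.span ℝ ((fun i => intVec (v i)) '' Set.Iio i) →
        ‖intVec (v i)‖ ≤ ‖intVec z‖ := by
  induction j with
  | zero => exact ⟨Fin.elim0, fun i => i.elim0, linearIndependent_empty_type, fun i => i.elim0⟩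
  | succ j ih =>
    obtain ⟨v, hvW, hli, hmin⟩ := ih (by omega)
    set U := Submodule.span ℝ (Set.range fun i => intVec (v i)) with hU
    have hlt : ∃ z, intVec z ∈ W ∧ intVec z ∉ U := by
      by_contra! hcon
      have h1 : W ≤ U := by
        conv_lhs => rw [hW]
        rw [Submodule.span_le]
        rintro _ ⟨hx, z, rfl⟩
        exact hcon z hx
      have h2 := Submodule.finrank_mono h1
      have h3 : Module.finrank ℝ U ≤ j := by
        have := finrank_range_le_card (R := ℝ) (fun i => intVec (v i))
        rwa [Fintype.card_fin] at this
      omega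
    obtain ⟨z, ⟨hzW, hzU⟩, hzmin⟩ := exists_min_norm_intVec {z | intVec z ∈ W ∧ intVec z ∉ U} hlt
    have hcomp : (fun i => intVec ((Fin.snoc v z : Fin (j + 1) → Fin N → ℤ) i)) =
        Fin.snoc (fun i => intVec (v i)) (intVec z) := by
      ext i : 1
      refine Fin.lastCases ?_ (fun i => ?_) i <;> simp
    have himg : ∀ i : Fin (j + 1), (fun i => intVec ((Fin.snoc v z : Fin (j + 1) → Fin N → ℤ) i)) ''
        Set.Iio i = (fun i => intVec (v i)) '' {l | l.castSucc < i} := by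
      intro i
      ext x
      constructor
      · rintro ⟨l, hl, rfl⟩
        have hl' : l ≠ Fin.last j := fun h => by
          subst h; exact absurd (Fin.le_last i) (not_le.mpr hl)
        obtain ⟨l', rfl⟩ := Fin.exists_castSucc_eq.mpr hl'
        exact ⟨l', hl, by simp⟩
      · rintro ⟨l, hl, rfl⟩
        exact ⟨l.castSucc, hl, by simp⟩
    refine ⟨Fin.snoc v z, fun i => ?_, ?_, fun i => ?_⟩
    · refine Fin.lastCases ?_ (fun i => ?_) i
      · simpa using hzW
      · simpa using hvW i
    · rw [hcomp, linearIndependent_finSnoc]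
      exact ⟨hli, hzU⟩
    · rw [himg]
      refine Fin.lastCases ?_ (fun i => ?_) i
      · intro w hw hw2
        simp only [Fin.snoc_last]
        refine hzmin w ⟨hw, fun h => hw2 ?_⟩
        convert h
        ext x
        simp [Fin.castSucc_lt_last]
      · intro w hw hw2
        simp only [Fin.snoc_castSucc]
        refine hmin i w hw fun h => hw2 ?_
        convert h using 3
        ext l; simp

/-- The Gram-Schmidt orthonormalization of the successive minima separates integer points by
boxes whose sides are the successive minima. -/
lemma exists_orthonormal_separated {N k : ℕ} (W : Submodule ℝ (EuclideanSpace ℝ (Fin N)))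
    (hW : W = Submodule.span ℝ {x | x ∈ W ∧ ∃ z, intVec z = x})
    (hk : Module.finrank ℝ W = k) :
    ∃ (v : Fin k → Fin N → ℤ) (e : Fin k → EuclideanSpace ℝ (Fin N)),
      LinearIndependent ℝ (fun i => intVec (v i)) ∧
      Submodule.span ℝ (Set.range fun i => intVec (v i)) = W ∧ Orthonormal ℝ e ∧
      Submodule.span ℝ (Set.range e) = W ∧
      ∀ z, z ≠ 0 → intVec z ∈ W → ∃ i, ‖intVec (v i)‖ / k ≤ |inner ℝ (e i) (intVec z)| := by
  obtain ⟨v, hvW, hli, hmin⟩ := exists_successive_minima W hW k hk.ge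
  set f : Fin k → EuclideanSpace ℝ (Fin N) := fun i => intVec (v i) with hf
  set e := InnerProductSpace.gramSchmidtNormed ℝ f with he
  have hspan : Submodule.span ℝ (Set.range f) = W := by
    refine Submodule.eq_of_le_of_finrank_eq ?_ ?_
    · rw [Submodule.span_le]; rintro _ ⟨i, rfl⟩; exact hvW i
    · rw [finrank_span_eq_card hli, hk, Fintype.card_fin]
  have hon : Orthonormal ℝ e := InnerProductSpace.gramSchmidtNormed_orthonormal hli
  have hspane : Submodule.span ℝ (Set.range e) = W := by
    rw [he, InnerProductSpace.span_gramSchmidtNormed_range, InnerProductSpace.span_gramSchmidt, hspan]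
  have htri : ∀ i j, i < j → inner ℝ (e j) (f i) = 0 := by
    intro i j hij
    rw [he, InnerProductSpace.gramSchmidtNormed, inner_smul_left,
      InnerProductSpace.gramSchmidt_inv_triangular ℝ f hij, mul_zero]
  refine ⟨v, e, hli, hspan, hon, hspane, fun z hz hzW => ?_⟩
  have hexp : ∑ i, inner ℝ (e i) (intVec z) • e i = intVec z := by
    have h1 : intVec z ∈ Submodule.span ℝ (Set.range e) := by rw [hspane]; exact hzW
    obtain ⟨c, hc⟩ := (Submodule.mem_span_range_iff_exists_fun ℝ).mp h1
    rw [← hc]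
    refine Finset.sum_congr rfl fun i _ => ?_
    rw [hon.inner_right_fintype]
  have hnorm : ‖intVec z‖ ^ 2 = ∑ i, inner ℝ (e i) (intVec z) ^ 2 := by
    rw [← real_inner_self_eq_norm_sq]
    conv_lhs => rw [← hexp]
    rw [hon.inner_sum]
    simp [sq]
  have hne : (Finset.univ.filter fun i => inner ℝ (e i) (intVec z) ≠ 0).Nonempty := by
    by_contra hemp
    rw [Finset.not_nonempty_iff_eq_empty, Finset.filter_eq_empty_iff] at hemp
    have h0 : ‖intVec z‖ ^ 2 = 0 := by
      rw [hnorm]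
      exact Finset.sum_eq_zero fun i hi => by
        have := hemp hi; rw [not_not] at this; rw [this]; ring
    have := one_le_norm_intVec hz
    nlinarith
  -- The last nonzero Gram-Schmidt coordinate of `z`: as it does not vanish, `z` lies outside the
  -- span of the earlier minima, so `‖intVec z‖` is at least the `j`-th minimum. If all coordinates
  -- were below the claimed sides, the sum of squares would contradict this.
  obtain ⟨j, hj, hjmax⟩ := Finset.exists_max_image _ id hne
  simp only [Finset.mem_filter, Finset.mem_univ, true_and, id] at hj hjmax
  have hjz : ‖f j‖ ≤ ‖intVec z‖ := by
    refine hmin j z hzW fun hmem => hj ?_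
    have : Submodule.span ℝ (f '' Set.Iio j) ≤ LinearMap.ker (innerSL ℝ (e j)).toLinearMap := by
      rw [Submodule.span_le]
      rintro _ ⟨i, hi, rfl⟩
      simpa using htri i j hi
    simpa using this hmem
  have hmono : ∀ i, i ≤ j → ‖f i‖ ≤ ‖f j‖ := by
    intro i hij
    refine hmin i (v j) (hvW j) fun hmem => ?_
    have := hli.notMem_span_image (s := Set.Iio i) (x := j) (by simpa using hij)
    exact this hmem
  have hkpos : 0 < k := j.pos
  by_contra! hcon
  have hfj : 1 ≤ ‖f j‖ := one_le_norm_intVec fun h => hli.ne_zero j (by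
    show intVec (v j) = 0
    rw [h]; ext i; simp [intVec])
  have hlt : ‖intVec z‖ ^ 2 < ‖f j‖ ^ 2 := by
    rw [hnorm]
    have hb : ∀ i, inner ℝ (e i) (intVec z) ^ 2 ≤ (‖f j‖ / k) ^ 2 := by
      intro i
      by_cases hi : inner ℝ (e i) (intVec z) = 0
      · rw [hi, zero_pow two_ne_zero]; positivity
      · rw [← sq_abs]
        have h1 := hcon i
        have h2 := hmono i (hjmax i hi)
        gcongr
        exact h1.le.trans (by gcongr)
    have hb' : inner ℝ (e j) (intVec z) ^ 2 < (‖f j‖ / k) ^ 2 := by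
      rw [← sq_abs]
      have h1 := hcon j
      gcongr
    calc ∑ i, inner ℝ (e i) (intVec z) ^ 2 < ∑ i : Fin k, (‖f j‖ / k) ^ 2 :=
          Finset.sum_lt_sum (fun i _ => hb i) ⟨j, Finset.mem_univ j, hb'⟩
      _ = ‖f j‖ ^ 2 / k := by
          rw [Finset.sum_const, Finset.card_univ, Fintype.card_fin, nsmul_eq_mul]
          field_simp
      _ ≤ ‖f j‖ ^ 2 := div_le_self (by positivity) (by exact_mod_cast hkpos)
  have := pow_le_pow_left₀ (norm_nonneg _) hjz 2
  linarith

/-! ### Determinant bounds for integer vectors in a box. -/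

section MatrixBounds

open Matrix

lemma abs_det_le_of_row_bound {κ : Type*} [Fintype κ] [DecidableEq κ] (A : Matrix κ κ ℝ) (β : κ → ℝ)
    (hA : ∀ i j, |A i j| ≤ β i) : |A.det| ≤ (Fintype.card κ).factorial * ∏ i, β i := by
  rw [← det_transpose, det_apply]
  refine (Finset.abs_sum_le_sum_abs _ _).trans ?_
  have : ∀ σ ∈ (Finset.univ : Finset (Equiv.Perm κ)),
      |Equiv.Perm.sign σ • ∏ i, Aᵀ (σ i) i| ≤ ∏ i, β i := by
    intro σ _
    have h1 : |Equiv.Perm.sign σ • ∏ i, Aᵀ (σ i) i| = |∏ i, Aᵀ (σ i) i| := by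
      rcases Int.units_eq_one_or (Equiv.Perm.sign σ) with h | h <;> simp [h]
    rw [h1, Finset.abs_prod]
    exact Finset.prod_le_prod (fun i _ => abs_nonneg _) fun i _ => hA i (σ i)
  refine (Finset.sum_le_card_nsmul _ _ _ this).trans ?_
  rw [Finset.card_univ, Fintype.card_perm, nsmul_eq_mul]

lemma abs_mul_apply_le {κ μ ν : Type*} [Fintype μ] (A : Matrix κ μ ℝ) (B : Matrix μ ν ℝ) (a b : ℝ)
    (ha : 0 ≤ a) (hA : ∀ i j, |A i j| ≤ a) (hB : ∀ i j, |B i j| ≤ b) (i : κ) (j : ν) :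
    |(A * B) i j| ≤ Fintype.card μ * (a * b) := by
  rw [mul_apply]
  refine (Finset.abs_sum_le_sum_abs _ _).trans ?_
  refine (Finset.sum_le_card_nsmul _ _ (a * b) fun l _ => ?_).trans ?_
  · rw [abs_mul]
    exact mul_le_mul (hA i l) (hB l j) (abs_nonneg _) ha
  · rw [Finset.card_univ, nsmul_eq_mul]

variable {k n m : ℕ} (M : Matrix (Fin k) (Fin k) ℝ) (O₁ c₁ : Matrix (Fin k) (Fin n) ℝ)
  (O₂ c₂ : Matrix (Fin k) (Fin m) ℝ) (t : Matrix (Fin n) (Fin n) ℝ) (h : ℝ)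

lemma abs_le_one_of_mul_transpose_add (hO : O₁ * O₁ᵀ + O₂ * O₂ᵀ = 1) :
    (∀ i j, |O₁ i j| ≤ 1) ∧ ∀ i j, |O₂ i j| ≤ 1 := by
  have key : ∀ i, ∑ j, O₁ i j * O₁ i j + ∑ j, O₂ i j * O₂ i j = 1 := by
    intro i
    have := congrFun (congrFun hO i) i
    simpa [mul_apply, transpose_apply] using this
  constructor
  · intro i j
    have h1 := Finset.single_le_sum (f := fun j => O₁ i j * O₁ i j)
      (fun j _ => mul_self_nonneg _) (Finset.mem_univ j)
    have h2 := Finset.sum_nonneg fun j (_ : j ∈ Finset.univ) => mul_self_nonneg (O₂ i j)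
    exact abs_le_one_iff_mul_self_le_one.mpr (by linarith [key i])
  · intro i j
    have h1 := Finset.single_le_sum (f := fun j => O₂ i j * O₂ i j)
      (fun j _ => mul_self_nonneg _) (Finset.mem_univ j)
    have h2 := Finset.sum_nonneg fun j (_ : j ∈ Finset.univ) => mul_self_nonneg (O₁ i j)
    exact abs_le_one_iff_mul_self_le_one.mpr (by linarith [key i])

/-- Here, and below, the rows of `M` are vectors in an orthonormal basis of `W`, and `O₁`, `O₂` hold
the coordinates of that basis along `V` and `Vᗮ`. By `det (1 - O₁ᵀ O₁) = det (1 - O₁ O₁ᵀ) = det (O₂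
O₂ᵀ)`, the left side is the Gram determinant of the `Vᗮ`-components of the `k` vectors, whose
coordinates are at most `|h|` in absolute value. -/
lemma det_sq_mul_det_one_sub_le (hO : O₁ * O₁ᵀ + O₂ * O₂ᵀ = 1) (h2 : h • c₂ = M * O₂)
    (hc : ∀ i j, |c₂ i j| ≤ 1) :
    M.det ^ 2 * (1 - O₁ᵀ * O₁).det ≤ h ^ (2 * k) * (k.factorial * (m : ℝ) ^ k) := by
  have e1 : M.det ^ 2 * (1 - O₁ᵀ * O₁).det = h ^ (2 * k) * (c₂ * c₂ᵀ).det := by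
    rw [det_one_sub_mul_comm, show 1 - O₁ * O₁ᵀ = O₂ * O₂ᵀ by rw [← hO]; abel]
    calc M.det ^ 2 * (O₂ * O₂ᵀ).det = (M * (O₂ * O₂ᵀ) * Mᵀ).det := by
          rw [det_mul, det_mul, det_transpose]; ring
      _ = ((h • c₂) * (h • c₂)ᵀ).det := by rw [h2, transpose_mul]; simp only [Matrix.mul_assoc]
      _ = _ := by
          rw [transpose_smul, Matrix.smul_mul, Matrix.mul_smul, smul_smul, det_smul, Fintype.card_fin]
          ring
  rw [e1]
  have h3 := abs_det_le_of_row_bound (c₂ * c₂ᵀ) (fun _ => (m : ℝ)) fun i j => by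
    have := abs_mul_apply_le c₂ c₂ᵀ 1 1 zero_le_one hc (fun a b => hc b a) i j
    simpa using this
  have h4 : 0 ≤ h ^ (2 * k) := by rw [pow_mul]; positivity
  refine mul_le_mul_of_nonneg_left ((le_abs_self _).trans ?_) h4
  simpa using h3

lemma exists_orthonormal_complement_columns (hnk : n ≤ k) :
    ∃ ω : Matrix (Fin k) (Fin (k - n)) ℝ, ωᵀ * ω = 1 ∧ O₁ᵀ * ω = 0 := by
  let col : Fin n → EuclideanSpace ℝ (Fin k) := fun j => WithLp.toLp 2 fun i => O₁ i j
  let U : Submodule ℝ (EuclideanSpace ℝ (Fin k)) := Submodule.span ℝ (Set.range col)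
  have hU : Module.finrank ℝ U ≤ n := by
    have := finrank_range_le_card (R := ℝ) col
    rwa [Fintype.card_fin] at this
  have hUo : k - n ≤ Module.finrank ℝ Uᗮ := by
    have := U.finrank_add_finrank_orthogonal
    rw [finrank_euclideanSpace_fin] at this
    omega
  let b := stdOrthonormalBasis ℝ Uᗮ
  refine ⟨Matrix.of fun i j => ((b (Fin.castLE hUo j) : Uᗮ) : EuclideanSpace ℝ (Fin k)) i, ?_, ?_⟩
  · ext i j
    have h1 := orthonormal_iff_ite.mp b.orthonormal (Fin.castLE hUo i) (Fin.castLE hUo j)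
    rw [Submodule.coe_inner, PiLp.inner_apply] at h1
    simp only [mul_apply, transpose_apply, of_apply, one_apply]
    have h2 : (Fin.castLE hUo i = Fin.castLE hUo j) ↔ i = j := by simp
    simp only [h2] at h1
    rw [← h1]
    refine Finset.sum_congr rfl fun l _ => ?_
    simp [mul_comm]
  · ext i j
    have h1 : inner ℝ (col i) ((b (Fin.castLE hUo j) : Uᗮ) : EuclideanSpace ℝ (Fin k)) = 0 :=
      (Submodule.mem_orthogonal _ _).mp (b (Fin.castLE hUo j)).2 _
        (Submodule.subset_span ⟨i, rfl⟩)
    rw [PiLp.inner_apply] at h1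
    simp only [mul_apply, transpose_apply, of_apply, Matrix.zero_apply]
    rw [← h1]
    refine Finset.sum_congr rfl fun l _ => ?_
    simp [col, mul_comm]

/-- The directions of `W` orthogonal to the projection of `V` lie in `Vᗮ`, so the vectors have
components of size `O(h)` along them; in the remaining `n` directions they are controlled by `t`.
Algebraically, let `ω` complete the columns of `O₁` by orthonormal ones: `M [O₁ ω]` factors as a
bounded matrix times the block diagonal of `t` and `h`, and `det [O₁ ω] ^ 2 = det (O₁ᵀ O₁)`. -/
lemma det_sq_mul_det_le (hO : O₁ * O₁ᵀ + O₂ * O₂ᵀ = 1) (h1 : c₁ * t = M * O₁)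
    (h2 : h • c₂ = M * O₂) (hc₁ : ∀ i j, |c₁ i j| ≤ 1) (hc₂ : ∀ i j, |c₂ i j| ≤ 1) (hnk : n ≤ k) :
    M.det ^ 2 * (O₁ᵀ * O₁).det ≤
      (k.factorial * (1 + m * k : ℝ) ^ k) ^ 2 * t.det ^ 2 * h ^ (2 * (k - n)) := by
  obtain ⟨ω, hω1, hω2⟩ := exists_orthonormal_complement_columns O₁ hnk
  let e : Fin n ⊕ Fin (k - n) ≃ Fin k := finSumFinEquiv.trans (finCongr (by omega))
  let Z : Matrix (Fin k) (Fin n ⊕ Fin (k - n)) ℝ := fromCols O₁ ω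
  let Y : Matrix (Fin k) (Fin n ⊕ Fin (k - n)) ℝ := fromCols c₁ (c₂ * O₂ᵀ * ω)
  let D : Matrix (Fin n ⊕ Fin (k - n)) (Fin n ⊕ Fin (k - n)) ℝ := fromBlocks t 0 0 (h • 1)
  have hω3 : ωᵀ * O₁ = 0 := by
    rw [← transpose_transpose O₁, ← transpose_mul, hω2, transpose_zero]
  have hZZ : Zᵀ * Z = fromBlocks (O₁ᵀ * O₁) 0 0 1 := by
    simp only [Z, transpose_fromCols, fromRows_mul_fromCols, hω1, hω2, hω3]
  -- Orthogonality of `ω` to the columns of `O₁` removes the part of `ω` along `V`, leaving only the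
  -- `h`-bounded block `M * O₂`.
  have hωe : ω = O₂ * O₂ᵀ * ω := by
    calc ω = (O₁ * O₁ᵀ + O₂ * O₂ᵀ) * ω := by rw [hO, Matrix.one_mul]
      _ = _ := by rw [Matrix.add_mul, Matrix.mul_assoc O₁, hω2, Matrix.mul_zero, zero_add]
  have hMZ : M * Z = Y * D := by
    simp only [Z, Y, D, mul_fromCols, fromCols_mul_fromBlocks, Matrix.mul_zero, add_zero, zero_add,
      Matrix.mul_smul, Matrix.mul_one, h1]
    congr 1
    conv_lhs => rw [hωe]
    rw [← Matrix.mul_assoc, ← Matrix.mul_assoc, ← h2, Matrix.smul_mul, Matrix.smul_mul]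
  have hdetZ : (Z.submatrix id e.symm).det ^ 2 = (O₁ᵀ * O₁).det := by
    calc (Z.submatrix id e.symm).det ^ 2
        = ((Z.submatrix id e.symm)ᵀ * Z.submatrix id e.symm).det := by
          rw [det_mul, det_transpose, sq]
      _ = ((Zᵀ * Z).submatrix e.symm e.symm).det := by
          rw [transpose_submatrix]
          congr 1
      _ = _ := by rw [det_submatrix_equiv_self, hZZ, det_fromBlocks_zero₂₁, det_one, mul_one]
  have hdet : M.det * (Z.submatrix id e.symm).det =
      (Y.submatrix id e.symm).det * (t.det * h ^ (k - n)) := by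
    have hD : (D.submatrix e.symm e.symm).det = t.det * h ^ (k - n) := by
      rw [det_submatrix_equiv_self]
      simp [D, det_fromBlocks_zero₂₁]
    rw [← hD, ← det_mul, ← det_mul]
    congr 1
    calc M * Z.submatrix id e.symm = (M * Z).submatrix id e.symm := rfl
      _ = (Y * D).submatrix id e.symm := by rw [hMZ]
      _ = _ := (submatrix_mul_equiv Y D id e.symm e.symm).symm
  have hωb : ∀ i j, |ω i j| ≤ 1 := by
    intro i j
    have h3 := congrFun (congrFun hω1 j) j
    simp only [mul_apply, transpose_apply, one_apply_eq] at h3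
    have h4 := Finset.single_le_sum (f := fun i => ω i j * ω i j)
      (fun j _ => mul_self_nonneg _) (Finset.mem_univ i)
    exact abs_le_one_iff_mul_self_le_one.mpr (by linarith)
  have hY : ∀ i j, |Y i j| ≤ 1 + m * k := by
    rintro i (j | j)
    · simp only [Y, fromCols_apply_inl]
      have : (0 : ℝ) ≤ m * k := by positivity
      linarith [hc₁ i j]
    · simp only [Y, fromCols_apply_inr]
      have hO2 := (abs_le_one_of_mul_transpose_add O₁ O₂ hO).2
      have h5 := abs_mul_apply_le (c₂ * O₂ᵀ) ω (m : ℝ) 1 (by positivity)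
        (fun a b => by
          simpa using abs_mul_apply_le c₂ O₂ᵀ 1 1 zero_le_one hc₂ (fun a b => hO2 b a) a b) hωb i j
      rw [Fintype.card_fin, mul_one] at h5
      linarith [mul_comm (m : ℝ) k]
  have hYd := abs_det_le_of_row_bound (Y.submatrix id e.symm) (fun _ => (1 + m * k : ℝ))
    fun i j => hY _ _
  rw [Finset.prod_const, Finset.card_univ, Fintype.card_fin] at hYd
  have hYd2 : (Y.submatrix id e.symm).det ^ 2 ≤ (k.factorial * (1 + m * k : ℝ) ^ k) ^ 2 := by
    rw [← sq_abs]
    exact pow_le_pow_left₀ (abs_nonneg _) hYd 2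
  calc M.det ^ 2 * (O₁ᵀ * O₁).det = (M.det * (Z.submatrix id e.symm).det) ^ 2 := by
        rw [← hdetZ]; ring
    _ = (Y.submatrix id e.symm).det ^ 2 * (t.det ^ 2 * h ^ (2 * (k - n))) := by
        rw [hdet]; ring
    _ ≤ (k.factorial * (1 + m * k : ℝ) ^ k) ^ 2 * (t.det ^ 2 * h ^ (2 * (k - n))) := by
        refine mul_le_mul_of_nonneg_right hYd2 ?_
        rw [pow_mul]; positivity
    _ = _ := by ring

/-- Expanding multilinearly in the rows, a choice that repeats a row of `A` contributes zero. Hence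
each `β i` is used at most once, and the unused ones may be inserted because they are at least `1`.
This keeps the bound independent of the size of `k` relative to `n` and `m`. -/
lemma abs_det_le_of_mul {ι κ : Type*} [Fintype ι] [DecidableEq ι] [Fintype κ] [DecidableEq κ]
    (c : Matrix κ ι ℝ) (A : Matrix ι κ ℝ) (β : ι → ℝ) (hβ : ∀ i, 1 ≤ β i)
    (hc : ∀ i j, |c i j| ≤ 1) (hA : ∀ i j, |A i j| ≤ β i) :
    |(c * A).det| ≤
      (Fintype.card ι : ℝ) ^ Fintype.card κ * ((Fintype.card κ).factorial * ∏ i, β i) := by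
  have h1 : (c * A).det = ∑ r : κ → ι, detRowAlternating fun j => c j (r j) • A (r j) := by
    have h2 : c * A = fun j => ∑ i, c j i • A i := by
      ext j l
      simp [mul_apply]
    have h3 := (detRowAlternating (R := ℝ) (n := κ)).toMultilinearMap.map_sum
      (fun j i => c j i • A i)
    rw [h2]
    exact h3
  rw [h1]
  refine (Finset.abs_sum_le_sum_abs _ _).trans ?_
  have hβ0 : ∀ i, 0 ≤ β i := fun i => zero_le_one.trans (hβ i)
  refine (Finset.sum_le_card_nsmul _ _ ((Fintype.card κ).factorial * ∏ i, β i)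
    fun r _ => ?_).trans ?_
  · by_cases hr : Function.Injective r
    · refine (abs_det_le_of_row_bound (fun j => c j (r j) • A (r j)) (fun j => β (r j))
        fun j l => ?_).trans ?_
      · simp only [Pi.smul_apply, smul_eq_mul, abs_mul]
        calc |c j (r j)| * |A (r j) l| ≤ 1 * β (r j) :=
              mul_le_mul (hc _ _) (hA _ _) (abs_nonneg _) zero_le_one
          _ = _ := one_mul _
      · have h4 : ∏ j, β (r j) = ∏ i ∈ Finset.univ.map ⟨r, hr⟩, β i := by
          rw [Finset.prod_map]; rfl
        rw [h4]
        have h5 : ∏ i ∈ Finset.univ.map ⟨r, hr⟩, β i ≤ ∏ i, β i := by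
          rw [← Finset.prod_mul_prod_compl (Finset.univ.map ⟨r, hr⟩)]
          refine le_mul_of_one_le_right (Finset.prod_nonneg fun i _ => hβ0 i) ?_
          simpa using Finset.prod_le_prod (s := (Finset.univ.map ⟨r, hr⟩)ᶜ) (f := fun _ => (1 : ℝ))
            (fun _ _ => zero_le_one) fun i _ => hβ i
        gcongr
    · simp only [Function.Injective, not_forall] at hr
      obtain ⟨a, b, hab, hne⟩ := hr
      rw [AlternatingMap.map_smul_univ, AlternatingMap.map_eq_zero_of_eq _ _ (i := a) (j := b)
        (by simp only [hab]) hne, smul_zero, abs_zero]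
      exact mul_nonneg (Nat.cast_nonneg _) (Finset.prod_nonneg fun i _ => hβ0 i)
  · simp

/-- A crude bound that needs no transversality: `M` is a bounded matrix times `n` rows of size `Q`
stacked on `m` rows of size `H`. It later serves to bound the product of successive minima. -/
lemma abs_det_le_pow (hO : O₁ * O₁ᵀ + O₂ * O₂ᵀ = 1) (h1 : c₁ * t = M * O₁)
    (h2 : h • c₂ = M * O₂) (hc₁ : ∀ i j, |c₁ i j| ≤ 1) (hc₂ : ∀ i j, |c₂ i j| ≤ 1)
    (Q H : ℝ) (hQ : 1 ≤ Q) (hH : 1 ≤ H) (hhH : |h| ≤ H) (ht : ∀ i j, |t i j| ≤ Q) :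
    |M.det| ≤ (n + m : ℝ) ^ k * (k.factorial * (((n + 1) * Q) ^ n * H ^ m)) := by
  have hOb := abs_le_one_of_mul_transpose_add O₁ O₂ hO
  have hM : M = fromCols c₁ c₂ * fromRows (t * O₁ᵀ) (h • O₂ᵀ) := by
    rw [fromCols_mul_fromRows, ← Matrix.mul_assoc, h1, Matrix.mul_smul, ← Matrix.smul_mul, h2, Matrix.mul_assoc,
      Matrix.mul_assoc, ← Matrix.mul_add, hO, Matrix.mul_one]
  have := abs_det_le_of_mul (fromCols c₁ c₂) (fromRows (t * O₁ᵀ) (h • O₂ᵀ))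
    (Sum.elim (fun _ => (n + 1) * Q) fun _ => H) ?_ ?_ ?_
  · rw [← hM] at this
    simpa [Fintype.prod_sum_type] using this
  · rintro (i | i)
    · simp only [Sum.elim_inl]
      have : (0 : ℝ) ≤ n * Q := by positivity
      linarith
    · simpa using hH
  · rintro i (j | j)
    · simpa using hc₁ i j
    · simpa using hc₂ i j
  · rintro (i | i) j
    · simp only [fromRows_apply_inl, Sum.elim_inl]
      have := abs_mul_apply_le t O₁ᵀ Q 1 (by linarith) ht (fun a b => hOb.1 b a) i j
      rw [Fintype.card_fin, mul_one] at this
      linarith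
    · simp only [fromRows_apply_inr, Sum.elim_inr, Matrix.smul_apply, smul_eq_mul, abs_mul, transpose_apply]
      calc |h| * |O₂ j i| ≤ H * 1 := mul_le_mul hhH (hOb.2 j i) (abs_nonneg _) (by linarith)
        _ = H := mul_one H

end MatrixBounds

/-! ### Volumes of projections and their recursion. -/

section ProjectedGram

variable {E : Type*} [NormedAddCommGroup E] [InnerProductSpace ℝ E] [FiniteDimensional ℝ E]

/-- The Gram determinant of the orthogonal projections of the vectors `x i` to `U`. -/
noncomputable def projGram {n : ℕ} (U : Submodule ℝ E) (x : Fin n → E) : ℝ :=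
  (Matrix.of fun i j => inner ℝ (U.starProjection (x i)) (U.starProjection (x j))).det

lemma projGram_zero (U : Submodule ℝ E) (x : Fin 0 → E) : projGram U x = 1 :=
  Matrix.det_isEmpty

lemma continuous_projGram {n : ℕ} (U : Submodule ℝ E) :
    Continuous fun x : Fin n → E => projGram U x := by
  unfold projGram
  refine Continuous.matrix_det ?_
  refine continuous_matrix fun i j => ?_
  simp only [Matrix.of_apply]
  fun_prop

/-- Within `U`, being orthogonal to `x` means being orthogonal to the projection of `x`; so
projecting to `U ⊓ xᗮ` is projecting to `U` and then removing the component along that projection.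
-/
lemma inner_starProjection_inf_orthogonal (U : Submodule ℝ E) {x : E}
    (hx : U.starProjection x ≠ 0) (y z : E) :
    inner ℝ ((U ⊓ (Submodule.span ℝ {x})ᗮ).starProjection y)
        ((U ⊓ (Submodule.span ℝ {x})ᗮ).starProjection z) =
      inner ℝ (U.starProjection y) (U.starProjection z) -
        inner ℝ (U.starProjection y) (U.starProjection x) / ‖U.starProjection x‖ ^ 2 *
          inner ℝ (U.starProjection x) (U.starProjection z) := by
  set p := U.starProjection x with hp
  have hpn : ‖p‖ ^ 2 ≠ 0 := pow_ne_zero 2 (norm_ne_zero_iff.mpr hx)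
  have key : ∀ y, (U ⊓ (Submodule.span ℝ {x})ᗮ).starProjection y =
      U.starProjection y - (inner ℝ (U.starProjection y) p / ‖p‖ ^ 2) • p := by
    intro y
    have hpU : p ∈ U := U.starProjection_apply_mem x
    have hyU : U.starProjection y ∈ U := U.starProjection_apply_mem y
    have hinner : ∀ w ∈ U, inner ℝ x w = inner ℝ p w := by
      intro w hw
      rw [hp, U.inner_starProjection_left_eq_right, U.starProjection_eq_self_iff.mpr hw]
    refine Submodule.eq_starProjection_of_mem_of_inner_eq_zero ⟨?_, ?_⟩ ?_
    · exact U.sub_mem hyU (U.smul_mem _ hpU)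
    · rw [SetLike.mem_coe, Submodule.mem_orthogonal_singleton_iff_inner_right,
        hinner _ (U.sub_mem hyU (U.smul_mem _ hpU)), inner_sub_right, inner_smul_right,
        real_inner_self_eq_norm_sq, div_mul_cancel₀ _ hpn, real_inner_comm, sub_self]
    · rintro w ⟨hw, hw2⟩
      rw [SetLike.mem_coe, Submodule.mem_orthogonal_singleton_iff_inner_right, hinner w hw] at hw2
      rw [sub_sub_eq_add_sub, add_sub_right_comm, inner_add_left, inner_smul_left, hw2, mul_zero,
        add_zero, inner_sub_left, U.inner_starProjection_left_eq_right,
        U.starProjection_eq_self_iff.mpr hw, sub_self]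
  rw [key y, key z, inner_sub_left, inner_sub_right, inner_sub_right, inner_smul_left,
    inner_smul_left, inner_smul_right, inner_smul_right, real_inner_self_eq_norm_sq,
    real_inner_comm p (U.starProjection z)]
  simp only [conj_trivial]
  field_simp
  ring

/-- Base times height for projected volumes. Clearing the first column of the Gram matrix leaves the
Gram matrix of the other vectors projected to `U ⊓ xᗮ`, which permits integrating over one vector at
a time. -/
lemma projGram_cons {n : ℕ} (U : Submodule ℝ E) (x : E) (xs : Fin n → E) :
    projGram U (Fin.cons x xs : Fin (n + 1) → E) =
      ‖U.starProjection x‖ ^ 2 * projGram (U ⊓ (Submodule.span ℝ {x})ᗮ) xs := by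
  by_cases hx : U.starProjection x = 0
  · rw [hx, norm_zero, zero_pow two_ne_zero, zero_mul]
    exact Matrix.det_eq_zero_of_row_eq_zero 0 fun j => by simp [hx]
  set A : Matrix (Fin (n + 1)) (Fin (n + 1)) ℝ := Matrix.of fun i j =>
    inner ℝ (U.starProjection ((Fin.cons x xs : Fin (n + 1) → E) i))
      (U.starProjection ((Fin.cons x xs : Fin (n + 1) → E) j)) with hA
  have hpn : ‖U.starProjection x‖ ^ 2 ≠ 0 := pow_ne_zero 2 (norm_ne_zero_iff.mpr hx)
  let c : Fin (n + 1) → ℝ := Fin.cons 0 fun i => A i.succ 0 / ‖U.starProjection x‖ ^ 2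
  let B : Matrix (Fin (n + 1)) (Fin (n + 1)) ℝ := Matrix.of fun i j => A i j - c i * A 0 j
  have hAB : A.det = B.det := by
    refine Matrix.det_eq_of_forall_row_eq_smul_add_const c 0 rfl fun i j => ?_
    simp [B, c]
  have hA00 : A 0 0 = ‖U.starProjection x‖ ^ 2 := by
    simp [hA]
  have hB0 : ∀ i : Fin n, B i.succ 0 = 0 := by
    intro i
    simp only [B, c, Matrix.of_apply, Fin.cons_succ, hA00]
    rw [div_mul_cancel₀ _ hpn, sub_self]
  have hB00 : B 0 0 = ‖U.starProjection x‖ ^ 2 := by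
    simp [B, c, hA00]
  change A.det = _
  rw [hAB, Matrix.det_succ_column_zero, Fin.sum_univ_succ]
  simp only [hB0, hB00, mul_zero, zero_mul, Finset.sum_const_zero, add_zero, Fin.val_zero, pow_zero,
    one_mul, Fin.succAbove_zero]
  congr 2
  ext i j
  rw [Matrix.of_apply, inner_starProjection_inf_orthogonal U hx]
  simp [B, c, hA]

lemma projGram_nonneg {n : ℕ} (U : Submodule ℝ E) (x : Fin n → E) : 0 ≤ projGram U x := by
  induction n generalizing U with
  | zero => rw [projGram_zero]; exact zero_le_one
  | succ n ih =>
    rw [← Fin.cons_self_tail x, projGram_cons]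
    exact mul_nonneg (sq_nonneg _) (ih _ _)

lemma projGram_sum_smul {n : ℕ} (U : Submodule ℝ E) (x : Fin n → E) (M : Matrix (Fin n) (Fin n) ℝ) :
    projGram U (fun i => ∑ j, M i j • x j) = M.det ^ 2 * projGram U x := by
  have : (Matrix.of fun i j => inner ℝ (U.starProjection (∑ l, M i l • x l))
      (U.starProjection (∑ l, M j l • x l))) =
      M * (Matrix.of fun i j => inner ℝ (U.starProjection (x i)) (U.starProjection (x j))) *
        M.transpose := by
    ext i j
    simp only [Matrix.mul_apply, Matrix.of_apply, map_sum, map_smul, sum_inner, inner_sum,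
      inner_smul_left, inner_smul_right, Matrix.transpose_apply, Finset.sum_mul, conj_trivial]
    refine Finset.sum_congr rfl fun a _ => ?_
    rw [Finset.mul_sum]
    refine Finset.sum_congr rfl fun b _ => ?_
    rw [real_inner_comm]
    ring
  unfold projGram
  rw [this, Matrix.det_mul, Matrix.det_mul, Matrix.det_transpose]
  ring

lemma finrank_le_finrank_inf_orthogonal_add_one (U : Submodule ℝ E) (x : E) :
    Module.finrank ℝ U ≤ Module.finrank ℝ (U ⊓ (Submodule.span ℝ {x})ᗮ : Submodule ℝ E) + 1 := by
  have h1 := Submodule.finrank_sup_add_finrank_inf_eq U (Submodule.span ℝ {x})ᗮ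
  have h2 := (Submodule.span ℝ {x}).finrank_add_finrank_orthogonal
  have h3 : Module.finrank ℝ (Submodule.span ℝ {x}) ≤ 1 := by
    simpa using finrank_span_le_card (R := ℝ) ({x} : Set E)
  have h4 := Submodule.finrank_le (U ⊔ (Submodule.span ℝ {x})ᗮ)
  omega

end ProjectedGram

/-! ### Negative moments over products of balls. -/

lemma lintegral_pi_fin_succ {α : Type*} [MeasurableSpace α] (μ : Measure α) [SigmaFinite μ] {n : ℕ}
    (F : (Fin (n + 1) → α) → ENNReal) (hF : Measurable F) :
    ∫⁻ x, F x ∂(Measure.pi fun _ => μ) =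
      ∫⁻ a, ∫⁻ xs, F (Fin.cons a xs : Fin (n + 1) → α) ∂(Measure.pi fun _ => μ) ∂μ := by
  have h := measurePreserving_piFinSuccAbove (fun _ : Fin (n + 1) => μ) 0
  have h' := h.symm
  have hcons : ∀ p : α × (Fin n → α),
      (MeasurableEquiv.piFinSuccAbove (fun _ : Fin (n + 1) => α) 0).symm p =
        (Fin.cons p.1 p.2 : Fin (n + 1) → α) := fun p => Fin.insertNth_zero' p.1 p.2
  rw [← h'.lintegral_comp hF]
  have hF' := hF.comp h'.measurable
  simp only [Function.comp_def, hcons] at hF' ⊢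
  exact lintegral_prod (μ := μ) (ν := Measure.pi fun _ => μ)
    (fun p => F (Fin.cons p.1 p.2 : Fin (n + 1) → α)) hF'.aemeasurable

lemma lintegral_pi_fin_prod {α : Type*} [MeasurableSpace α] (μ : Measure α) [SigmaFinite μ] (n : ℕ)
    (f : α → ENNReal) (hf : Measurable f) :
    ∫⁻ x : Fin n → α, ∏ i, f (x i) ∂(Measure.pi fun _ => μ) = (∫⁻ a, f a ∂μ) ^ n := by
  induction n with
  | zero => simp
  | succ n ih =>
    rw [lintegral_pi_fin_succ μ _ (by fun_prop)]
    simp only [Fin.prod_univ_succ, Fin.cons_zero, Fin.cons_succ]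
    have : ∀ a, ∫⁻ xs : Fin n → α, f a * ∏ i, f (xs i) ∂(Measure.pi fun _ => μ) =
        f a * (∫⁻ a, f a ∂μ) ^ n := fun a => by
      rw [lintegral_const_mul _ (by fun_prop), ih]
    simp only [this]
    rw [lintegral_mul_const _ hf, pow_succ']

lemma lintegral_inv_rpow_ne_top (θ : ℝ) (hθ : θ < 1) :
    ∫⁻ t in Set.Icc (-1 : ℝ) 1, (ENNReal.ofReal (|t| ^ θ))⁻¹ ≠ ⊤ := by
  have h1 : IntegrableOn (fun t : ℝ => |t| ^ (-θ)) (Set.Icc (-1) 1) := by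
    have h0 : IntegrableOn (fun t : ℝ => |t| ^ (-θ)) (Set.Ioc 0 1) := by
      have := (intervalIntegral.intervalIntegrable_rpow' (a := 0) (b := 1) (r := -θ)
        (by linarith)).1
      refine this.congr_fun (fun t ht => ?_) measurableSet_Ioc
      rw [abs_of_pos ht.1]
    have h2 : IntegrableOn (fun t : ℝ => |t| ^ (-θ)) (Set.Ico (-1) 0) := by
      have := h0.comp_neg
      simpa using this
    have h3 : Set.Icc (-1 : ℝ) 1 ⊆ Set.Ico (-1) 0 ∪ ({0} ∪ Set.Ioc 0 1) := by
      intro t ht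
      rcases lt_trichotomy t 0 with h | h | h
      · exact Or.inl ⟨ht.1, h⟩
      · exact Or.inr (Or.inl h)
      · exact Or.inr (Or.inr ⟨h, ht.2⟩)
    exact (h2.union ((integrableOn_singleton (hx := by
      rw [Real.volume_singleton]; exact ENNReal.zero_lt_top)).union h0)).mono_set h3
  have h2 := h1.lintegral_lt_top
  refine ne_top_of_le_ne_top h2.ne ?_
  have h3 : ∀ᵐ t : ℝ ∂volume.restrict (Set.Icc (-1) 1), t ≠ 0 :=
    ae_restrict_of_ae (compl_mem_ae_iff.mpr Real.volume_singleton)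
  refine lintegral_mono_ae (h3.mono fun t ht => ?_)
  have : 0 < |t| := abs_pos.mpr ht
  rw [Real.rpow_neg this.le, ENNReal.ofReal_inv_of_pos (Real.rpow_pos_of_pos this θ)]

section Averages

variable {E : Type*} [NormedAddCommGroup E] [InnerProductSpace ℝ E] [FiniteDimensional ℝ E]

lemma exists_orthonormalBasis_extending {N : ℕ} (hN : Module.finrank ℝ E = N) {κ : Type*}
    (φ : κ ↪ Fin N) (v : κ → E) (hv : Orthonormal ℝ v) :
    ∃ y : OrthonormalBasis (Fin N) ℝ E, ∀ i, y (φ i) = v i := by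
  let w : Fin N → E := Function.extend φ v 0
  have hw : ∀ i, w (φ i) = v i := fun i => φ.injective.extend_apply v 0 i
  have hon : Orthonormal ℝ ((Set.range φ).domRestrict w) := by
    let e := Equiv.ofInjective φ φ.injective
    have : (Set.range φ).domRestrict w = v ∘ e.symm := by
      ext ⟨_, i, rfl⟩
      simp [e, hw]
    rw [this]
    exact hv.comp _ e.symm.injective
  obtain ⟨y, hy⟩ := Orthonormal.exists_orthonormalBasis_extension_of_card_eq
    (by rw [hN, Fintype.card_fin]) hon
  exact ⟨y, fun i => by rw [hy _ ⟨i, rfl⟩, hw]⟩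

/-- Each factor is at most `‖U.starProjection x‖ ≤ 1`, so the total exponent `θ * s.card` may be
lowered to `a`. This dominates a singularity along a subspace by a product of one-variable
singularities. -/
lemma prod_abs_inner_rpow_le {ι : Type*} (U : Submodule ℝ E) (s : Finset ι)
    (y : ι → E) (hy : ∀ i, ‖y i‖ = 1) (hU : ∀ i ∈ s, y i ∈ U) (a : ℕ) (θ : ℝ) (hθ : 0 ≤ θ)
    (ha : a ≤ θ * s.card) (ha' : a = 0 ∨ 0 < s.card) (x : E) (hx : ‖x‖ ≤ 1) :
    ∏ i ∈ s, |inner ℝ (y i) x| ^ θ ≤ ‖U.starProjection x‖ ^ a := by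
  have hPx : ‖U.starProjection x‖ ≤ 1 := (U.norm_starProjection_apply_le x).trans hx
  have h1 : ∀ i ∈ s, |inner ℝ (y i) x| ≤ ‖U.starProjection x‖ := by
    intro i hi
    have : inner ℝ (y i) x = inner ℝ (y i) (U.starProjection x) := by
      rw [← U.inner_starProjection_left_eq_right, U.starProjection_eq_self_iff.mpr (hU i hi)]
    rw [this]
    simpa [hy i] using abs_real_inner_le_norm (y i) (U.starProjection x)
  calc ∏ i ∈ s, |inner ℝ (y i) x| ^ θ ≤ ∏ i ∈ s, ‖U.starProjection x‖ ^ θ :=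
        Finset.prod_le_prod (fun i _ => Real.rpow_nonneg (abs_nonneg _) _) fun i hi =>
          Real.rpow_le_rpow (abs_nonneg _) (h1 i hi) hθ
    _ = ‖U.starProjection x‖ ^ (θ * s.card) := by
        rw [Finset.prod_const, Real.rpow_mul_natCast (norm_nonneg _)]
    _ ≤ ‖U.starProjection x‖ ^ (a : ℝ) := by
        rcases (norm_nonneg (U.starProjection x)).eq_or_lt with h0 | h0
        · rcases ha' with rfl | hs
          · rw [← h0, Nat.cast_zero, Real.rpow_zero]
            exact Real.zero_rpow_le_one _
          · rcases Nat.eq_zero_or_pos a with rfl | hapos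
            · rw [← h0, Nat.cast_zero, Real.rpow_zero]
              exact Real.zero_rpow_le_one _
            · have h2 : (0 : ℝ) < a := by exact_mod_cast hapos
              rw [← h0, Real.zero_rpow h2.ne', Real.zero_rpow (h2.trans_le ha).ne']
        · exact Real.rpow_le_rpow_of_exponent_ge h0 hPx ha
    _ = _ := Real.rpow_natCast _ _

variable [MeasurableSpace E] [BorelSpace E]

/-- In an orthonormal basis adapted to both orthogonal subspaces, the integrand is at most a product
of functions `|t| ^ (-θ)` of single coordinates, and Tonelli on the enclosing cube gives a bound
independent of the subspaces. -/
lemma lintegral_closedBall_le (N : ℕ) (hN : Module.finrank ℝ E = N) (U₁ U₂ : Submodule ℝ E)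
    (hU : U₁ ⟂ U₂) (a b : ℕ) (ha : a = 0 ∨ a + 1 ≤ Module.finrank ℝ U₁)
    (hb : b = 0 ∨ b + 1 ≤ Module.finrank ℝ U₂) :
    ∫⁻ x in Metric.closedBall (0 : E) 1,
        (ENNReal.ofReal (‖U₁.starProjection x‖ ^ a * ‖U₂.starProjection x‖ ^ b))⁻¹ ≤
      (∫⁻ t in Set.Icc (-1 : ℝ) 1, (ENNReal.ofReal (|t| ^ (N / (N + 1) : ℝ)))⁻¹) ^ N := by
  classical
  -- One exponent for all coordinates: below `1`, hence integrable, yet `a ≤ θ * d` whenever `a + 1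
  -- ≤ d ≤ N`.
  set θ : ℝ := N / (N + 1) with hθ
  have hθ0 : 0 ≤ θ := by positivity
  let b₁ := stdOrthonormalBasis ℝ U₁
  let b₂ := stdOrthonormalBasis ℝ U₂
  let v : Fin (Module.finrank ℝ U₁) ⊕ Fin (Module.finrank ℝ U₂) → E :=
    Sum.elim (fun i => (b₁ i : E)) fun i => (b₂ i : E)
  have hv : Orthonormal ℝ v := by
    constructor
    · rintro (i | i)
      · exact b₁.orthonormal.1 i
      · exact b₂.orthonormal.1 i
    · rintro (i | i) (j | j) hij
      · exact b₁.orthonormal.2 (fun h => hij (by rw [h]))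
      · exact Submodule.isOrtho_iff_inner_eq.mp hU _ (b₁ i).2 _ (b₂ j).2
      · exact Submodule.isOrtho_iff_inner_eq.mp hU.symm _ (b₂ i).2 _ (b₁ j).2
      · exact b₂.orthonormal.2 (fun h => hij (by rw [h]))
  have hle : Module.finrank ℝ U₁ + Module.finrank ℝ U₂ ≤ N := by
    have := hv.linearIndependent.fintype_card_le_finrank
    simpa [hN] using this
  let φ : Fin (Module.finrank ℝ U₁) ⊕ Fin (Module.finrank ℝ U₂) ↪ Fin N :=
    (finSumFinEquiv.toEmbedding).trans (Fin.castLEEmb hle)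
  obtain ⟨y, hy⟩ := exists_orthonormalBasis_extending hN φ v hv
  let s₁ : Finset (Fin N) := Finset.univ.map (Function.Embedding.inl.trans φ)
  let s₂ : Finset (Fin N) := Finset.univ.map (Function.Embedding.inr.trans φ)
  have hdisj : Disjoint s₁ s₂ := by
    rw [Finset.disjoint_left]
    intro i h1 h2
    obtain ⟨p, -, rfl⟩ := Finset.mem_map.mp h1
    obtain ⟨q, -, hq⟩ := Finset.mem_map.mp h2
    have := φ.injective hq
    simp at this
  have hs₁ : s₁.card = Module.finrank ℝ U₁ := by simp [s₁]
  have hs₂ : s₂.card = Module.finrank ℝ U₂ := by simp [s₂]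
  have hexp : ∀ a d : ℕ, (a = 0 ∨ a + 1 ≤ d) → d ≤ N → (a : ℝ) ≤ θ * d := by
    rintro a d (rfl | h) hd
    · rw [Nat.cast_zero]; positivity
    · rw [hθ, div_mul_eq_mul_div, le_div_iff₀ (by positivity)]
      have h1 : (a : ℝ) + 1 ≤ d := by exact_mod_cast h
      have h2 : (d : ℝ) ≤ N := by exact_mod_cast hd
      nlinarith
  have hpoint : ∀ x : E, ‖x‖ ≤ 1 → ∏ i, |inner ℝ (y i) x| ^ θ ≤
      ‖U₁.starProjection x‖ ^ a * ‖U₂.starProjection x‖ ^ b := by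
    intro x hx
    have h1 := prod_abs_inner_rpow_le U₁ s₁ y (fun i => y.orthonormal.1 i) (fun i hi => by
      obtain ⟨p, -, rfl⟩ := Finset.mem_map.mp hi
      have : y (φ (Sum.inl p)) = b₁ p := hy _
      simp [this]) a θ hθ0 (by rw [hs₁]; exact hexp _ _ ha (by omega)) (by rw [hs₁]; omega) x hx
    have h2 := prod_abs_inner_rpow_le U₂ s₂ y (fun i => y.orthonormal.1 i) (fun i hi => by
      obtain ⟨p, -, rfl⟩ := Finset.mem_map.mp hi
      have : y (φ (Sum.inr p)) = b₂ p := hy _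
      simp [this]) b θ hθ0 (by rw [hs₂]; exact hexp _ _ hb (by omega)) (by rw [hs₂]; omega) x hx
    have hnn : ∀ i, 0 ≤ |inner ℝ (y i) x| ^ θ := fun i => Real.rpow_nonneg (abs_nonneg _) _
    refine le_trans ?_ (mul_le_mul h1 h2 (Finset.prod_nonneg fun i _ => hnn i) (by positivity))
    rw [← Finset.prod_union hdisj, ← Finset.prod_mul_prod_compl (s₁ ∪ s₂)]
    refine mul_le_of_le_one_right (Finset.prod_nonneg fun i _ => hnn i) ?_
    refine Finset.prod_le_one (fun i _ => hnn i) fun i _ => ?_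
    refine Real.rpow_le_one (abs_nonneg _) ?_ hθ0
    have := abs_real_inner_le_norm (y i) x
    rw [y.orthonormal.1 i, one_mul] at this
    exact this.trans hx
  have hmp : MeasurePreserving (fun x : E => fun i => inner ℝ (y i) x) volume volume := by
    have h1 := (EuclideanSpace.volume_preserving_symm_measurableEquiv_toLp (Fin N)).comp
      y.measurePreserving_repr
    have h2 : (fun x : E => fun i => inner ℝ (y i) x) =
        (MeasurableEquiv.toLp 2 (Fin N → ℝ)).symm ∘ y.repr := by
      funext x i
      simp [← OrthonormalBasis.repr_apply_apply]
    rw [h2]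
    exact h1
  let f : ℝ → ENNReal := fun t => (ENNReal.ofReal (|t| ^ θ))⁻¹
  have hf : Measurable f := by fun_prop
  calc ∫⁻ x in Metric.closedBall (0 : E) 1,
        (ENNReal.ofReal (‖U₁.starProjection x‖ ^ a * ‖U₂.starProjection x‖ ^ b))⁻¹
      ≤ ∫⁻ x in Metric.closedBall (0 : E) 1, ∏ i, f (inner ℝ (y i) x) := by
        refine setLIntegral_mono' Metric.isClosed_closedBall.measurableSet fun x hx => ?_
        rw [mem_closedBall_zero_iff] at hx
        simp only [f]
        rw [← ENNReal.prod_inv_distrib fun i _ j _ _ => Or.inr ENNReal.ofReal_ne_top]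
        rw [← ENNReal.ofReal_prod_of_nonneg fun i _ => Real.rpow_nonneg (abs_nonneg _) _]
        exact ENNReal.inv_le_inv.mpr (ENNReal.ofReal_le_ofReal (hpoint x hx))
    _ ≤ ∫⁻ x in (fun x : E => fun i => inner ℝ (y i) x) ⁻¹'
          (Set.univ.pi fun _ : Fin N => Set.Icc (-1 : ℝ) 1), ∏ i, f (inner ℝ (y i) x) := by
        refine lintegral_mono_set fun x hx i _ => ?_
        rw [mem_closedBall_zero_iff] at hx
        have := abs_real_inner_le_norm (y i) x
        rw [y.orthonormal.1 i, one_mul] at this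
        exact abs_le.mp (this.trans hx)
    _ = ∫⁻ z in Set.univ.pi fun _ : Fin N => Set.Icc (-1 : ℝ) 1, ∏ i, f (z i) :=
        hmp.setLIntegral_comp_preimage (MeasurableSet.univ_pi fun _ => measurableSet_Icc)
          (Finset.univ.measurable_fun_prod fun i _ => hf.comp (measurable_pi_apply i))
    _ = _ := by
        rw [volume_pi, Measure.restrict_pi_pi, lintegral_pi_fin_prod _ _ f hf]

end Averages

section Averages

variable {E : Type*} [NormedAddCommGroup E] [InnerProductSpace ℝ E] [FiniteDimensional ℝ E]

/-- A negative moment weight: the inverse of a product of powers of the volumes of the projections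
of the vectors `x i` to two subspaces. -/
noncomputable def invGram {n : ℕ} (a b : ℕ) (U₁ U₂ : Submodule ℝ E) (x : Fin n → E) : ENNReal :=
  (ENNReal.ofReal (√(projGram U₁ x) ^ a * √(projGram U₂ x) ^ b))⁻¹

lemma continuous_sqrt_projGram {n : ℕ} (a b : ℕ) (U₁ U₂ : Submodule ℝ E) :
    Continuous fun x : Fin n → E => √(projGram U₁ x) ^ a * √(projGram U₂ x) ^ b :=
  ((continuous_projGram U₁).sqrt.pow a).mul ((continuous_projGram U₂).sqrt.pow b)

lemma measurable_invGram [MeasurableSpace E] [BorelSpace E] {n : ℕ} (a b : ℕ) (U₁ U₂ : Submodule ℝ E) :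
    Measurable fun x : Fin n → E => invGram a b U₁ U₂ x :=
  ((continuous_sqrt_projGram a b U₁ U₂).measurable.ennreal_ofReal).inv

lemma invGram_cons {n : ℕ} (a b : ℕ) (U₁ U₂ : Submodule ℝ E) (x : E) (xs : Fin n → E) :
    invGram a b U₁ U₂ (Fin.cons x xs : Fin (n + 1) → E) =
      (ENNReal.ofReal (‖U₁.starProjection x‖ ^ a * ‖U₂.starProjection x‖ ^ b))⁻¹ *
        invGram a b (U₁ ⊓ (Submodule.span ℝ {x})ᗮ) (U₂ ⊓ (Submodule.span ℝ {x})ᗮ) xs := by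
  unfold invGram
  rw [← ENNReal.mul_inv (Or.inr ENNReal.ofReal_ne_top) (Or.inl ENNReal.ofReal_ne_top),
    ← ENNReal.ofReal_mul (by positivity), projGram_cons, projGram_cons,
    Real.sqrt_mul (sq_nonneg _), Real.sqrt_mul (sq_nonneg _), Real.sqrt_sq (norm_nonneg _),
    Real.sqrt_sq (norm_nonneg _)]
  congr 2
  ring

/-- Fixing the first vector lowers each dimension by at most one, so the margin `n` in the
hypotheses leaves room for every step of the recursion. The alternatives `a = 0` and `b = 0`
accommodate truncated exponents. -/
lemma lintegral_invGram_le [MeasurableSpace E] [BorelSpace E] (N : ℕ) (hN : Module.finrank ℝ E = N) (n a b : ℕ)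
    (U₁ U₂ : Submodule ℝ E) (hU : U₁ ⟂ U₂) (ha : a = 0 ∨ a + n ≤ Module.finrank ℝ U₁)
    (hb : b = 0 ∨ b + n ≤ Module.finrank ℝ U₂) :
    ∫⁻ x : Fin n → E, invGram a b U₁ U₂ x
        ∂(Measure.pi fun _ => volume.restrict (Metric.closedBall 0 1)) ≤
      ((∫⁻ t in Set.Icc (-1 : ℝ) 1, (ENNReal.ofReal (|t| ^ (N / (N + 1) : ℝ)))⁻¹) ^ N) ^ n := by
  induction n generalizing U₁ U₂ with
  | zero => simp [invGram, projGram_zero]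
  | succ n ih =>
    rw [lintegral_pi_fin_succ _ _ (measurable_invGram a b U₁ U₂), pow_succ']
    set C := (∫⁻ t in Set.Icc (-1 : ℝ) 1, (ENNReal.ofReal (|t| ^ (N / (N + 1) : ℝ)))⁻¹) ^ N
    calc _ ≤ ∫⁻ x in Metric.closedBall (0 : E) 1,
          (ENNReal.ofReal (‖U₁.starProjection x‖ ^ a * ‖U₂.starProjection x‖ ^ b))⁻¹ * C ^ n := by
          refine lintegral_mono fun x => ?_
          simp only [invGram_cons]
          rw [lintegral_const_mul _ (measurable_invGram _ _ _ _)]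
          refine mul_le_mul_right (ih _ _ (hU.mono inf_le_left inf_le_left) ?_ ?_) _
          · have := finrank_le_finrank_inf_orthogonal_add_one U₁ x
            omega
          · have := finrank_le_finrank_inf_orthogonal_add_one U₂ x
            omega
      _ = (∫⁻ x in Metric.closedBall (0 : E) 1,
          (ENNReal.ofReal (‖U₁.starProjection x‖ ^ a * ‖U₂.starProjection x‖ ^ b))⁻¹) * C ^ n :=
          lintegral_mul_const _ (by fun_prop)
      _ ≤ C * C ^ n := by
          refine mul_le_mul_left ?_ _
          exact lintegral_closedBall_le N hN U₁ U₂ hU a b (by omega) (by omega)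

end Averages

/-! ### Random frames and Haar measure. -/

section Haar

/-- The vectors `g eᵢ`, `i < n`. -/
noncomputable def rotatedFrame {N n : ℕ} (hn : n ≤ N) (g : SO N) (i : Fin n) :
    EuclideanSpace ℝ (Fin N) :=
  Matrix.toEuclideanLin (g : Matrix (Fin N) (Fin N) ℝ) (EuclideanSpace.single (Fin.castLE hn i) 1)

lemma span_rotatedFrame {N n : ℕ} (hn : n ≤ N) (g : SO N) :
    Submodule.span ℝ (Set.range (rotatedFrame hn g)) = rotatedSubspace n g := by
  unfold rotatedSubspace
  congr 1
  ext x
  constructor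
  · rintro ⟨i, rfl⟩
    exact ⟨Fin.castLE hn i, by simp, rfl⟩
  · rintro ⟨i, hi, rfl⟩
    exact ⟨⟨i, hi⟩, rfl⟩

/-- The isometry of Euclidean space given by an element of `SO(N)`. -/
noncomputable def soIsometry {N : ℕ} (g : SO N) :
    EuclideanSpace ℝ (Fin N) ≃ₗᵢ[ℝ] EuclideanSpace ℝ (Fin N) :=
  LinearEquiv.isometryOfInner
    (LinearEquiv.ofLinearMap (Matrix.toEuclideanLin (g : Matrix (Fin N) (Fin N) ℝ))
      (Matrix.toEuclideanLin ((g⁻¹ : SO N) : Matrix (Fin N) (Fin N) ℝ))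
      (by
        rw [← Matrix.toLpLin_mul_same]
        have : (g : Matrix (Fin N) (Fin N) ℝ) * ((g⁻¹ : SO N) : Matrix (Fin N) (Fin N) ℝ) = 1 :=
          congrArg Subtype.val (mul_inv_cancel g)
        rw [this, Matrix.toLpLin_one])
      (by
        rw [← Matrix.toLpLin_mul_same]
        have : ((g⁻¹ : SO N) : Matrix (Fin N) (Fin N) ℝ) * (g : Matrix (Fin N) (Fin N) ℝ) = 1 :=
          congrArg Subtype.val (inv_mul_cancel g)
        rw [this, Matrix.toLpLin_one]))
    (by
      intro x y
      change inner ℝ (Matrix.toEuclideanLin (g : Matrix (Fin N) (Fin N) ℝ) x)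
        (Matrix.toEuclideanLin (g : Matrix (Fin N) (Fin N) ℝ) y) = inner ℝ x y
      rw [← LinearMap.adjoint_inner_right, ← Matrix.toEuclideanLin_conjTranspose_eq_adjoint]
      change inner ℝ x (((Matrix.toEuclideanLin (g : Matrix (Fin N) (Fin N) ℝ).conjTranspose) ∘ₗ
        (Matrix.toEuclideanLin (g : Matrix (Fin N) (Fin N) ℝ))) y) = _
      rw [← Matrix.toLpLin_mul_same]
      have : (g : Matrix (Fin N) (Fin N) ℝ).conjTranspose * (g : Matrix (Fin N) (Fin N) ℝ) = 1 :=
        congrArg Subtype.val (inv_mul_cancel g)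
      rw [this, Matrix.toLpLin_one]
      rfl)

lemma soIsometry_apply {N : ℕ} (g : SO N) (x : EuclideanSpace ℝ (Fin N)) :
    soIsometry g x = Matrix.toEuclideanLin (g : Matrix (Fin N) (Fin N) ℝ) x := rfl

lemma rotatedFrame_eq {N n : ℕ} (hn : n ≤ N) (g : SO N) (i : Fin n) :
    rotatedFrame hn g i = soIsometry g (EuclideanSpace.single (Fin.castLE hn i) 1) := rfl

lemma soIsometry_mul {N : ℕ} (g g' : SO N) (x : EuclideanSpace ℝ (Fin N)) :
    soIsometry (g * g') x = soIsometry g (soIsometry g' x) := by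
  simp only [soIsometry_apply]
  have : ((g * g' : SO N) : Matrix (Fin N) (Fin N) ℝ) = (g : Matrix (Fin N) (Fin N) ℝ) * g' := rfl
  rw [this, Matrix.toLpLin_mul_same]
  rfl

lemma orthonormal_rotatedFrame {N n : ℕ} (hn : n ≤ N) (g : SO N) :
    Orthonormal ℝ (rotatedFrame hn g) := by
  have h := (EuclideanSpace.basisFun (Fin N) ℝ).orthonormal.comp_linearIsometry
    (soIsometry g).toLinearIsometry
  have h2 := h.comp (Fin.castLE hn) (Fin.castLE_injective hn)
  convert h2 using 1
  funext i
  simp [rotatedFrame_eq]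

lemma continuous_soIsometry {N : ℕ} :
    Continuous fun p : SO N × EuclideanSpace ℝ (Fin N) => soIsometry p.1 p.2 := by
  simp only [soIsometry_apply, Matrix.toLpLin_apply]
  refine (PiLp.continuous_toLp 2 _).comp ?_
  refine Continuous.matrix_mulVec ?_ ?_
  · exact continuous_subtype_val.comp continuous_fst
  · fun_prop

/-- Any `n < N` vectors lie in a rotated copy of the coordinate subspace. -/
lemma exists_rotation_span_le {N n : ℕ} (hn : n < N) (x : Fin n → EuclideanSpace ℝ (Fin N)) :
    ∃ g : SO N, ∀ i, x i ∈ rotatedSubspace n g := by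
  set W := Submodule.span ℝ (Set.range x) with hW
  have hd : Module.finrank ℝ W ≤ n := by
    have := finrank_range_le_card (R := ℝ) x
    rwa [Fintype.card_fin] at this
  let bW := stdOrthonormalBasis ℝ W
  let φ : Fin (Module.finrank ℝ W) ↪ Fin N := Fin.castLEEmb (hd.trans hn.le)
  obtain ⟨y, hy⟩ := exists_orthonormalBasis_extending (E := EuclideanSpace ℝ (Fin N)) (by simp) φ
    (fun i => (bW i : EuclideanSpace ℝ (Fin N)))
    (bW.orthonormal.comp_linearIsometry W.subtypeₗᵢ)
  have : Nonempty (Fin N) := ⟨⟨n, hn⟩⟩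
  set e := EuclideanSpace.basisFun (Fin N) ℝ with he
  set y' := y.adjustToOrientation e.toBasis.orientation with hy'
  have hdet : (e.toBasis.toMatrix y').det = 1 := by
    have := e.det_to_matrix_orthonormalBasis_of_same_orientation y'
      (y.orientation_adjustToOrientation _).symm
    rwa [Module.Basis.det_apply] at this
  let g : SO N := ⟨e.toBasis.toMatrix y', Matrix.mem_specialOrthogonalGroup_iff.mpr
    ⟨e.toMatrix_orthonormalBasis_mem_orthogonal y', hdet⟩⟩
  have hg : ∀ j, Matrix.toEuclideanLin (g : Matrix (Fin N) (Fin N) ℝ)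
      (EuclideanSpace.single j 1) = y' j := by
    intro j
    ext i
    simp [g, Module.Basis.toMatrix_apply, he, Matrix.toLpLin_apply]
  refine ⟨g, fun i => ?_⟩
  have hle : W ≤ rotatedSubspace n g := by
    intro w hw
    have h1 := congrArg Subtype.val (bW.sum_repr ⟨w, hw⟩)
    simp only [Submodule.coe_sum, Submodule.coe_smul] at h1
    rw [← h1]
    refine Submodule.sum_mem _ fun l _ => Submodule.smul_mem _ _ ?_
    have h2 : y' (φ l) ∈ rotatedSubspace n g :=
      Submodule.subset_span ⟨φ l, lt_of_lt_of_le l.2 hd, hg _⟩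
    rw [← hy l]
    rcases y.adjustToOrientation_apply_eq_or_eq_neg e.toBasis.orientation (φ l) with h | h
    · rw [← h]; exact h2
    · rw [eq_neg_iff_add_eq_zero, add_comm, ← eq_neg_iff_add_eq_zero] at h
      rw [h]; exact Submodule.neg_mem _ h2
  exact hle (Submodule.subset_span ⟨i, rfl⟩)

end Haar

section HaarMoment

instance SO.instSecondCountableTopology (N : ℕ) : SecondCountableTopology (SO N) :=
  inferInstanceAs (SecondCountableTopology
    {A : Fin N → Fin N → ℝ // A ∈ Matrix.specialOrthogonalGroup (Fin N) ℝ})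

instance instIsProbabilityMeasureUniformSO (N : ℕ) : IsProbabilityMeasure (uniformSO N) :=
  ⟨Measure.haarMeasure_self (K₀ := (⊤ : TopologicalSpace.PositiveCompacts (SO N)))⟩

instance instIsHaarMeasureUniformSO (N : ℕ) : (uniformSO N).IsHaarMeasure := by
  unfold uniformSO; infer_instance

/-- A right translate of Haar measure is again a Haar probability measure, and there is only one. -/
instance instIsMulRightInvariantUniformSO (N : ℕ) : (uniformSO N).IsMulRightInvariant := by
  refine ⟨fun g => ?_⟩
  have : IsProbabilityMeasure ((uniformSO N).map (· * g)) :=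
    Measure.isProbabilityMeasure_map (by fun_prop)
  have : ((uniformSO N).map (· * g)).IsHaarMeasure := inferInstance
  exact Measure.isHaarMeasure_eq_of_isProbabilityMeasure _ _

variable {N n : ℕ}

lemma continuous_soIsometry_family :
    Continuous fun p : (Fin n → EuclideanSpace ℝ (Fin N)) × SO N =>
      fun i => soIsometry p.2 (p.1 i) := by
  have h : ∀ i, Continuous fun p : (Fin n → EuclideanSpace ℝ (Fin N)) × SO N => (p.2, p.1 i) := by
    intro i
    fun_prop
  have h2 := fun i => continuous_soIsometry.comp (h i)
  simp only [Function.comp_def] at h2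
  exact continuous_pi h2

lemma continuous_rotatedFrame (hn : n ≤ N) :
    Continuous fun g : SO N => rotatedFrame hn g := by
  refine continuous_pi fun i => ?_
  have h : Continuous fun g : SO N =>
      (g, (EuclideanSpace.single (Fin.castLE hn i) 1 : EuclideanSpace ℝ (Fin N))) := by
    fun_prop
  exact Continuous.comp (g := fun p : SO N × EuclideanSpace ℝ (Fin N) => soIsometry p.1 p.2)
    continuous_soIsometry h

lemma inv_ofReal_le_mul {c κ p : ℝ} (hκ : 0 < κ) (hc : c ≤ κ) (hp : 0 ≤ p) :
    (ENNReal.ofReal p)⁻¹ ≤ ENNReal.ofReal κ * (ENNReal.ofReal (c * p))⁻¹ := by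
  have hκ0 : ENNReal.ofReal κ ≠ 0 := (ENNReal.ofReal_pos.mpr hκ).ne'
  calc (ENNReal.ofReal p)⁻¹ = ENNReal.ofReal κ * (ENNReal.ofReal (κ * p))⁻¹ := by
        rw [ENNReal.ofReal_mul hκ.le, ENNReal.mul_inv (Or.inl hκ0) (Or.inl ENNReal.ofReal_ne_top),
          ← mul_assoc, ENNReal.mul_inv_cancel hκ0 ENNReal.ofReal_ne_top, one_mul]
    _ ≤ _ := by gcongr

/-- The vectors `X i` are combinations of some rotated frame `g₀ eᵢ`, with coefficient matrix of
determinant at most `n!` in absolute value; right invariance absorbs `g₀`. Degenerate `X` cause no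
trouble, as the inverse of zero is `⊤`. -/
lemma lintegral_invGram_rotatedFrame_le_of_norm_le (hn : n < N) (a b : ℕ)
    (U₁ U₂ : Submodule ℝ (EuclideanSpace ℝ (Fin N))) (X : Fin n → EuclideanSpace ℝ (Fin N))
    (hX : ∀ i, ‖X i‖ ≤ 1) :
    ∫⁻ g, invGram a b U₁ U₂ (rotatedFrame hn.le g) ∂uniformSO N ≤
      ENNReal.ofReal ((n.factorial : ℝ) ^ (a + b)) *
        ∫⁻ g, invGram a b U₁ U₂ (fun i => soIsometry g (X i)) ∂uniformSO N := by
  obtain ⟨g₀, hg₀⟩ := exists_rotation_span_le hn X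
  have hon := orthonormal_rotatedFrame hn.le g₀
  have hM : ∀ i, ∃ c : Fin n → ℝ, ∑ j, c j • rotatedFrame hn.le g₀ j = X i := fun i => by
    have := hg₀ i
    rw [← span_rotatedFrame hn.le] at this
    exact (Submodule.mem_span_range_iff_exists_fun ℝ).mp this
  choose M hM using hM
  have hMb : ∀ i j, |M i j| ≤ 1 := by
    intro i j
    have h1 : inner ℝ (rotatedFrame hn.le g₀ j) (X i) = M i j := by
      rw [← hM i, hon.inner_right_fintype]
    rw [← h1]
    refine (abs_real_inner_le_norm _ _).trans ?_
    rw [hon.1 j, one_mul]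
    exact hX i
  have hdet : |(Matrix.of M).det| ≤ n.factorial := by
    have := abs_det_le_of_row_bound (Matrix.of M) (fun _ => 1) hMb
    simpa using this
  rw [← lintegral_mul_right_eq_self _ g₀, ← lintegral_const_mul']
  · refine lintegral_mono fun g => ?_
    have hfr : ∀ U, projGram U (fun i => soIsometry g (X i)) =
        (Matrix.of M).det ^ 2 * projGram U (rotatedFrame hn.le (g * g₀)) := by
      intro U
      rw [← projGram_sum_smul]
      congr 1
      funext i
      rw [← hM i, map_sum]
      refine Finset.sum_congr rfl fun j _ => ?_
      rw [map_smul, rotatedFrame_eq, rotatedFrame_eq, soIsometry_mul]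
      rfl
    unfold invGram
    rw [hfr, hfr, Real.sqrt_mul (sq_nonneg _), Real.sqrt_mul (sq_nonneg _), Real.sqrt_sq_eq_abs]
    have := inv_ofReal_le_mul (c := |(Matrix.of M).det| ^ (a + b))
      (κ := (n.factorial : ℝ) ^ (a + b))
      (p := √(projGram U₁ (rotatedFrame hn.le (g * g₀))) ^ a *
        √(projGram U₂ (rotatedFrame hn.le (g * g₀))) ^ b)
      (by positivity) (pow_le_pow_left₀ (abs_nonneg _) hdet _) (by positivity)
    refine this.trans (le_of_eq ?_)
    congr 3
    ring
  · exact ENNReal.ofReal_ne_top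

/-- Averaging the comparison over `X` in a product of unit balls and exchanging integrals, the
rotation invariance of the ball removes `g` and leaves a Euclidean integral. -/
lemma lintegral_invGram_rotatedFrame_le (hn : n < N) (a b : ℕ)
    (U₁ U₂ : Submodule ℝ (EuclideanSpace ℝ (Fin N))) (hU : U₁ ⟂ U₂)
    (ha : a = 0 ∨ a + n ≤ Module.finrank ℝ U₁) (hb : b = 0 ∨ b + n ≤ Module.finrank ℝ U₂) :
    (∫⁻ g, invGram a b U₁ U₂ (rotatedFrame hn.le g) ∂uniformSO N) *
        volume (Metric.closedBall (0 : EuclideanSpace ℝ (Fin N)) 1) ^ n ≤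
      ENNReal.ofReal ((n.factorial : ℝ) ^ (a + b)) *
      ((∫⁻ t in Set.Icc (-1 : ℝ) 1, (ENNReal.ofReal (|t| ^ (N / (N + 1) : ℝ)))⁻¹) ^ N) ^ n := by
  set B := Metric.closedBall (0 : EuclideanSpace ℝ (Fin N)) 1 with hB
  set ν : Measure (Fin n → EuclideanSpace ℝ (Fin N)) :=
    Measure.pi fun _ => volume.restrict B with hν
  set κ := ENNReal.ofReal ((n.factorial : ℝ) ^ (a + b)) with hκ
  set I := ∫⁻ g, invGram a b U₁ U₂ (rotatedFrame hn.le g) ∂uniformSO N with hI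
  have hmeas : Measurable fun p : (Fin n → EuclideanSpace ℝ (Fin N)) × SO N =>
      invGram a b U₁ U₂ (fun i => soIsometry p.2 (p.1 i)) :=
    (measurable_invGram a b U₁ U₂).comp continuous_soIsometry_family.measurable
  have hBm : MeasurableSet B := Metric.isClosed_closedBall.measurableSet
  calc I * volume B ^ n = ∫⁻ _, I ∂ν := by
        rw [lintegral_const, hν, Measure.pi_univ]
        simp
    _ ≤ ∫⁻ X, κ * ∫⁻ g, invGram a b U₁ U₂ (fun i => soIsometry g (X i)) ∂uniformSO N ∂ν := by
        rw [hν, ← Measure.restrict_pi_pi]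
        refine setLIntegral_mono' (MeasurableSet.univ_pi fun _ => hBm) fun X hX => ?_
        exact lintegral_invGram_rotatedFrame_le_of_norm_le hn a b U₁ U₂ X fun i =>
          mem_closedBall_zero_iff.mp (hX i (Set.mem_univ i))
    _ = κ * ∫⁻ g, ∫⁻ X, invGram a b U₁ U₂ (fun i => soIsometry g (X i)) ∂ν ∂uniformSO N := by
        rw [lintegral_const_mul' _ _ ENNReal.ofReal_ne_top]
        congr 1
        exact lintegral_lintegral_swap hmeas.aemeasurable
    _ = κ * ∫⁻ _, ∫⁻ X, invGram a b U₁ U₂ X ∂ν ∂uniformSO N := by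
        congr 1
        refine lintegral_congr fun g => ?_
        have h1 : MeasurePreserving (soIsometry g) (volume.restrict B) (volume.restrict B) := by
          have := (soIsometry g).measurePreserving.restrict_preimage hBm
          have hpre : soIsometry g ⁻¹' B = B := by
            ext x
            simp [hB]
          rwa [hpre] at this
        have h2 := measurePreserving_pi (fun _ : Fin n => volume.restrict B)
          (fun _ : Fin n => volume.restrict B) (f := fun _ => soIsometry g) (fun _ => h1)
        exact h2.lintegral_comp (measurable_invGram a b U₁ U₂)
    _ = κ * ∫⁻ X, invGram a b U₁ U₂ X ∂ν := by
        rw [lintegral_const, measure_univ, mul_one]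
    _ ≤ _ := by
        gcongr
        exact lintegral_invGram_le N (by simp) n a b U₁ U₂ hU ha hb

/-- Negative moments of projected volumes of a random subspace are bounded uniformly in the
subspaces onto which one projects. -/
lemma exists_bound_lintegral_invGram (hn : n < N) :
    ∃ I : ENNReal, I ≠ ⊤ ∧ ∀ (a b : ℕ) (U₁ U₂ : Submodule ℝ (EuclideanSpace ℝ (Fin N))), U₁ ⟂ U₂ →
      a ≤ N → b ≤ N → (a = 0 ∨ a + n ≤ Module.finrank ℝ U₁) →
      (b = 0 ∨ b + n ≤ Module.finrank ℝ U₂) →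
      ∫⁻ g, invGram a b U₁ U₂ (rotatedFrame hn.le g) ∂uniformSO N ≤ I := by
  set V := volume (Metric.closedBall (0 : EuclideanSpace ℝ (Fin N)) 1) ^ n with hV
  have hV0 : V ≠ 0 := pow_ne_zero _ (Metric.measure_closedBall_pos volume _ one_pos).ne'
  have hV1 : V ≠ ⊤ := ENNReal.pow_ne_top measure_closedBall_lt_top.ne
  refine ⟨ENNReal.ofReal ((n.factorial : ℝ) ^ (N + N)) *
      ((∫⁻ t in Set.Icc (-1 : ℝ) 1, (ENNReal.ofReal (|t| ^ (N / (N + 1) : ℝ)))⁻¹) ^ N) ^ n / V,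
    ENNReal.div_ne_top (ENNReal.mul_ne_top ENNReal.ofReal_ne_top (ENNReal.pow_ne_top
      (ENNReal.pow_ne_top (lintegral_inv_rpow_ne_top _ ?_)))) hV0, ?_⟩
  · rw [div_lt_one (by positivity)]; linarith
  intro a b U₁ U₂ hU haN hbN ha hb
  rw [ENNReal.le_div_iff_mul_le (Or.inl hV0) (Or.inl hV1)]
  refine (lintegral_invGram_rotatedFrame_le hn a b U₁ U₂ hU ha hb).trans ?_
  gcongr
  exact_mod_cast Nat.factorial_pos n

end HaarMoment

/-! ### The transversality event. -/

section GoodEvent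

/-- The exponent `N + 1` exceeds the rank of the lattice; the same exponent appears on `P` in the
transversality bound. -/
lemma tsum_intVec_ne_top (N : ℕ) :
    ∑' z : {z : Fin N → ℤ // z ≠ 0}, (ENNReal.ofReal (‖intVec z.1‖ ^ (N + 1)))⁻¹ ≠ ⊤ := by
  let b := (EuclideanSpace.basisFun (Fin N) ℝ).toBasis
  let L := Submodule.span ℤ (Set.range b)
  have hmem : ∀ z : Fin N → ℤ, intVec z ∈ L := by
    intro z
    have : intVec z = ∑ i, z i • b i := by
      ext j
      simp [b, intVec_apply, Finset.sum_apply, Pi.single_apply]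
    rw [this]
    exact Submodule.sum_mem _ fun i _ => Submodule.smul_mem _ _ (Submodule.subset_span ⟨i, rfl⟩)
  have hrank : Module.finrank ℤ L < N + 1 := by
    rw [ZLattice.rank ℝ L, finrank_euclideanSpace_fin]; omega
  have hs := ZLattice.summable_norm_pow_inv L (N + 1) hrank
  have hinj : Function.Injective fun z : {z : Fin N → ℤ // z ≠ 0} => (⟨intVec z.1, hmem z.1⟩ : L) :=
    fun z w h => Subtype.ext (intVec_injective (congrArg Subtype.val h))
  have hs2 := (hs.comp_injective hinj).tsum_ofReal_ne_top
  convert hs2 using 3 with z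
  have hpos : 0 < ‖intVec z.1‖ := zero_lt_one.trans_le (one_le_norm_intVec z.2)
  rw [← ENNReal.ofReal_inv_of_pos (by positivity), ← inv_pow]
  rfl

lemma tsum_pi_prod {α : Type*} (f : α → ENNReal) (k : ℕ) :
    ∑' v : Fin k → α, ∏ i, f (v i) = (∑' a, f a) ^ k := by
  induction k with
  | zero => simp
  | succ k ih =>
    rw [← (Fin.consEquiv fun _ : Fin (k + 1) => α).tsum_eq, ENNReal.tsum_prod', pow_succ']
    simp only [Fin.consEquiv_apply, Fin.prod_univ_succ, Fin.cons_zero, Fin.cons_succ]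
    simp only [ENNReal.tsum_mul_left, ih, ENNReal.tsum_mul_right]

/-- With probability at least `κ`, the random subspace is quantitatively transversal to every
subspace spanned by integer vectors and to its orthogonal complement. -/
lemma exists_good_event {N n : ℕ} (hn : n < N) (κ : ℝ) (hκ : κ < 1) :
    ∃ C : ℝ, 0 < C ∧ ∃ G : Set (SO N), MeasurableSet G ∧ ENNReal.ofReal κ ≤ uniformSO N G ∧
      ∀ g ∈ G, ∀ k ≤ N, ∀ v : Fin k → Fin N → ℤ, LinearIndependent ℝ (fun i => intVec (v i)) →
        ∀ W, W = Submodule.span ℝ (Set.range fun i => intVec (v i)) →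
        1 ≤ C * (∏ i, ‖intVec (v i)‖) ^ (N + 1) *
          (√(projGram Wᗮ (rotatedFrame hn.le g)) ^ (N - n - k) *
            √(projGram W (rotatedFrame hn.le g)) ^ (k - n)) := by
  obtain ⟨I, hI, hbound⟩ := exists_bound_lintegral_invGram hn
  let T := Σ k : Fin (N + 1), Fin k → {z : Fin N → ℤ // z ≠ 0}
  let W : T → Submodule ℝ (EuclideanSpace ℝ (Fin N)) := fun v =>
    Submodule.span ℝ (Set.range fun i => intVec (v.2 i).1)
  let P : T → ℝ := fun v => ∏ i, ‖intVec (v.2 i).1‖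
  let Φ : T → SO N → ENNReal := fun v g =>
    invGram (N - n - v.1) (v.1 - n) (W v)ᗮ (W v) (rotatedFrame hn.le g)
  have hΦ : ∀ v, Measurable (Φ v) := fun v =>
    (measurable_invGram _ _ _ _).comp (continuous_rotatedFrame hn.le).measurable
  have hP : ∀ v, 0 < P v := fun v =>
    Finset.prod_pos fun i _ => zero_lt_one.trans_le (one_le_norm_intVec (v.2 i).2)
  set S : ENNReal := ∑' v : T, (ENNReal.ofReal (P v ^ (N + 1)))⁻¹ with hS
  have hS1 : S ≠ ⊤ := by
    rw [hS, ENNReal.tsum_sigma']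
    rw [tsum_fintype]
    refine ENNReal.sum_ne_top.mpr fun k _ => ?_
    have h1 : ∀ v : Fin k → {z : Fin N → ℤ // z ≠ 0},
        (ENNReal.ofReal (P ⟨k, v⟩ ^ (N + 1)))⁻¹ =
          ∏ i, (ENNReal.ofReal (‖intVec (v i).1‖ ^ (N + 1)))⁻¹ := by
      intro v
      rw [← ENNReal.prod_inv_distrib fun i _ j _ _ => Or.inr ENNReal.ofReal_ne_top,
        ← ENNReal.ofReal_prod_of_nonneg fun i _ => by positivity, Finset.prod_pow]
    simp only [h1]
    rw [tsum_pi_prod (fun z : {z : Fin N → ℤ // z ≠ 0} =>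
      (ENNReal.ofReal (‖intVec z.1‖ ^ (N + 1)))⁻¹)]
    exact ENNReal.pow_ne_top (tsum_intVec_ne_top N)
  -- Chosen so that the sum `I * S / C` of the Markov bounds is at most `1 - κ`.
  set C : ℝ := (I * S).toReal / (1 - κ) + 1 with hC
  have h1κ : 0 < 1 - κ := by linarith
  have hCpos : 0 < C := by positivity
  let bad : T → Set (SO N) := fun v =>
    {g | v.1.1 ≤ N ∧ LinearIndependent ℝ (fun i => intVec (v.2 i).1) ∧
      ENNReal.ofReal (C * P v ^ (N + 1)) ≤ Φ v g}
  have hbadm : ∀ v, MeasurableSet (bad v) := fun v =>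
    (MeasurableSet.const _).inter ((MeasurableSet.const _).inter
      (measurableSet_le measurable_const (hΦ v)))
  have hbad : ∀ v, uniformSO N (bad v) ≤
      I * (ENNReal.ofReal C)⁻¹ * (ENNReal.ofReal (P v ^ (N + 1)))⁻¹ := by
    intro v
    by_cases hli : LinearIndependent ℝ (fun i => intVec (v.2 i).1)
    · have hfr : Module.finrank ℝ (W v) = v.1 := by
        simpa using finrank_span_eq_card hli
      have hfr2 : v.1 + Module.finrank ℝ (W v)ᗮ = N := by
        have := (W v).finrank_add_finrank_orthogonal
        rw [hfr, finrank_euclideanSpace_fin] at this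
        exact this
      have hD : 0 < C * P v ^ (N + 1) := mul_pos hCpos (pow_pos (hP v) _)
      have h1 := meas_ge_le_lintegral_div (μ := uniformSO N) (hΦ v).aemeasurable
        (ε := ENNReal.ofReal (C * P v ^ (N + 1))) (ENNReal.ofReal_pos.mpr hD).ne'
        ENNReal.ofReal_ne_top
      have h2 : ∫⁻ g, Φ v g ∂uniformSO N ≤ I :=
        hbound _ _ (W v)ᗮ (W v) (Submodule.isOrtho_orthogonal_left _) (by omega) (by omega)
          (by omega) (by omega)
      refine (measure_mono fun g hg => hg.2.2).trans (h1.trans ?_)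
      rw [ENNReal.div_eq_inv_mul, ENNReal.ofReal_mul hCpos.le,
        ENNReal.mul_inv (Or.inr ENNReal.ofReal_ne_top) (Or.inl ENNReal.ofReal_ne_top)]
      calc _ ≤ (ENNReal.ofReal C)⁻¹ * (ENNReal.ofReal (P v ^ (N + 1)))⁻¹ * I := by gcongr
        _ = _ := by ring
    · have : bad v = ∅ := Set.eq_empty_of_forall_notMem fun g hg => hli hg.2.1
      rw [this]; simp
  refine ⟨C, hCpos, (⋃ v, bad v)ᶜ, (MeasurableSet.iUnion hbadm).compl, ?_, ?_⟩
  · have h1 : uniformSO N (⋃ v, bad v) ≤ ENNReal.ofReal (1 - κ) := by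
      refine (measure_iUnion_le _).trans ((ENNReal.tsum_le_tsum hbad).trans ?_)
      rw [ENNReal.tsum_mul_left, ← hS]
      have h2 : I * S ≤ ENNReal.ofReal ((1 - κ) * C) := by
        rw [← ENNReal.ofReal_toReal (ENNReal.mul_ne_top hI hS1)]
        refine ENNReal.ofReal_le_ofReal ?_
        rw [hC, mul_add, mul_div_cancel₀ _ h1κ.ne']
        linarith
      calc I * (ENNReal.ofReal C)⁻¹ * S = I * S * (ENNReal.ofReal C)⁻¹ := by ring
        _ ≤ ENNReal.ofReal ((1 - κ) * C) * (ENNReal.ofReal C)⁻¹ := by gcongr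
        _ = _ := by
          rw [ENNReal.ofReal_mul h1κ.le, mul_assoc, ENNReal.mul_inv_cancel
            (ENNReal.ofReal_pos.mpr hCpos).ne' ENNReal.ofReal_ne_top, mul_one]
    rw [prob_compl_eq_one_sub (MeasurableSet.iUnion hbadm)]
    calc ENNReal.ofReal κ = 1 - ENNReal.ofReal (1 - κ) := by
          rw [← ENNReal.ofReal_one, ← ENNReal.ofReal_sub _ h1κ.le]
          congr 1; ring
      _ ≤ _ := tsub_le_tsub_left h1 _
  · rintro g hg k hk v hli _ rfl
    let v' : T := ⟨⟨k, by omega⟩, fun i => ⟨v i, fun h => hli.ne_zero i (by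
      show intVec (v i) = 0
      rw [h]; ext j; simp [intVec_apply])⟩⟩
    have h1 : g ∉ bad v' := fun h => hg (Set.mem_iUnion.mpr ⟨v', h⟩)
    have h2 : Φ v' g < ENNReal.ofReal (C * P v' ^ (N + 1)) := by
      by_contra hcon
      exact h1 ⟨hk, hli, not_lt.mp hcon⟩
    have h3 := h2.le
    have hD : 0 < C * P v' ^ (N + 1) := mul_pos hCpos (pow_pos (hP v') _)
    simp only [Φ, invGram] at h3
    rw [ENNReal.inv_le_iff_le_mul (fun h => absurd h ENNReal.ofReal_ne_top)
      (fun h => absurd h ENNReal.ofReal_ne_top), ← ENNReal.ofReal_mul (by positivity),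
      ENNReal.one_le_ofReal, mul_comm] at h3
    exact h3

end GoodEvent

/-! ### From integer points to determinants. -/

section LatticeGeometry

open Matrix

lemma starProjection_eq_sum {N k : ℕ} {W : Submodule ℝ (EuclideanSpace ℝ (Fin N))}
    {e : Fin k → EuclideanSpace ℝ (Fin N)} (he : Orthonormal ℝ e)
    (hW : Submodule.span ℝ (Set.range e) = W) (y : EuclideanSpace ℝ (Fin N)) :
    W.starProjection y = ∑ l, inner ℝ (e l) y • e l := by
  have hmem : ∀ l, e l ∈ W := fun l => hW ▸ Submodule.subset_span ⟨l, rfl⟩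
  refine Submodule.eq_starProjection_of_mem_of_inner_eq_zero
    (Submodule.sum_mem _ fun l _ => Submodule.smul_mem _ _ (hmem l)) fun w hw => ?_
  rw [← hW] at hw
  induction hw using Submodule.span_induction with
  | mem x hx =>
    obtain ⟨l, rfl⟩ := hx
    rw [inner_sub_left, he.inner_left_fintype, conj_trivial, real_inner_comm, sub_self]
  | zero => simp
  | add x y _ _ hx hy => rw [inner_add_right, hx, hy, add_zero]
  | smul c x _ hx => rw [inner_smul_right, hx, mul_zero]

lemma projGram_eq_det {N k n : ℕ} {W : Submodule ℝ (EuclideanSpace ℝ (Fin N))}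
    {e : Fin k → EuclideanSpace ℝ (Fin N)} (he : Orthonormal ℝ e)
    (hW : Submodule.span ℝ (Set.range e) = W) (x : Fin n → EuclideanSpace ℝ (Fin N)) :
    projGram W x = ((Matrix.of fun l i => inner ℝ (e l) (x i))ᵀ *
      Matrix.of fun l i => inner ℝ (e l) (x i)).det := by
  unfold projGram
  congr 1
  ext i j
  rw [of_apply, starProjection_eq_sum he hW, starProjection_eq_sum he hW, he.inner_sum]
  simp [mul_apply]

/-- For an orthonormal family, the Gram matrices of the projections to `W` and `Wᗮ` add up to the
identity. -/
lemma projGram_orthogonal_eq_det {N k n : ℕ} {W : Submodule ℝ (EuclideanSpace ℝ (Fin N))}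
    {e : Fin k → EuclideanSpace ℝ (Fin N)} (he : Orthonormal ℝ e)
    (hW : Submodule.span ℝ (Set.range e) = W) {x : Fin n → EuclideanSpace ℝ (Fin N)}
    (hx : Orthonormal ℝ x) :
    projGram Wᗮ x = (1 - (Matrix.of fun l i => inner ℝ (e l) (x i))ᵀ *
      Matrix.of fun l i => inner ℝ (e l) (x i)).det := by
  unfold projGram
  congr 1
  ext i j
  have h1 : inner ℝ (Wᗮ.starProjection (x i)) (Wᗮ.starProjection (x j)) =
      inner ℝ (x i) (x j) - inner ℝ (W.starProjection (x i)) (W.starProjection (x j)) := by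
    rw [Submodule.inner_starProjection_left_eq_right, Submodule.starProjection_eq_self_iff.mpr
      (Submodule.starProjection_apply_mem _ _), Submodule.starProjection_orthogonal_val,
      inner_sub_right, Submodule.inner_starProjection_left_eq_right W,
      Submodule.starProjection_eq_self_iff.mpr (Submodule.starProjection_apply_mem W _)]
  rw [of_apply, h1, starProjection_eq_sum he hW, starProjection_eq_sum he hW, he.inner_sum,
    orthonormal_iff_ite.mp hx]
  simp [mul_apply, one_apply]

/-- The integer points of a set spanning `W` are counted by the ratio of the determinant of some
of them to the product of the successive minima of the lattice of integer points of `W`. -/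
lemma exists_card_mul_prod_le {N : ℕ} (F : Finset (Fin N → ℤ)) :
    ∃ (k : ℕ) (v u : Fin k → Fin N → ℤ) (e : Fin k → EuclideanSpace ℝ (Fin N)), k ≤ N ∧
      LinearIndependent ℝ (fun i => intVec (v i)) ∧ Orthonormal ℝ e ∧
      Submodule.span ℝ (Set.range e) = Submodule.span ℝ (Set.range fun i => intVec (v i)) ∧
      (∀ i, u i ∈ F) ∧ (∀ i, intVec (u i) = ∑ l, inner ℝ (e l) (intVec (u i)) • e l) ∧
      (F.card : ℝ) * ∏ i, ‖intVec (v i)‖ ≤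
        (5 * k : ℝ) ^ k * |(Matrix.of fun i l => inner ℝ (e l) (intVec (u i))).det| := by
  classical
  set W := Submodule.span ℝ (intVec '' (F : Set (Fin N → ℤ))) with hWdef
  have hFW : ∀ z ∈ F, intVec z ∈ W := fun z hz => Submodule.subset_span ⟨z, hz, rfl⟩
  have hW : W = Submodule.span ℝ {x | x ∈ W ∧ ∃ z, intVec z = x} := by
    refine le_antisymm ?_ (Submodule.span_le.mpr fun x hx => hx.1)
    rw [hWdef]
    refine Submodule.span_mono ?_
    rintro _ ⟨z, hz, rfl⟩
    exact ⟨hFW z hz, z, rfl⟩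
  obtain ⟨k, hk⟩ : ∃ k, Module.finrank ℝ W = k := ⟨_, rfl⟩
  obtain ⟨v, e, hli, hspan, hon, hspane, hsep⟩ := exists_orthonormal_separated W hW hk
  have hkN : k ≤ N := by
    rw [← hk]
    simpa using W.finrank_le
  have hexp : ∀ y ∈ W, y = ∑ l, inner ℝ (e l) y • e l := fun y hy => by
    rw [← starProjection_eq_sum hon hspane, Submodule.starProjection_eq_self_iff.mpr hy]
  let ψ : EuclideanSpace ℝ (Fin N) →ₗ[ℝ] (Fin k → ℝ) :=
    LinearMap.pi fun l => (innerSL ℝ (e l)).toLinearMap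
  have hψ : ∀ y l, ψ y l = inner ℝ (e l) y := fun y l => rfl
  have hψinj : ∀ y ∈ W, ∀ y' ∈ W, ψ y = ψ y' → y = y' := by
    intro y hy y' hy' h
    rw [hexp y hy, hexp y' hy']
    exact Finset.sum_congr rfl fun l _ => by rw [← hψ, ← hψ, h]
  set A : Set (Fin k → ℝ) := (fun z => ψ (intVec z)) '' (F : Set (Fin N → ℤ)) with hA
  have hAspan : Submodule.span ℝ A = ⊤ := by
    have h1 : A = ψ '' (intVec '' (F : Set (Fin N → ℤ))) := by rw [hA, Set.image_image]
    rw [h1, ← Submodule.map_span, ← hWdef, eq_top_iff]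
    rintro c -
    refine ⟨∑ l, c l • e l, Submodule.sum_mem _ fun l _ => Submodule.smul_mem _ _
      (hspane ▸ Submodule.subset_span ⟨l, rfl⟩), ?_⟩
    ext l
    rw [hψ, hon.inner_right_fintype]
  have hAbdd : ∀ u : Fin k → Fin k → ℝ, (∀ i, u i ∈ A) → |(Pi.basisFun ℝ (Fin k)).det u| ≤
      (Fintype.card (Fin k)).factorial * ∏ _i : Fin k, ∑ z ∈ F, ‖intVec z‖ := by
    intro u hu
    rw [Pi.basisFun_det]
    refine abs_det_le_of_row_bound (Matrix.of u) _ fun i j => ?_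
    obtain ⟨z, hz, hzi⟩ := hu i
    rw [of_apply, ← hzi]
    simp only [hψ]
    refine (abs_real_inner_le_norm _ _).trans ?_
    rw [hon.1 j, one_mul]
    exact Finset.single_le_sum (f := fun z => ‖intVec z‖) (fun _ _ => norm_nonneg _) hz
  -- These vectors come from `F`, and all of `F` has coordinates at most `2` in them, which is the
  -- input of the packing bound; the separating boxes are those of the successive minima.
  obtain ⟨u', hu'A, hdet, -, hcoord⟩ :=
    exists_almost_maximal_det (Pi.basisFun ℝ (Fin k)) A hAspan _ hAbdd
  choose u hu using hu'A
  have hu' : u' = fun i l => inner ℝ (e l) (intVec (u i)) := by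
    funext i
    rw [← (hu i).2]
    rfl
  refine ⟨k, v, u, e, hkN, hli, hon, hspane.trans hspan.symm, fun i => (hu i).1,
    fun i => hexp _ (hFW _ (hu i).1), ?_⟩
  let Λ : AddSubgroup (Fin k → ℝ) :=
    { carrier := {y | ∃ z, intVec z ∈ W ∧ ψ (intVec z) = y}
      zero_mem' := ⟨0, by
        have : intVec (0 : Fin N → ℤ) = 0 := by ext i; simp [intVec_apply]
        rw [this]
        exact ⟨W.zero_mem, map_zero ψ⟩⟩
      add_mem' := by
        rintro _ _ ⟨z, hz, rfl⟩ ⟨w, hw, rfl⟩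
        have : intVec (z + w) = intVec z + intVec w := by ext i; simp [intVec_apply]
        exact ⟨z + w, this ▸ W.add_mem hz hw, by rw [this, map_add]⟩
      neg_mem' := by
        rintro _ ⟨z, hz, rfl⟩
        have : intVec (-z) = -intVec z := by ext i; simp [intVec_apply]
        exact ⟨-z, this ▸ W.neg_mem hz, by rw [this, map_neg]⟩ }
  have hv1 : ∀ i, 1 ≤ ‖intVec (v i)‖ := fun i => one_le_norm_intVec fun h => hli.ne_zero i (by
    show intVec (v i) = 0
    rw [h]; ext j; simp [intVec_apply])
  obtain ⟨hbli, hbsp⟩ := (Module.Basis.is_basis_iff_det (Pi.basisFun ℝ (Fin k))).mpr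
    (isUnit_iff_ne_zero.mpr hdet)
  let b : Module.Basis (Fin k) ℝ (Fin k → ℝ) := Module.Basis.mk hbli hbsp.ge
  have hb : ∀ i, b i = u' i := fun i => Module.Basis.mk_apply hbli hbsp.ge i
  have hpack := card_mul_prod_le_det Λ (fun i => ‖intVec (v i)‖ / k)
    (fun i => div_pos (zero_lt_one.trans_le (hv1 i)) (by exact_mod_cast i.pos))
    (by
      rintro _ ⟨z, hz, rfl⟩ hne
      obtain ⟨i, hi⟩ := hsep z (fun h => hne (by
        have : intVec (0 : Fin N → ℤ) = 0 := by ext i; simp [intVec_apply]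
        rw [h, this, map_zero])) hz
      exact ⟨i, hi⟩)
    b (fun i => by rw [hb, ← (hu i).2]; exact ⟨u i, hFW _ (hu i).1, rfl⟩)
    (F.image fun z => ψ (intVec z))
    (by
      intro f hf
      obtain ⟨z, hz, rfl⟩ := Finset.mem_image.mp hf
      refine ⟨⟨z, hFW z hz, rfl⟩, fun i => ?_⟩
      obtain ⟨c, hc, hcz⟩ := hcoord (ψ (intVec z)) ⟨z, hz, rfl⟩
      have : b.repr (ψ (intVec z)) i = c i := by
        rw [hcz]
        simp only [← hb]
        rw [b.repr_sum_self]
      rw [this]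
      exact hc i)
  rw [Finset.card_image_of_injOn (fun z hz w hw h =>
    intVec_injective (hψinj _ (hFW z hz) _ (hFW w hw) h)), Finset.prod_div_distrib,
    Finset.prod_const, Finset.card_univ, Fintype.card_fin] at hpack
  have hbM : (Matrix.of b : Matrix (Fin k) (Fin k) ℝ) =
      Matrix.of fun i l => inner ℝ (e l) (intVec (u i)) := by
    ext i l
    rw [of_apply, hb, hu']
    rfl
  rw [hbM] at hpack
  rcases Nat.eq_zero_or_pos k with rfl | hkpos
  · simpa using hpack
  · have hkk : (0 : ℝ) < (k : ℝ) ^ k := pow_pos (by exact_mod_cast hkpos) _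
    rw [← mul_div_assoc, div_le_iff₀ hkk] at hpack
    rw [mul_pow]
    linarith

end LatticeGeometry

/-! ### Counting integer points of a normalized box. -/

section Counting

open Matrix

/-- With `D` the volume spanned by the chosen integer points, the box conditions read `c₁ t = M O₁`
and `h c₂ = M O₂`, so the determinant bounds apply: `D` is compared with `h` through the projection
to `Wᗮ`, with `t` and `h` through the projection to `W`, and crudely without either. -/
lemma exists_integer_frame {N n m : ℕ}
    (x : OrthonormalBasis (Fin n ⊕ Fin m) ℝ (EuclideanSpace ℝ (Fin N)))
    (t : Matrix (Fin n) (Fin n) ℝ) (h : ℝ) (F : Finset (Fin N → ℤ))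
    (hF : ∀ z ∈ F, ∃ (c₁ : Fin n → ℝ) (c₂ : Fin m → ℝ), (∀ i, |c₁ i| ≤ 1) ∧ (∀ i, |c₂ i| ≤ 1) ∧
      (∀ j, inner ℝ (intVec z) (x (Sum.inl j)) = ∑ i, c₁ i * t i j) ∧
      ∀ j, inner ℝ (intVec z) (x (Sum.inr j)) = h * c₂ j) :
    ∃ (k : ℕ) (v : Fin k → Fin N → ℤ) (W : Submodule ℝ (EuclideanSpace ℝ (Fin N))) (D : ℝ),
      k ≤ N ∧ LinearIndependent ℝ (fun i => intVec (v i)) ∧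
      W = Submodule.span ℝ (Set.range fun i => intVec (v i)) ∧ 0 ≤ D ∧
      (F.card : ℝ) * ∏ i, ‖intVec (v i)‖ ≤ (5 * k : ℝ) ^ k * D ∧
      D ^ 2 * projGram Wᗮ (fun i => x (Sum.inl i)) ≤ h ^ (2 * k) * (k.factorial * (m : ℝ) ^ k) ∧
      (n ≤ k → D ^ 2 * projGram W (fun i => x (Sum.inl i)) ≤
        (k.factorial * (1 + m * k : ℝ) ^ k) ^ 2 * t.det ^ 2 * h ^ (2 * (k - n))) ∧
      ∀ Q H : ℝ, 1 ≤ Q → 1 ≤ H → |h| ≤ H → (∀ i j, |t i j| ≤ Q) →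
        D ≤ (n + m : ℝ) ^ k * (k.factorial * (((n + 1) * Q) ^ n * H ^ m)) := by
  obtain ⟨k, v, u, e, hk, hli, hon, hspan, huF, hu, hcard⟩ := exists_card_mul_prod_le F
  choose! c₁ c₂ hc₁ hc₂ hx₁ hx₂ using hF
  set M : Matrix (Fin k) (Fin k) ℝ := Matrix.of fun i l => inner ℝ (e l) (intVec (u i)) with hM
  set O₁ : Matrix (Fin k) (Fin n) ℝ := Matrix.of fun l j => inner ℝ (e l) (x (Sum.inl j)) with hO₁
  set O₂ : Matrix (Fin k) (Fin m) ℝ := Matrix.of fun l j => inner ℝ (e l) (x (Sum.inr j)) with hO₂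
  have hO : O₁ * O₁ᵀ + O₂ * O₂ᵀ = 1 := by
    ext i j
    have h1 := x.sum_inner_mul_inner (e i) (e j)
    rw [Fintype.sum_sum_type, orthonormal_iff_ite.mp hon] at h1
    simp only [Matrix.add_apply, mul_apply, transpose_apply, one_apply, hO₁, hO₂, of_apply]
    rw [← h1]
    congr 1 <;> exact Finset.sum_congr rfl fun l _ => by rw [real_inner_comm (e j)]
  have hMx : ∀ i y, ∑ l, M i l * inner ℝ (e l) y = inner ℝ (intVec (u i)) y := by
    intro i y
    conv_rhs => rw [hu i, sum_inner]
    exact Finset.sum_congr rfl fun l _ => by rw [inner_smul_left]; rfl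
  have h1 : (Matrix.of fun i => c₁ (u i)) * t = M * O₁ := by
    ext i j
    simp only [mul_apply, hO₁, of_apply]
    rw [hMx, hx₁ _ (huF i)]
  have h2 : h • (Matrix.of fun i => c₂ (u i)) = M * O₂ := by
    ext i j
    simp only [mul_apply, hO₂, of_apply, Matrix.smul_apply, smul_eq_mul]
    rw [hMx, hx₂ _ (huF i)]
  have hb₁ : ∀ i j, |(Matrix.of fun i => c₁ (u i)) i j| ≤ 1 := fun i j => hc₁ _ (huF i) j
  have hb₂ : ∀ i j, |(Matrix.of fun i => c₂ (u i)) i j| ≤ 1 := fun i j => hc₂ _ (huF i) j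
  refine ⟨k, v, _, |M.det|, hk, hli, rfl, abs_nonneg _, hcard, ?_, fun hnk => ?_,
    fun Q H hQ hH hhH ht => ?_⟩
  · rw [projGram_orthogonal_eq_det hon hspan (x := fun i => x (Sum.inl i))
      (x.orthonormal.comp _ Sum.inl_injective), sq_abs]
    exact det_sq_mul_det_one_sub_le M O₁ O₂ _ h hO h2 hb₂
  · rw [projGram_eq_det hon hspan, sq_abs]
    exact det_sq_mul_det_le M O₁ _ O₂ _ t h hO h1 h2 hb₁ hb₂ hnk
  · exact abs_det_le_pow M O₁ _ O₂ _ t h hO h1 h2 hb₁ hb₂ Q H hQ hH hhH ht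

end Counting

lemma pow_mul_inv_pow_le {h Z : ℝ} (hh : 0 < h) (hZ1 : 1 ≤ Z) (hZ : h ≤ Z) (hZ' : h⁻¹ ≤ Z)
    {p q r : ℕ} (hpq : p ≤ q + r) (hqp : q ≤ p + r) : h ^ p * h⁻¹ ^ q ≤ Z ^ r := by
  have hne : h ≠ 0 := hh.ne'
  rcases le_total q p with hle | hle
  · obtain ⟨d, rfl⟩ := Nat.exists_eq_add_of_le hle
    have : h ^ (q + d) * h⁻¹ ^ q = h ^ d := by
      rw [pow_add, inv_pow]; field_simp
    rw [this]
    exact (pow_le_pow_left₀ hh.le hZ d).trans (pow_le_pow_right₀ hZ1 (by omega))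
  · obtain ⟨d, rfl⟩ := Nat.exists_eq_add_of_le hle
    have : h ^ p * h⁻¹ ^ (p + d) = h⁻¹ ^ d := by
      rw [pow_add, ← mul_assoc, ← mul_pow, mul_inv_cancel₀ hne, one_pow, one_mul]
    rw [this]
    exact (pow_le_pow_left₀ (inv_nonneg.mpr hh.le) hZ' d).trans (pow_le_pow_right₀ hZ1 (by omega))

/-- The exponents appearing in the two volume bounds nearly cancel. -/
lemma exponent_balance {N n k : ℕ} (hn : 2 * n ≤ N) (hk : k ≤ N) :
    k * (N - n - k) ≤ (N - k) * (k - n) + n * N ∧ (N - k) * (k - n) ≤ k * (N - n - k) + n * N := by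
  rcases le_total k n with h1 | h1
  · have h2 : k - n = 0 := by omega
    rw [h2]
    constructor
    · have : N - n - k ≤ N := by omega
      nlinarith [Nat.mul_le_mul h1 this]
    · simp
  rcases le_total (N - n) k with h3 | h3
  · have h2 : N - n - k = 0 := by omega
    rw [h2]
    constructor
    · simp
    · have h4 : N - k ≤ n := by omega
      have : k - n ≤ N := by omega
      nlinarith [Nat.mul_le_mul h4 this]
  -- For `n ≤ k ≤ N - n` no subtraction is truncated, and the two products differ by exactly `n (N -
  -- 2 k)`.
  obtain ⟨b, rfl⟩ := Nat.exists_eq_add_of_le h1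
  obtain ⟨a, ha⟩ := Nat.exists_eq_add_of_le h3
  have hN : N = n + (n + b) + a := by omega
  subst hN
  have e1 : n + (n + b) + a - n - (n + b) = a := by omega
  have e2 : n + (n + b) + a - (n + b) = n + a := by omega
  have e3 : n + b - n = b := by omega
  rw [e1, e2, e3]
  constructor <;> nlinarith [Nat.zero_le (n * a), Nat.zero_le (n * b), Nat.zero_le (n * n)]

/-- Combination of the transversality of the random subspace with the determinant bounds. -/
lemma card_pow_le_of_bounds {N n m k : ℕ} (hN : n + m = N) (hn : 1 ≤ n) (hn4 : 4 * n ≤ N)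
    (hk : k ≤ N) {f P D K C h Q Z τ s₁ s₂ : ℝ} (hf : 1 ≤ f) (hP : 1 ≤ P) (hD : 0 ≤ D)
    (hK : 1 ≤ K) (hC : 1 ≤ C) (hh : 0 < h) (hQ : 1 ≤ Q) (hZ1 : 1 ≤ Z) (hhZ : h ≤ Z) (hhZ' : h⁻¹ ≤ Z)
    (hs₁ : 0 ≤ s₁) (hs₂ : 0 ≤ s₂) (hτ : τ * h ^ m = 1)
    (hcard : f * P ≤ K * D) (hD₁ : D * s₁ ≤ K * h ^ k)
    (hD₂ : n ≤ k → D * s₂ ≤ K * τ * h ^ (k - n)) (hDQ : D ≤ K * (Q ^ n * Z ^ m))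
    (hgood : 1 ≤ C * P ^ (N + 1) * (s₁ ^ (N - n - k) * s₂ ^ (k - n))) :
    f ^ (N - 2 * n) ≤ K ^ (2 * N) * C * (K ^ 2 * (Q ^ n * Z ^ m)) ^ (3 * n) * (Z ^ m) ^ (2 * n) := by
  obtain ⟨a, ha⟩ : ∃ a, N - n - k = a := ⟨_, rfl⟩
  obtain ⟨b, hb⟩ : ∃ b, k - n = b := ⟨_, rfl⟩
  have hbal := exponent_balance (show 2 * n ≤ N by omega) hk
  rw [ha, hb] at hbal
  rw [ha, hb] at hgood
  have hK0 : 0 ≤ K := by linarith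
  have hP0 : 0 < P := by linarith
  have hf0 : 0 < f := by linarith
  have hab : a + b ≤ N := by omega
  have hab' : N - 2 * n ≤ a + b := by omega
  -- The normalization gives `τ h ^ (k - n) = h ^ (-(N - k))`, because `m = (N - k) + (k - n)`.
  have hDs₂ : (D * s₂) ^ b ≤ (K * h⁻¹ ^ (N - k)) ^ b := by
    rcases Nat.eq_zero_or_pos b with h0 | h0
    · simp [h0]
    · have hnk : n ≤ k := by omega
      refine pow_le_pow_left₀ (mul_nonneg hD hs₂) ((hD₂ hnk).trans (le_of_eq ?_)) b
      have hm : m = (N - k) + (k - n) := by omega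
      rw [hm, pow_add] at hτ
      rw [mul_assoc, inv_pow]
      congr 1
      refine eq_inv_of_mul_eq_one_left ?_
      rw [← hτ]
      ring
  have hmain : (f * P) ^ (a + b) ≤ K ^ (2 * N) * C * P ^ (N + 1) * Z ^ (n * N) := by
    calc (f * P) ^ (a + b) ≤ (K * D) ^ (a + b) :=
          pow_le_pow_left₀ (by positivity) hcard _
      _ ≤ (K * D) ^ (a + b) * (C * P ^ (N + 1) * (s₁ ^ a * s₂ ^ b)) :=
          le_mul_of_one_le_right (by positivity) hgood
      _ = K ^ (a + b) * (C * P ^ (N + 1)) * ((D * s₁) ^ a * (D * s₂) ^ b) := by ring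
      _ ≤ K ^ (a + b) * (C * P ^ (N + 1)) * ((K * h ^ k) ^ a * (K * h⁻¹ ^ (N - k)) ^ b) := by
          gcongr
      _ = (K ^ (2 * (a + b)) * (C * P ^ (N + 1))) * (h ^ (k * a) * h⁻¹ ^ ((N - k) * b)) := by
          rw [mul_pow, mul_pow, ← pow_mul, ← pow_mul]; ring
      _ ≤ (K ^ (2 * N) * (C * P ^ (N + 1))) * Z ^ (n * N) := by
          have h1 : K ^ (2 * (a + b)) ≤ K ^ (2 * N) := pow_le_pow_right₀ hK (by omega)
          have h2 := pow_mul_inv_pow_le hh hZ1 hhZ hhZ' hbal.1 hbal.2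
          gcongr
      _ = _ := by ring
  -- Since `f ≥ 1`, the packing inequality also bounds `P` itself.
  have hPb : P ≤ K ^ 2 * (Q ^ n * Z ^ m) := by
    calc P ≤ f * P := le_mul_of_one_le_left hP0.le hf
      _ ≤ K * D := hcard
      _ ≤ K * (K * (Q ^ n * Z ^ m)) := by gcongr
      _ = _ := by ring
  have hZN : Z ^ (n * N) ≤ (Z ^ m) ^ (2 * n) := by
    rw [← pow_mul]
    refine pow_le_pow_right₀ hZ1 ?_
    calc n * N ≤ n * (2 * m) := Nat.mul_le_mul_left n (by omega)
      _ = m * (2 * n) := by ring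
  have hfab : f ^ (a + b) ≤ K ^ (2 * N) * C * P ^ (3 * n) * Z ^ (n * N) := by
    -- As `a + b ≥ N - 2 n`, at most `2 n + 1 ≤ 3 n` surplus powers of `P` remain.
    have h1 : P ^ (N + 1) ≤ P ^ (a + b) * P ^ (3 * n) := by
      rw [← pow_add]
      exact pow_le_pow_right₀ hP (by omega)
    have h2 : P ^ (a + b) * f ^ (a + b) ≤
        P ^ (a + b) * (K ^ (2 * N) * C * P ^ (3 * n) * Z ^ (n * N)) := by
      calc P ^ (a + b) * f ^ (a + b) = (f * P) ^ (a + b) := by ring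
        _ ≤ _ := hmain
        _ ≤ K ^ (2 * N) * C * (P ^ (a + b) * P ^ (3 * n)) * Z ^ (n * N) := by gcongr
        _ = _ := by ring
    exact le_of_mul_le_mul_left h2 (by positivity)
  calc f ^ (N - 2 * n) ≤ f ^ (a + b) := pow_le_pow_right₀ hf hab'
    _ ≤ _ := hfab
    _ ≤ _ := by gcongr

lemma exists_uniform_bound (N : ℕ) (φ : ℕ → ℝ) : ∃ K, 1 ≤ K ∧ ∀ k ≤ N, φ k ≤ K := by
  refine ⟨1 + ∑ k ∈ Finset.range (N + 1), |φ k|, ?_, fun k hk => ?_⟩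
  · have := Finset.sum_nonneg fun k (_ : k ∈ Finset.range (N + 1)) => abs_nonneg (φ k)
    linarith
  · have := Finset.single_le_sum (f := fun k => |φ k|) (fun k _ => abs_nonneg (φ k))
      (Finset.mem_range.mpr (Nat.lt_succ_of_le hk))
    have := le_abs_self (φ k)
    linarith

/-- Counting integer points of a normalized box adapted to a transversal subspace. -/
lemma exists_card_pow_le {N n m : ℕ} (hN : n + m = N) (hn : 1 ≤ n) (hn4 : 4 * n ≤ N) (C : ℝ)
    (hC : 1 ≤ C) :
    ∃ B : ℝ, 1 ≤ B ∧ ∀ (x : OrthonormalBasis (Fin n ⊕ Fin m) ℝ (EuclideanSpace ℝ (Fin N)))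
      (t : Matrix (Fin n) (Fin n) ℝ) (h Q Z : ℝ) (F : Finset (Fin N → ℤ)),
      (∀ k ≤ N, ∀ v : Fin k → Fin N → ℤ, LinearIndependent ℝ (fun i => intVec (v i)) →
        ∀ W, W = Submodule.span ℝ (Set.range fun i => intVec (v i)) →
        1 ≤ C * (∏ i, ‖intVec (v i)‖) ^ (N + 1) *
          (√(projGram Wᗮ (fun i => x (Sum.inl i))) ^ (N - n - k) *
            √(projGram W (fun i => x (Sum.inl i))) ^ (k - n))) →
      0 < h → 1 ≤ Q → 1 ≤ Z → h ≤ Z → h⁻¹ ≤ Z → (∀ i j, |t i j| ≤ Q) → |t.det| * h ^ m = 1 →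
      F.Nonempty →
      (∀ z ∈ F, ∃ (c₁ : Fin n → ℝ) (c₂ : Fin m → ℝ), (∀ i, |c₁ i| ≤ 1) ∧ (∀ i, |c₂ i| ≤ 1) ∧
        (∀ j, inner ℝ (intVec z) (x (Sum.inl j)) = ∑ i, c₁ i * t i j) ∧
        ∀ j, inner ℝ (intVec z) (x (Sum.inr j)) = h * c₂ j) →
      (F.card : ℝ) ^ (N - 2 * n) ≤ B * (Q ^ n * Z ^ m) ^ (3 * n) * (Z ^ m) ^ (2 * n) := by
  obtain ⟨K₁, hK₁, hK₁'⟩ := exists_uniform_bound N fun k => (5 * k : ℝ) ^ k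
  obtain ⟨K₂, hK₂, hK₂'⟩ := exists_uniform_bound N fun k => k.factorial * (m : ℝ) ^ k
  obtain ⟨K₃, hK₃, hK₃'⟩ := exists_uniform_bound N fun k => k.factorial * (1 + m * k : ℝ) ^ k
  obtain ⟨K₄, hK₄, hK₄'⟩ := exists_uniform_bound N fun k =>
    (n + m : ℝ) ^ k * (k.factorial * (n + 1) ^ n)
  set K := max (max K₁ K₂) (max K₃ K₄) with hKdef
  have e1 : K₁ ≤ K := (le_max_left _ _).trans (le_max_left _ _)
  have e2 : K₂ ≤ K := (le_max_right _ _).trans (le_max_left _ _)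
  have e3 : K₃ ≤ K := (le_max_left _ _).trans (le_max_right _ _)
  have e4 : K₄ ≤ K := (le_max_right _ _).trans (le_max_right _ _)
  have hK : 1 ≤ K := hK₁.trans e1
  have hK0 : 0 ≤ K := by linarith
  refine ⟨K ^ (2 * N) * C * (K ^ 2) ^ (3 * n), ?_, ?_⟩
  · exact one_le_mul_of_one_le_of_one_le (one_le_mul_of_one_le_of_one_le (one_le_pow₀ hK) hC)
      (one_le_pow₀ (one_le_pow₀ hK))
  intro x t h Q Z F hgood hh hQ hZ1 hhZ hhZ' ht hτ hFne hF
  obtain ⟨k, v, W, D, hk, hli, hW, hD, hcard, hD₁, hD₂, hDQ⟩ := exists_integer_frame x t h F hF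
  have hP : 1 ≤ ∏ i, ‖intVec (v i)‖ := by
    have := Finset.prod_le_prod (s := (Finset.univ : Finset (Fin k))) (f := fun _ => (1 : ℝ))
      (g := fun i => ‖intVec (v i)‖) (fun _ _ => zero_le_one) fun i _ =>
        one_le_norm_intVec fun h => hli.ne_zero i (by
          show intVec (v i) = 0
          rw [h]; ext j; simp [intVec_apply])
    simpa using this
  have hf : (1 : ℝ) ≤ F.card := by exact_mod_cast hFne.card_pos
  have key := card_pow_le_of_bounds (N := N) (n := n) (m := m) (k := k) (f := F.card)
    (P := ∏ i, ‖intVec (v i)‖) (D := D) (K := K) (C := C) (h := h) (Q := Q) (Z := Z)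
    (τ := |t.det|) (s₁ := √(projGram Wᗮ fun i => x (Sum.inl i)))
    (s₂ := √(projGram W fun i => x (Sum.inl i)))
    hN hn hn4 hk hf hP hD hK hC hh hQ hZ1 hhZ hhZ' (Real.sqrt_nonneg _) (Real.sqrt_nonneg _) hτ
    (hcard.trans (mul_le_mul_of_nonneg_right ((hK₁' k hk).trans e1) hD)) ?_ (fun hnk => ?_) ?_
    (hgood k hk v hli W hW)
  · refine key.trans (le_of_eq ?_)
    ring
  · refine abs_le_of_sq_le_sq' ?_ (by positivity) |>.2
    rw [mul_pow, Real.sq_sqrt (projGram_nonneg _ _)]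
    refine hD₁.trans ?_
    have h1 : (k.factorial * (m : ℝ) ^ k) ≤ K := (hK₂' k hk).trans e2
    have h2 : (k.factorial * (m : ℝ) ^ k) ≤ K * K := by nlinarith
    calc h ^ (2 * k) * (k.factorial * (m : ℝ) ^ k) ≤ h ^ (2 * k) * (K * K) :=
          mul_le_mul_of_nonneg_left h2 (by positivity)
      _ = (K * h ^ k) ^ 2 := by ring
  · refine abs_le_of_sq_le_sq' ?_ (by positivity) |>.2
    rw [mul_pow, Real.sq_sqrt (projGram_nonneg _ _)]
    refine (hD₂ hnk).trans ?_
    have h1 : (k.factorial * (1 + m * k : ℝ) ^ k) ≤ K := (hK₃' k hk).trans e3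
    calc (k.factorial * (1 + m * k : ℝ) ^ k) ^ 2 * t.det ^ 2 * h ^ (2 * (k - n))
        ≤ K ^ 2 * t.det ^ 2 * h ^ (2 * (k - n)) := by gcongr
      _ = (K * |t.det| * h ^ (k - n)) ^ 2 := by rw [← sq_abs t.det]; ring
  · refine (hDQ Q Z hQ hZ1 (by rwa [abs_of_pos hh]) ht).trans ?_
    have h1 := (hK₄' k hk).trans e4
    calc (n + m : ℝ) ^ k * (k.factorial * (((n + 1) * Q) ^ n * Z ^ m))
        = (n + m : ℝ) ^ k * (k.factorial * (n + 1) ^ n) * (Q ^ n * Z ^ m) := by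
          rw [mul_pow]; ring
      _ ≤ K * (Q ^ n * Z ^ m) := by gcongr

/-! ### Reduction of cylinders to boxes. -/

section Reduction

lemma finite_intVec_norm_le {N : ℕ} (r : ℝ) : {z : Fin N → ℤ | ‖intVec z‖ ≤ r}.Finite := by
  refine (Set.Finite.pi' (t := fun _ : Fin N => Set.Icc (-⌈r⌉) ⌈r⌉)
    fun _ => Set.finite_Icc _ _).subset ?_
  intro z hz i
  have h1 := (PiLp.norm_apply_le (intVec z) i).trans hz
  rw [intVec_apply, Real.norm_eq_abs] at h1
  have h2 : ((|z i| : ℤ) : ℝ) ≤ ⌈r⌉ := by push_cast; exact h1.trans (Int.le_ceil r)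
  exact abs_le.mp (by exact_mod_cast h2)

/-- Both volume estimates for cylinders use it, with the block diagonal matrix of `t` and `h`: one
with coefficients in `[-2, 2]`, the other with coefficients in `[0, 1 / N]`. -/
lemma volume_affine_box {ι E : Type*} [Fintype ι] [DecidableEq ι] [NormedAddCommGroup E]
    [InnerProductSpace ℝ E] [FiniteDimensional ℝ E] [MeasurableSpace E] [BorelSpace E]
    (x : OrthonormalBasis ι ℝ E) (A : Matrix ι ι ℝ) (p : E) (α β : ℝ) (hαβ : α ≤ β) :
    volume ((fun c : ι → ℝ => p + ∑ i, (Matrix.vecMul c A) i • x i) ''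
        Set.univ.pi fun _ => Set.Icc α β) =
      ENNReal.ofReal (|A.det| * (β - α) ^ Fintype.card ι) := by
  let e : (ι → ℝ) ≃ᵐ E := (MeasurableEquiv.toLp 2 (ι → ℝ)).trans
    x.repr.symm.toHomeomorph.toMeasurableEquiv
  have he : MeasurePreserving e volume volume :=
    x.measurePreserving_repr_symm.comp
      (EuclideanSpace.volume_preserving_symm_measurableEquiv_toLp ι).symm
  have hee : ∀ c, e c = ∑ i, c i • x i := fun c => by
    have : e c = x.repr.symm (WithLp.toLp 2 c) := rfl
    rw [this, ← x.sum_repr_symm]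
  have himg : (fun c : ι → ℝ => p + ∑ i, (Matrix.vecMul c A) i • x i) ''
        (Set.univ.pi fun _ => Set.Icc α β) =
      (fun y => p + y) '' (e '' (Matrix.toLin' A.transpose '' Set.univ.pi fun _ => Set.Icc α β)) := by
    rw [Set.image_image, Set.image_image]
    refine Set.image_congr fun c _ => ?_
    rw [hee, Matrix.toLin'_apply, Matrix.mulVec_transpose]
  rw [himg, Set.image_add_left, measure_preimage_add, e.image_eq_preimage_symm,
    he.symm.measure_preimage_equiv, Measure.addHaar_image_linearMap, LinearMap.det_toLin',
    Matrix.det_transpose, ENNReal.ofReal_mul (abs_nonneg _), volume_pi, Measure.pi_pi]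
  congr 1
  rw [Real.volume_Icc, Finset.prod_const, Finset.card_univ, ENNReal.ofReal_pow (by linarith)]

variable {N n m : ℕ} (x : OrthonormalBasis (Fin n ⊕ Fin m) ℝ (EuclideanSpace ℝ (Fin N)))

/-- The coordinates of a vector along the first block of an orthonormal basis. -/
noncomputable def headCoord : EuclideanSpace ℝ (Fin N) →ₗ[ℝ] (Fin n → ℝ) :=
  LinearMap.pi fun j => (innerSL ℝ (x (Sum.inl j))).toLinearMap

lemma headCoord_apply (y : EuclideanSpace ℝ (Fin N)) (j : Fin n) :
    headCoord x y j = inner ℝ (x (Sum.inl j)) y := rfl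

variable {x}

lemma inner_inr_eq_zero {V : Submodule ℝ (EuclideanSpace ℝ (Fin N))}
    (hV : Submodule.span ℝ (Set.range fun i => x (Sum.inl i)) = V)
    {y : EuclideanSpace ℝ (Fin N)} (hy : y ∈ V) (j : Fin m) : inner ℝ (x (Sum.inr j)) y = 0 := by
  have : V ≤ LinearMap.ker (innerSL ℝ (x (Sum.inr j))).toLinearMap := by
    rw [← hV, Submodule.span_le]
    rintro _ ⟨i, rfl⟩
    simp
  simpa using this hy

lemma inr_mem_orthogonal {V : Submodule ℝ (EuclideanSpace ℝ (Fin N))}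
    (hV : Submodule.span ℝ (Set.range fun i => x (Sum.inl i)) = V) (j : Fin m) :
    x (Sum.inr j) ∈ Vᗮ := by
  rw [Submodule.mem_orthogonal']
  intro u hu
  exact inner_inr_eq_zero hV hu j

/-- A convex set over which a cylinder contains a ball contains a simplex in which it is
comparable to a parallelepiped. -/
lemma exists_inscribed_simplex {V : Submodule ℝ (EuclideanSpace ℝ (Fin N))}
    (hV : Submodule.span ℝ (Set.range fun i => x (Sum.inl i)) = V)
    {K : Set (EuclideanSpace ℝ (Fin N))} (hKV : K ⊆ V) {h r ρ : ℝ} (hh : 0 < h) (hr : 0 < r)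
    (hball : ∃ c, Metric.ball c r ⊆ subspaceCylinder V K h)
    (hρ : subspaceCylinder V K h ⊆ Metric.ball 0 ρ) :
    ∃ (p : EuclideanSpace ℝ (Fin N)) (k : Fin n → EuclideanSpace ℝ (Fin N))
      (t : Matrix (Fin n) (Fin n) ℝ), p ∈ K ∧ (∀ i, k i ∈ K) ∧
      (∀ i j, t i j = inner ℝ (x (Sum.inl j)) (k i - p)) ∧ (∀ i j, |t i j| ≤ 2 * ρ) ∧
      (r / 2) ^ n / 2 ≤ |t.det| ∧
      ∀ y ∈ K, ∃ c : Fin n → ℝ, (∀ i, |c i| ≤ 2) ∧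
        ∀ j, inner ℝ (x (Sum.inl j)) (y - p) = ∑ i, c i * t i j := by
  obtain ⟨c, hc⟩ := hball
  obtain ⟨p, hp, y₀, hy₀, -, rfl⟩ := hc (Metric.mem_ball_self hr)
  have hKρ : ∀ y ∈ K, ‖y‖ < ρ := fun y hy =>
    mem_ball_zero_iff.mp (hρ ⟨y, hy, 0, Vᗮ.zero_mem, by simpa using hh.le, by simp⟩)
  -- The component along `V` of the ball in the cylinder is a ball of the same radius about `p`,
  -- contained in `K`. Its vectors of length `r / 2` bound the almost maximal determinant from
  -- below.
  have hpw : ∀ w ∈ V, ‖w‖ < r → p + w ∈ K := by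
    intro w hw hwr
    obtain ⟨y, hy, y', hy', -, he⟩ := hc (show p + y₀ + w ∈ Metric.ball (p + y₀) r by
      simpa [mem_ball_iff_norm] using hwr)
    have h1 : p + w - y ∈ V := V.sub_mem (V.add_mem (hKV hp) hw) (hKV hy)
    have h2 : p + w - y ∈ Vᗮ := by
      have : p + w - y = y' - y₀ := by
        rw [sub_eq_sub_iff_add_eq_add, add_right_comm, he, add_comm]
      rw [this]
      exact Vᗮ.sub_mem hy' hy₀
    have h3 : p + w - y = 0 := by
      have := V.inf_orthogonal_eq_bot
      exact (Submodule.mem_bot ℝ).mp (this ▸ ⟨h1, h2⟩)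
    rw [sub_eq_zero.mp h3]
    exact hy
  set A : Set (Fin n → ℝ) := (fun y => headCoord x (y - p)) '' K with hA
  have hscaled : ∀ j, (fun i => if i = j then r / 2 else 0) ∈ A := by
    intro j
    refine ⟨p + (r / 2) • x (Sum.inl j), hpw _ (V.smul_mem _ (hV ▸ Submodule.subset_span
      ⟨j, rfl⟩)) ?_, ?_⟩
    · rw [norm_smul, x.orthonormal.1, mul_one, Real.norm_eq_abs, abs_of_pos (by linarith)]
      linarith
    · ext i
      simp [headCoord_apply, inner_smul_right, orthonormal_iff_ite.mp x.orthonormal]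
  have hspan : Submodule.span ℝ A = ⊤ := by
    rw [eq_top_iff]
    rintro c -
    have : c = ∑ j, (c j / (r / 2)) • fun i => if i = j then r / 2 else 0 := by
      ext i
      have : r / 2 ≠ 0 := by linarith
      simp [Finset.sum_apply, div_mul_cancel₀ _ this]
    rw [this]
    exact Submodule.sum_mem _ fun j _ => Submodule.smul_mem _ _ (Submodule.subset_span (hscaled j))
  have hentry : ∀ u ∈ A, ∀ j, |u j| ≤ 2 * ρ := by
    rintro _ ⟨y, hy, rfl⟩ j
    simp only [headCoord_apply]
    refine (abs_real_inner_le_norm _ _).trans ?_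
    rw [x.orthonormal.1, one_mul]
    refine (norm_sub_le _ _).trans ?_
    linarith [hKρ y hy, hKρ p hp]
  obtain ⟨u, huA, hdet, hmax, hcoord⟩ := exists_almost_maximal_det (Pi.basisFun ℝ (Fin n)) A hspan
    ((Fintype.card (Fin n)).factorial * ∏ _i : Fin n, 2 * ρ) (fun u hu => by
      rw [Pi.basisFun_det]
      exact abs_det_le_of_row_bound (Matrix.of u) _ fun i j => hentry _ (hu i) j)
  have huA' := huA
  choose k hk using huA'
  refine ⟨p, k, Matrix.of u, hp, fun i => (hk i).1, fun i j => ?_, fun i j => hentry _ (huA i) j,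
    ?_, fun y hy => ?_⟩
  · rw [Matrix.of_apply, ← (hk i).2]
    rfl
  · have h1 := hmax _ hscaled
    rw [Pi.basisFun_det] at h1
    have h2 : (fun j i : Fin n => if i = j then r / 2 else 0) =
        ((r / 2) • (1 : Matrix (Fin n) (Fin n) ℝ) : Matrix (Fin n) (Fin n) ℝ) := by
      ext i j
      simp [Matrix.one_apply, eq_comm]
    have h3 : Matrix.detRowAlternating (fun j i : Fin n => if i = j then r / 2 else 0) =
        (r / 2) ^ n := by
      rw [h2]
      change Matrix.det _ = _
      rw [Matrix.det_smul]
      simp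
    rw [h3, abs_of_pos (by positivity)] at h1
    change _ ≤ 2 * |(Matrix.of u).det| at h1
    linarith
  · obtain ⟨c, hc, hcy⟩ := hcoord _ ⟨y, hy, rfl⟩
    refine ⟨c, hc, fun j => ?_⟩
    exact (congrFun hcy j).trans (by simp [Finset.sum_apply])

end Reduction

section NormalizedBox

variable {N n m : ℕ} {x : OrthonormalBasis (Fin n ⊕ Fin m) ℝ (EuclideanSpace ℝ (Fin N))}

lemma det_fromBlocks_smul_one (t : Matrix (Fin n) (Fin n) ℝ) {h : ℝ} (hh : 0 < h) :
    |(Matrix.fromBlocks t 0 0 (h • (1 : Matrix (Fin m) (Fin m) ℝ))).det| = |t.det| * h ^ m := by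
  rw [Matrix.det_fromBlocks_zero₂₁, Matrix.det_smul, abs_mul]
  simp [abs_of_pos hh]

lemma sum_vecMul_fromBlocks (t : Matrix (Fin n) (Fin n) ℝ) (h : ℝ) (c : Fin n ⊕ Fin m → ℝ) :
    ∑ i, (Matrix.vecMul c (Matrix.fromBlocks t 0 0 (h • 1))) i • x i =
      (∑ j, (∑ i, c (Sum.inl i) * t i j) • x (Sum.inl j)) +
        ∑ l, (h * c (Sum.inr l)) • x (Sum.inr l) := by
  rw [Fintype.sum_sum_type]
  congr 1
  · refine Finset.sum_congr rfl fun j _ => ?_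
    simp [Matrix.vecMul, dotProduct, Fintype.sum_sum_type]
  · refine Finset.sum_congr rfl fun l _ => ?_
    simp [Matrix.vecMul, dotProduct, Fintype.sum_sum_type, Matrix.one_apply, mul_comm]

/-- The coordinates of a point of a cylinder. -/
lemma exists_coeff_of_mem_cylinder {V : Submodule ℝ (EuclideanSpace ℝ (Fin N))}
    (hV : Submodule.span ℝ (Set.range fun i => x (Sum.inl i)) = V)
    {K : Set (EuclideanSpace ℝ (Fin N))} (hKV : K ⊆ V) {h : ℝ} (hh : 0 < h)
    {p : EuclideanSpace ℝ (Fin N)} {t : Matrix (Fin n) (Fin n) ℝ} (hp : p ∈ V)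
    (hK : ∀ y ∈ K, ∃ c : Fin n → ℝ, (∀ i, |c i| ≤ 2) ∧
      ∀ j, inner ℝ (x (Sum.inl j)) (y - p) = ∑ i, c i * t i j)
    {z : EuclideanSpace ℝ (Fin N)} (hz : z ∈ subspaceCylinder V K h) :
    ∃ (c : Fin n → ℝ) (c' : Fin m → ℝ), (∀ i, |c i| ≤ 2) ∧ (∀ l, |c' l| ≤ 1) ∧
      (∀ j, inner ℝ (x (Sum.inl j)) (z - p) = ∑ i, c i * t i j) ∧
      ∀ l, inner ℝ (x (Sum.inr l)) (z - p) = h * c' l := by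
  obtain ⟨y, hy, w, hw, hwh, rfl⟩ := hz
  obtain ⟨c, hc, hcy⟩ := hK y hy
  refine ⟨c, fun l => inner ℝ (x (Sum.inr l)) w / h, hc, fun l => ?_, fun j => ?_, fun l => ?_⟩
  · rw [abs_div, abs_of_pos hh, div_le_one hh]
    refine (abs_real_inner_le_norm _ _).trans ?_
    rwa [x.orthonormal.1, one_mul]
  · rw [add_sub_right_comm, inner_add_right, hcy]
    have : inner ℝ (x (Sum.inl j)) w = 0 :=
      hw _ (hV ▸ Submodule.subset_span ⟨j, rfl⟩)
    rw [this, add_zero]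
  · rw [add_sub_right_comm, inner_add_right,
      inner_inr_eq_zero hV (V.sub_mem (hKV hy) hp), zero_add, mul_div_cancel₀ _ hh.ne']

lemma volume_cylinder_le {V : Submodule ℝ (EuclideanSpace ℝ (Fin N))} (hN : n + m = N)
    (hV : Submodule.span ℝ (Set.range fun i => x (Sum.inl i)) = V)
    {K : Set (EuclideanSpace ℝ (Fin N))} (hKV : K ⊆ V) {h : ℝ} (hh : 0 < h)
    {p : EuclideanSpace ℝ (Fin N)} {t : Matrix (Fin n) (Fin n) ℝ} (hp : p ∈ V)
    (hK : ∀ y ∈ K, ∃ c : Fin n → ℝ, (∀ i, |c i| ≤ 2) ∧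
      ∀ j, inner ℝ (x (Sum.inl j)) (y - p) = ∑ i, c i * t i j) :
    volume (subspaceCylinder V K h) ≤ ENNReal.ofReal (|t.det| * h ^ m * 4 ^ N) := by
  have hvol := volume_affine_box x (Matrix.fromBlocks t 0 0 (h • 1)) p (-2) 2 (by norm_num)
  rw [det_fromBlocks_smul_one t hh, Fintype.card_sum, Fintype.card_fin, Fintype.card_fin, hN] at hvol
  rw [show (2 : ℝ) - -2 = 4 by norm_num] at hvol
  rw [← hvol]
  refine measure_mono fun z hz => ?_
  obtain ⟨c, c', hc, hc', h1, h2⟩ := exists_coeff_of_mem_cylinder hV hKV hh hp hK hz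
  refine ⟨Sum.elim c c', ?_, ?_⟩
  · rintro (i | l) -
    · exact abs_le.mp (hc i)
    · exact abs_le.mp ((hc' l).trans one_le_two)
  · simp only [sum_vecMul_fromBlocks, Sum.elim_inl, Sum.elim_inr, ← h1, ← h2]
    rw [← Fintype.sum_sum_type (fun i => inner ℝ (x i) (z - p) • x i), x.sum_repr']
    abel

/-- With all coefficients in `[0, 1 / N]`, the part along `V` is a convex combination of `p` and the
`k i`, and the orthogonal part has norm at most `h m / N ≤ h`. -/
lemma le_volume_cylinder {V : Submodule ℝ (EuclideanSpace ℝ (Fin N))} (hN : n + m = N)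
    (hN0 : 0 < N) (hV : Submodule.span ℝ (Set.range fun i => x (Sum.inl i)) = V)
    {K : Set (EuclideanSpace ℝ (Fin N))} (hKc : Convex ℝ K) (hKV : K ⊆ V) {h : ℝ} (hh : 0 < h)
    {p : EuclideanSpace ℝ (Fin N)} {k : Fin n → EuclideanSpace ℝ (Fin N)}
    {t : Matrix (Fin n) (Fin n) ℝ} (hp : p ∈ K) (hk : ∀ i, k i ∈ K)
    (ht : ∀ i j, t i j = inner ℝ (x (Sum.inl j)) (k i - p)) :
    ENNReal.ofReal (|t.det| * h ^ m * (N : ℝ)⁻¹ ^ N) ≤ volume (subspaceCylinder V K h) := by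
  have hN' : (0 : ℝ) < N := by exact_mod_cast hN0
  have hvol := volume_affine_box x (Matrix.fromBlocks t 0 0 (h • 1)) p 0 (N : ℝ)⁻¹ (by positivity)
  rw [det_fromBlocks_smul_one t hh, Fintype.card_sum, Fintype.card_fin, Fintype.card_fin, hN,
    sub_zero] at hvol
  rw [← hvol]
  refine measure_mono ?_
  rintro _ ⟨c, hc, rfl⟩
  have hc0 : ∀ i, 0 ≤ c i := fun i => (hc i trivial).1
  have hc1 : ∀ i, c i ≤ (N : ℝ)⁻¹ := fun i => (hc i trivial).2
  have hkp : ∀ i, ∑ j, t i j • x (Sum.inl j) = k i - p := by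
    intro i
    rw [← x.sum_repr' (k i - p), Fintype.sum_sum_type]
    simp [ht, inner_inr_eq_zero hV (V.sub_mem (hKV (hk i)) (hKV hp))]
  have hsum : ∑ j, (∑ i, c (Sum.inl i) * t i j) • x (Sum.inl j) =
      ∑ i, c (Sum.inl i) • (k i - p) := by
    simp_rw [← hkp, Finset.smul_sum, Finset.sum_smul, smul_smul]
    exact Finset.sum_comm
  simp only [sum_vecMul_fromBlocks, hsum, ← add_assoc]
  refine ⟨_, ?_, _, ?_, ?_, rfl⟩
  · have hs : ∑ i, c (Sum.inl i) ≤ 1 := by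
      calc ∑ i, c (Sum.inl i) ≤ ∑ _i : Fin n, (N : ℝ)⁻¹ := Finset.sum_le_sum fun i _ => hc1 _
        _ = n / N := by simp [div_eq_mul_inv]
        _ ≤ 1 := by rw [div_le_one hN']; exact_mod_cast (by omega)
    have := hKc.sum_mem (t := Finset.univ) (w := fun o : Option (Fin n) =>
        o.elim (1 - ∑ i, c (Sum.inl i)) fun i => c (Sum.inl i))
      (z := fun o => o.elim p k) (fun o _ => by
        rcases o with - | i
        · simpa using hs
        · exact hc0 _) (by simp [Fintype.sum_option]) (fun o _ => by
        rcases o with - | i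
        · exact hp
        · exact hk i)
    convert this using 1
    simp only [Fintype.sum_option, Option.elim, sub_smul, one_smul, smul_sub,
      Finset.sum_sub_distrib, Finset.sum_smul]
    abel
  · exact Submodule.sum_mem _ fun l _ => Submodule.smul_mem _ _ (inr_mem_orthogonal hV l)
  · refine (norm_sum_le _ _).trans ?_
    calc ∑ l, ‖(h * c (Sum.inr l)) • x (Sum.inr l)‖ ≤ ∑ _l : Fin m, h * (N : ℝ)⁻¹ := by
          refine Finset.sum_le_sum fun l _ => ?_
          rw [norm_smul, x.orthonormal.1, mul_one, Real.norm_eq_abs,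
            abs_of_nonneg (mul_nonneg hh.le (hc0 _))]
          exact mul_le_mul_of_nonneg_left (hc1 _) hh.le
      _ = h * (m / N) := by simp; ring
      _ ≤ h * 1 := by
          refine mul_le_mul_of_nonneg_left ?_ hh.le
          rw [div_le_one hN']; exact_mod_cast (by omega)
      _ = h := mul_one h

/-- The integer points of a box. -/
def IsBoxPoint (x : OrthonormalBasis (Fin n ⊕ Fin m) ℝ (EuclideanSpace ℝ (Fin N)))
    (t : Matrix (Fin n) (Fin n) ℝ) (h : ℝ) (z : Fin N → ℤ) : Prop :=
  ∃ (c₁ : Fin n → ℝ) (c₂ : Fin m → ℝ), (∀ i, |c₁ i| ≤ 1) ∧ (∀ i, |c₂ i| ≤ 1) ∧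
    (∀ j, inner ℝ (intVec z) (x (Sum.inl j)) = ∑ i, c₁ i * t i j) ∧
    ∀ j, inner ℝ (intVec z) (x (Sum.inr j)) = h * c₂ j

lemma IsBoxPoint.norm_le {t : Matrix (Fin n) (Fin n) ℝ} {h Q : ℝ} {z : Fin N → ℤ}
    (hz : IsBoxPoint x t h z) (ht : ∀ i j, |t i j| ≤ Q) :
    ‖intVec z‖ ≤ n * (n * Q) + m * |h| := by
  obtain ⟨c₁, c₂, h₁, h₂, e₁, e₂⟩ := hz
  rw [← x.sum_repr' (intVec z), Fintype.sum_sum_type]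
  refine (norm_add_le _ _).trans (add_le_add ?_ ?_)
  · refine (norm_sum_le _ _).trans ((Finset.sum_le_card_nsmul _ _ (n * Q) fun j _ => ?_).trans
      (by simp))
    rw [norm_smul, x.orthonormal.1, mul_one, Real.norm_eq_abs, real_inner_comm, e₁]
    refine (Finset.abs_sum_le_sum_abs _ _).trans
      ((Finset.sum_le_card_nsmul _ _ Q fun i _ => ?_).trans (by simp))
    rw [abs_mul]
    calc |c₁ i| * |t i j| ≤ 1 * Q := mul_le_mul (h₁ i) (ht i j) (abs_nonneg _) zero_le_one
      _ = Q := one_mul _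
  · refine (norm_sum_le _ _).trans ((Finset.sum_le_card_nsmul _ _ |h| fun j _ => ?_).trans
      (by simp))
    rw [norm_smul, x.orthonormal.1, mul_one, Real.norm_eq_abs, real_inner_comm, e₂, abs_mul]
    exact mul_le_of_le_one_right (abs_nonneg _) (h₂ j)

lemma finite_isBoxPoint (x : OrthonormalBasis (Fin n ⊕ Fin m) ℝ (EuclideanSpace ℝ (Fin N)))
    (t : Matrix (Fin n) (Fin n) ℝ) (h : ℝ) : {z | IsBoxPoint x t h z}.Finite := by
  refine (finite_intVec_norm_le (n * (n * ∑ i, ∑ j, |t i j|) + m * |h|)).subset fun z hz =>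
    IsBoxPoint.norm_le hz fun i j => ?_
  refine (Finset.single_le_sum (f := fun j => |t i j|) (fun _ _ => abs_nonneg _)
    (Finset.mem_univ j)).trans ?_
  exact Finset.single_le_sum (f := fun i => ∑ j, |t i j|)
    (fun _ _ => Finset.sum_nonneg fun _ _ => abs_nonneg _) (Finset.mem_univ i)

/-- The integer points of a translated box are covered by translates of a smaller box. -/
lemma card_le_mul_card_isBoxPoint {t : Matrix (Fin n) (Fin n) ℝ} {h h₁ : ℝ} (hh : 0 < h)
    (hh₁ : 0 < h₁) {p : EuclideanSpace ℝ (Fin N)} {T : Finset (Fin N → ℤ)}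
    (hT : ∀ z ∈ T, ∃ (c : Fin n → ℝ) (c' : Fin m → ℝ), (∀ i, |c i| ≤ 2) ∧ (∀ l, |c' l| ≤ 1) ∧
      (∀ j, inner ℝ (x (Sum.inl j)) (intVec z - p) = ∑ i, c i * t i j) ∧
      ∀ l, inner ℝ (x (Sum.inr l)) (intVec z - p) = h * c' l) :
    (T.card : ℝ) ≤ 5 ^ n * (2 * (h / h₁) + 3) ^ m * (finite_isBoxPoint x t h₁).toFinset.card := by
  classical
  have : ∀ z, ∃ (c : Fin n → ℝ) (c' : Fin m → ℝ), z ∈ T → (∀ i, |c i| ≤ 2) ∧ (∀ l, |c' l| ≤ 1) ∧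
      (∀ j, inner ℝ (x (Sum.inl j)) (intVec z - p) = ∑ i, c i * t i j) ∧
      ∀ l, inner ℝ (x (Sum.inr l)) (intVec z - p) = h * c' l := fun z => by
    by_cases hz : z ∈ T
    · obtain ⟨c, c', H⟩ := hT z hz
      exact ⟨c, c', fun _ => H⟩
    · exact ⟨0, 0, fun h => (hz h).elim⟩
  choose c c' H using this
  have hq : 0 < h / h₁ := div_pos hh hh₁
  set M := ⌈h / h₁⌉ with hM
  have hM0 : 0 ≤ M := Int.ceil_nonneg hq.le
  -- The label of the cell containing `z`. For two points in one cell the base point `p` cancels and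
  -- all coefficients differ by less than `1`, so the difference is an integer point of the centred
  -- box.
  let φ : (Fin N → ℤ) → (Fin n → ℤ) × (Fin m → ℤ) := fun z =>
    (fun i => ⌊c z i⌋, fun l => ⌊h / h₁ * c' z l⌋)
  have himg : T.image φ ⊆ (Fintype.piFinset fun _ => Finset.Icc (-2) 2) ×ˢ
      Fintype.piFinset fun _ => Finset.Icc (-M) M := by
    intro w hw
    obtain ⟨z, hz, rfl⟩ := Finset.mem_image.mp hw
    obtain ⟨h1, h2, -⟩ := H z hz
    simp only [Finset.mem_product, Fintype.mem_piFinset, Finset.mem_Icc, φ]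
    refine ⟨fun i => ⟨?_, ?_⟩, fun l => ⟨?_, ?_⟩⟩
    · rw [Int.le_floor]; exact_mod_cast (abs_le.mp (h1 i)).1
    · have := (Int.floor_le (c z i)).trans (abs_le.mp (h1 i)).2
      exact_mod_cast this
    · rw [Int.le_floor]
      have := Int.le_ceil (h / h₁)
      push_cast
      nlinarith [(abs_le.mp (h2 l)).1]
    · have := Int.le_ceil (h / h₁)
      have h3 := Int.floor_le (h / h₁ * c' z l)
      have : ((⌊h / h₁ * c' z l⌋ : ℤ) : ℝ) ≤ M := by nlinarith [(abs_le.mp (h2 l)).2]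
      exact_mod_cast this
  have hfib : ∀ w ∈ T.image φ, (T.filter fun z => φ z = w).card ≤
      (finite_isBoxPoint x t h₁).toFinset.card := by
    intro w hw
    obtain ⟨z₀, hz₀, rfl⟩ := Finset.mem_image.mp hw
    refine Finset.card_le_card_of_injOn (fun z => z - z₀) ?_ (fun a _ b _ hab => by simpa using hab)
    intro z hz
    obtain ⟨hz, hφ⟩ := Finset.mem_filter.mp (Finset.mem_coe.mp hz)
    have hφ1 : ∀ i, ⌊c z i⌋ = ⌊c z₀ i⌋ := fun i => congrFun (congrArg Prod.fst hφ) i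
    have hφ2 : ∀ l, ⌊h / h₁ * c' z l⌋ = ⌊h / h₁ * c' z₀ l⌋ :=
      fun l => congrFun (congrArg Prod.snd hφ) l
    obtain ⟨-, -, h1, h2⟩ := H z hz
    obtain ⟨-, -, h3, h4⟩ := H z₀ hz₀
    have hdiff : intVec (z - z₀) = (intVec z - p) - (intVec z₀ - p) := by
      rw [intVec_sub]; abel
    simp only [Finset.mem_coe, Set.Finite.mem_toFinset, Set.mem_ofPred_eq]
    refine ⟨fun i => c z i - c z₀ i, fun l => h / h₁ * c' z l - h / h₁ * c' z₀ l,
      fun i => (Int.abs_sub_lt_one_of_floor_eq_floor (hφ1 i)).le,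
      fun l => (Int.abs_sub_lt_one_of_floor_eq_floor (hφ2 l)).le, fun j => ?_, fun l => ?_⟩
    · rw [real_inner_comm, hdiff, inner_sub_right, h1, h3, ← Finset.sum_sub_distrib]
      exact Finset.sum_congr rfl fun i _ => by ring
    · rw [real_inner_comm, hdiff, inner_sub_right, h2, h4]
      field_simp
  have h1 := Finset.card_le_mul_card_image T _ hfib
  have h2 := Finset.card_le_card himg
  rw [Finset.card_product, Fintype.card_piFinset_const, Fintype.card_piFinset_const] at h2
  have h3 : (((Finset.Icc (-M) M).card : ℕ) : ℝ) ≤ 2 * (h / h₁) + 3 := by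
    rw [Int.card_Icc]
    have : (((M + 1 - -M).toNat : ℤ) : ℝ) = 2 * M + 1 := by
      rw [Int.toNat_of_nonneg (by omega)]; push_cast; ring
    have h4 := Int.ceil_lt_add_one (h / h₁)
    calc (((M + 1 - -M).toNat : ℕ) : ℝ) = 2 * M + 1 := by exact_mod_cast this
      _ ≤ _ := by linarith
  have h5 : (Finset.Icc (-2 : ℤ) 2).card = 5 := by decide
  rw [h5] at h2
  calc (T.card : ℝ) ≤ (finite_isBoxPoint x t h₁).toFinset.card * (T.image φ).card := by
        exact_mod_cast h1
    _ ≤ (finite_isBoxPoint x t h₁).toFinset.card * (5 ^ n * (2 * (h / h₁) + 3) ^ m) := by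
        refine mul_le_mul_of_nonneg_left ?_ (Nat.cast_nonneg _)
        calc ((T.image φ).card : ℝ) ≤ 5 ^ n * ((Finset.Icc (-M) M).card : ℝ) ^ m := by
              exact_mod_cast h2
          _ ≤ _ := by gcongr
    _ = _ := by ring

/-- Integer points of a cylinder are controlled by those of a box of volume comparable to `1`. -/
lemma exists_normalized_box (hN : n + m = N) (hm : 1 ≤ m)
    {V : Submodule ℝ (EuclideanSpace ℝ (Fin N))}
    (hV : Submodule.span ℝ (Set.range fun i => x (Sum.inl i)) = V)
    {K : Set (EuclideanSpace ℝ (Fin N))} (hKc : Convex ℝ K) (hKV : K ⊆ V) {h r ρ : ℝ}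
    (hh : 0 < h) (hr : 0 < r)
    (hball : ∃ c, Metric.ball c r ⊆ subspaceCylinder V K h)
    (hρ : subspaceCylinder V K h ⊆ Metric.ball 0 ρ) (hvol : 1 ≤ volume (subspaceCylinder V K h)) :
    ∃ (t : Matrix (Fin n) (Fin n) ℝ) (h₁ : ℝ), 0 < h₁ ∧ (∀ i j, |t i j| ≤ 2 * ρ) ∧
      (r / 2) ^ n / 2 ≤ |t.det| ∧ |t.det| * h₁ ^ m = 1 ∧
      (subspaceCylinder V K h ∩ integerLattice N).Finite ∧
      ((subspaceCylinder V K h ∩ integerLattice N).ncard : ℝ) ≤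
        5 ^ n * (2 + 3 * 4 ^ N) ^ m * N ^ N * (volume (subspaceCylinder V K h)).toReal *
          (finite_isBoxPoint x t h₁).toFinset.card := by
  obtain ⟨p, k, t, hp, hk, ht, htρ, hdet, hK⟩ := exists_inscribed_simplex hV hKV hh hr hball hρ
  set S := subspaceCylinder V K h with hS
  have hN0 : 0 < N := by omega
  have hN' : (0 : ℝ) < N := by exact_mod_cast hN0
  have hτ : 0 < |t.det| := lt_of_lt_of_le (by positivity) hdet
  have hup := volume_cylinder_le hN hV hKV hh (hKV hp) hK
  have hlo := le_volume_cylinder hN hN0 hV hKc hKV hh hp hk ht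
  rw [← hS] at hup hlo
  have hfin : volume S ≠ ⊤ := ne_top_of_le_ne_top ENNReal.ofReal_ne_top hup
  have hlo' : |t.det| * h ^ m * (N : ℝ)⁻¹ ^ N ≤ (volume S).toReal :=
    (ENNReal.ofReal_le_iff_le_toReal hfin).mp hlo
  have hup' : 1 ≤ |t.det| * h ^ m * 4 ^ N := ENNReal.one_le_ofReal.mp (hvol.trans hup)
  have hm0 : (m : ℝ) ≠ 0 := by positivity
  -- The height that normalizes the box; `(h / h₁) ^ m = |det t| h ^ m` is then comparable to the
  -- volume of the cylinder.
  set h₁ : ℝ := (|t.det|⁻¹) ^ ((m : ℝ)⁻¹) with hh₁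
  have hh₁0 : 0 < h₁ := Real.rpow_pos_of_pos (inv_pos.mpr hτ) _
  have hpow : h₁ ^ m = |t.det|⁻¹ := by
    rw [hh₁, Real.rpow_inv_natCast_pow (inv_pos.mpr hτ).le (by omega)]
  have hinv : (S ∩ integerLattice N) = intVec '' {z | intVec z ∈ S} := by
    rw [integerLattice_eq_range, ← Set.image_preimage_eq_inter_range]; rfl
  have hTfin : {z : Fin N → ℤ | intVec z ∈ S}.Finite :=
    (finite_intVec_norm_le ρ).subset fun z hz => (mem_ball_zero_iff.mp (hρ hz)).le
  refine ⟨t, h₁, hh₁0, htρ, hdet, by rw [hpow, mul_inv_cancel₀ hτ.ne'], ?_, ?_⟩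
  · rw [hinv]; exact hTfin.image _
  have hcard : ((S ∩ integerLattice N).ncard : ℝ) = hTfin.toFinset.card := by
    rw [hinv, Set.ncard_image_of_injective _ intVec_injective, Set.ncard_eq_toFinset_card _ hTfin]
  have hT := card_le_mul_card_isBoxPoint (x := x) (t := t) hh hh₁0 (p := p) (T := hTfin.toFinset)
    fun z hz => exists_coeff_of_mem_cylinder hV hKV hh (hKV hp) hK (hTfin.mem_toFinset.mp hz)
  rw [hcard]
  refine hT.trans (mul_le_mul_of_nonneg_right ?_ (Nat.cast_nonneg _))
  set q := h / h₁ with hq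
  have hq0 : 0 < q := div_pos hh hh₁0
  have hqm : q ^ m = |t.det| * h ^ m := by rw [hq, div_pow, hpow, div_inv_eq_mul, mul_comm]
  rw [← hqm] at hup' hlo'
  -- The volume hypothesis keeps `q` away from zero, so the additive `3` in the number of cells is
  -- absorbed into a multiple of `q`.
  have hq1 : 1 ≤ 4 ^ N * q := by
    by_contra hcon
    push Not at hcon
    have h4 : (1 : ℝ) ≤ 4 ^ N := one_le_pow₀ (by norm_num)
    have hq2 : q ≤ 1 := by nlinarith
    have : q ^ m ≤ q := pow_le_of_le_one hq0.le hq2 (by omega)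
    nlinarith
  calc (5 : ℝ) ^ n * (2 * q + 3) ^ m ≤ 5 ^ n * ((2 + 3 * 4 ^ N) * q) ^ m := by
        gcongr
        nlinarith
    _ = 5 ^ n * (2 + 3 * 4 ^ N) ^ m * N ^ N * (q ^ m * (N : ℝ)⁻¹ ^ N) := by
        rw [mul_pow, inv_pow]
        field_simp
    _ ≤ _ := by gcongr

end NormalizedBox

/-! ### Choice of constants and the three ranges of `n`. -/

section Assembly

lemma card_intVec_norm_le (N : ℕ) {r : ℝ} (hr : 0 ≤ r) :
    ((finite_intVec_norm_le (N := N) r).toFinset.card : ℝ) ≤ (2 * r + 3) ^ N := by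
  have hsub : (finite_intVec_norm_le (N := N) r).toFinset ⊆
      Fintype.piFinset fun _ => Finset.Icc (-⌈r⌉) ⌈r⌉ := by
    intro z hz
    have hz' : ‖intVec z‖ ≤ r := (finite_intVec_norm_le r).mem_toFinset.mp hz
    rw [Fintype.mem_piFinset]
    intro i
    have h1 := (PiLp.norm_apply_le (intVec z) i).trans hz'
    rw [intVec_apply, Real.norm_eq_abs] at h1
    have h2 : ((|z i| : ℤ) : ℝ) ≤ ⌈r⌉ := by push_cast; exact h1.trans (Int.le_ceil r)
    exact Finset.mem_Icc.mpr (abs_le.mp (by exact_mod_cast h2))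
  have h1 := Finset.card_le_card hsub
  rw [Fintype.card_piFinset_const] at h1
  have h0 : 0 ≤ ⌈r⌉ := Int.ceil_nonneg hr
  have h3 : (((Finset.Icc (-⌈r⌉) ⌈r⌉).card : ℕ) : ℝ) ≤ 2 * r + 3 := by
    rw [Int.card_Icc]
    have : (((⌈r⌉ + 1 - -⌈r⌉).toNat : ℤ) : ℝ) = 2 * ⌈r⌉ + 1 := by
      rw [Int.toNat_of_nonneg (by omega)]; push_cast; ring
    have h4 := Int.ceil_lt_add_one r
    calc (((⌈r⌉ + 1 - -⌈r⌉).toNat : ℕ) : ℝ) = 2 * ⌈r⌉ + 1 := by exact_mod_cast this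
      _ ≤ _ := by linarith
  calc ((finite_intVec_norm_le (N := N) r).toFinset.card : ℝ)
      ≤ ((Finset.Icc (-⌈r⌉) ⌈r⌉).card : ℝ) ^ N := by exact_mod_cast h1
    _ ≤ _ := by gcongr

/-- Cylinders over convex subsets of `V` contain at most `B` integer points per unit volume. -/
def CylinderBound {N : ℕ} (V : Submodule ℝ (EuclideanSpace ℝ (Fin N))) (r ρ B : ℝ) : Prop :=
  ∀ K : Set (EuclideanSpace ℝ (Fin N)), Convex ℝ K → K ⊆ (V : Set (EuclideanSpace ℝ (Fin N))) →
    ∀ h : ℝ, 0 < h → ∀ S : Set (EuclideanSpace ℝ (Fin N)), S = subspaceCylinder V K h →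
      (∃ x, Metric.ball x r ⊆ S) → S ⊆ Metric.ball 0 ρ → 1 ≤ volume S →
      (S ∩ integerLattice N).Finite ∧
        ((S ∩ integerLattice N).ncard : ℝ) / (volume S).toReal ≤ B

lemma CylinderBound.mono {N : ℕ} {V : Submodule ℝ (EuclideanSpace ℝ (Fin N))} {r ρ B B' : ℝ}
    (hB : CylinderBound V r ρ B) (h : B ≤ B') : CylinderBound V r ρ B' :=
  fun K hK hKV h' hh' S hS h1 h2 h3 =>
    ⟨(hB K hK hKV h' hh' S hS h1 h2 h3).1, (hB K hK hKV h' hh' S hS h1 h2 h3).2.trans h⟩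

lemma cylinderBound_trivial {N : ℕ} (V : Submodule ℝ (EuclideanSpace ℝ (Fin N))) (r : ℝ) {ρ : ℝ}
    (hρ : 0 ≤ ρ) : CylinderBound V r ρ ((2 * ρ + 3) ^ N) := by
  intro K _ _ h _ S _ _ hSρ hvol
  have hT := finite_intVec_norm_le (N := N) ρ
  have hsub : S ∩ integerLattice N ⊆ intVec '' {z | ‖intVec z‖ ≤ ρ} := by
    rintro _ ⟨hz, hz'⟩
    rw [integerLattice_eq_range] at hz'
    obtain ⟨z, rfl⟩ := hz'
    exact ⟨z, (mem_ball_zero_iff.mp (hSρ hz)).le, rfl⟩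
  have hfin : volume S ≠ ⊤ := ne_top_of_le_ne_top measure_ball_lt_top.ne (measure_mono hSρ)
  have hvol' : 1 ≤ (volume S).toReal := by
    simpa using ENNReal.toReal_mono hfin hvol
  refine ⟨(hT.image _).subset hsub, ?_⟩
  refine (div_le_self (Nat.cast_nonneg _) hvol').trans (le_trans ?_ (card_intVec_norm_le N hρ))
  have := Set.ncard_le_ncard hsub (hT.image _)
  rw [Set.ncard_image_of_injective _ intVec_injective, Set.ncard_eq_toFinset_card _ hT] at this
  exact_mod_cast this

lemma cylinderBound_of_card_le {N n m : ℕ}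
    {x : OrthonormalBasis (Fin n ⊕ Fin m) ℝ (EuclideanSpace ℝ (Fin N))} (hN : n + m = N)
    (hm : 1 ≤ m) {V : Submodule ℝ (EuclideanSpace ℝ (Fin N))}
    (hV : Submodule.span ℝ (Set.range fun i => x (Sum.inl i)) = V) {r ρ M : ℝ} (hr : 0 < r)
    (hM : ∀ (t : Matrix (Fin n) (Fin n) ℝ) (h₁ : ℝ), 0 < h₁ → (∀ i j, |t i j| ≤ 2 * ρ) →
      (r / 2) ^ n / 2 ≤ |t.det| → |t.det| * h₁ ^ m = 1 →
      ((finite_isBoxPoint x t h₁).toFinset.card : ℝ) ≤ M) :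
    CylinderBound V r ρ (5 ^ n * (2 + 3 * 4 ^ N) ^ m * N ^ N * M) := by
  rintro K hKc hKV h hh S rfl hball hSρ hvol
  obtain ⟨t, h₁, hh₁, ht, hdet, hdet1, hfin, hcard⟩ :=
    exists_normalized_box hN hm hV hKc hKV hh hr hball hSρ hvol
  refine ⟨hfin, ?_⟩
  have hvfin : volume (subspaceCylinder V K h) ≠ ⊤ :=
    ne_top_of_le_ne_top measure_ball_lt_top.ne (measure_mono hSρ)
  have hvol' : 1 ≤ (volume (subspaceCylinder V K h)).toReal := by
    simpa using ENNReal.toReal_mono hvfin hvol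
  rw [div_le_iff₀ (by linarith)]
  refine hcard.trans ?_
  rw [mul_right_comm _ M, mul_assoc _ _ M]
  rw [mul_assoc _ _ (Nat.cast _)]
  exact mul_le_mul_of_nonneg_left (mul_le_mul_of_nonneg_left (hM t h₁ hh₁ ht hdet hdet1)
    (by linarith)) (by positivity)

/-- An orthonormal basis whose first block spans the rotated subspace. -/
lemma exists_orthonormalBasis_rotatedFrame {N n m : ℕ} (hN : n + m = N) (hn : n ≤ N) (g : SO N) :
    ∃ x : OrthonormalBasis (Fin n ⊕ Fin m) ℝ (EuclideanSpace ℝ (Fin N)),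
      (fun i => x (Sum.inl i)) = rotatedFrame hn g := by
  obtain ⟨y, hy⟩ := exists_orthonormalBasis_extending (E := EuclideanSpace ℝ (Fin N)) (by simp)
    (Fin.castLEEmb hn) _ (orthonormal_rotatedFrame hn g)
  refine ⟨y.reindex (finSumFinEquiv.trans (finCongr hN)).symm, funext fun i => ?_⟩
  rw [← hy i, OrthonormalBasis.reindex_apply]
  rfl

/-- The empty determinant is `1`, so the normalized height is `1` and the box lies in a ball of
radius `N`. -/
lemma exists_cylinderBound_zero {N : ℕ} (hN : 0 < N) :
    ∃ C : ℝ, ∀ (g : SO N) (r ρ : ℝ), 0 < r → CylinderBound (rotatedSubspace 0 g) r ρ C := by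
  refine ⟨5 ^ 0 * (2 + 3 * 4 ^ N) ^ N * N ^ N * (2 * N + 3) ^ N, fun g r ρ hr => ?_⟩
  obtain ⟨x, hx⟩ := exists_orthonormalBasis_rotatedFrame (zero_add N) (Nat.zero_le N) g
  refine cylinderBound_of_card_le (x := x) (M := (2 * (N : ℝ) + 3) ^ N) (zero_add N) hN
    (by rw [hx, span_rotatedFrame]) hr fun t h₁ hh₁ _ _ hdet => ?_
  have h1 : h₁ = 1 := by
    rw [Matrix.det_isEmpty, abs_one, one_mul] at hdet
    exact (pow_eq_one_iff_of_nonneg hh₁.le hN.ne').mp hdet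
  refine le_trans ?_ (card_intVec_norm_le N (Nat.cast_nonneg N))
  have : (finite_isBoxPoint x t h₁).toFinset ⊆ (finite_intVec_norm_le (N := N) N).toFinset := by
    refine Set.Finite.toFinset_subset_toFinset.mpr fun z hz => ?_
    have := IsBoxPoint.norm_le (Q := 0) hz fun i => i.elim0
    simpa [h1] using this
  exact_mod_cast Finset.card_le_card this

lemma exists_cylinderBound_of_good {N n m : ℕ} (hN : n + m = N) (hn : 1 ≤ n) (hn4 : 4 * n ≤ N)
    (C L : ℝ) (hL : 0 < L) :
    ∃ B : ℝ, ∀ (x : OrthonormalBasis (Fin n ⊕ Fin m) ℝ (EuclideanSpace ℝ (Fin N))) (R : ℝ),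
      1 < R →
      (∀ k ≤ N, ∀ v : Fin k → Fin N → ℤ, LinearIndependent ℝ (fun i => intVec (v i)) →
        ∀ W, W = Submodule.span ℝ (Set.range fun i => intVec (v i)) →
        1 ≤ C * (∏ i, ‖intVec (v i)‖) ^ (N + 1) *
          (√(projGram Wᗮ (fun i => x (Sum.inl i))) ^ (N - n - k) *
            √(projGram W (fun i => x (Sum.inl i))) ^ (k - n))) →
      ∀ V, Submodule.span ℝ (Set.range fun i => x (Sum.inl i)) = V →
      CylinderBound V (1 / (L * R)) (L * R) (B * R ^ (16 * ((n : ℝ) ^ 2 / (N : ℝ)))) := by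
  obtain ⟨B, hB1, hB⟩ := exists_card_pow_le hN hn hn4 (max C 1) (le_max_right _ _)
  have hN0 : 0 < N := by omega
  obtain ⟨q, hq⟩ : ∃ q, q = 2 * L + 1 := ⟨_, rfl⟩
  have hq1 : 1 ≤ q := by linarith
  obtain ⟨w, hw⟩ : ∃ w : ℝ, w = 2 * n.factorial := ⟨_, rfl⟩
  have hfac : (1 : ℝ) ≤ n.factorial := by exact_mod_cast n.factorial_pos
  have hw1 : 1 ≤ w := by linarith
  obtain ⟨D, hD⟩ : ∃ D, D = B * (w ^ (5 * n) * q ^ (8 * n ^ 2)) := ⟨_, rfl⟩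
  have hD1 : 1 ≤ D := hD ▸ one_le_mul_of_one_le_of_one_le hB1
    (one_le_mul_of_one_le_of_one_le (one_le_pow₀ hw1) (one_le_pow₀ hq1))
  refine ⟨5 ^ n * (2 + 3 * 4 ^ N) ^ m * N ^ N * D ^ 2, fun x R hR hgood V hV => ?_⟩
  have hR0 : 0 < R := by linarith
  rw [mul_assoc _ (D ^ 2)]
  refine cylinderBound_of_card_le (x := x) hN (by omega) hV (by positivity)
    fun t h₁ hh₁ ht hdet hdet1 => ?_
  set Q := q * R with hQ
  have hQ1 : 1 ≤ Q := one_le_mul_of_one_le_of_one_le hq1 hR.le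
  have hLQ : 2 * (L * R) ≤ Q := by rw [hQ, hq]; nlinarith
  have htQ : ∀ i j, |t i j| ≤ Q := fun i j => (ht i j).trans hLQ
  have hτ : 0 < |t.det| := lt_of_lt_of_le (by positivity) hdet
  have hdetQ : |t.det| ≤ n.factorial * Q ^ n := by
    simpa using abs_det_le_of_row_bound t (fun _ => Q) htQ
  have hh₁m : h₁ ^ m = |t.det|⁻¹ := eq_inv_of_mul_eq_one_right hdet1
  have hinvdet : |t.det|⁻¹ ≤ 2 * Q ^ n := by
    rw [inv_le_comm₀ hτ (by positivity)]
    refine le_trans ?_ hdet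
    have : (1 / (L * R) / 2) ^ n / 2 = (2 * (2 * (L * R)) ^ n)⁻¹ := by
      rw [div_div, one_div, inv_pow, mul_inv, mul_comm (L * R) 2]
      ring
    rw [this]
    gcongr
  have hQn : 1 ≤ Q ^ n := one_le_pow₀ hQ1
  -- Since `h₁ ^ m = |det t|⁻¹`, the bounds `|det t| ≤ n! Q ^ n` (entries at most `Q`) and `|det
  -- t|⁻¹ ≤ 2 Q ^ n` (inscribed ball) give `Z ^ m ≤ w Q ^ n`.
  set Z := max 1 (max h₁ h₁⁻¹) with hZ
  have hZ1 : 1 ≤ Z := le_max_left _ _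
  have hZm : Z ^ m ≤ w * Q ^ n := by
    rw [hZ]
    rcases max_choice 1 (max h₁ h₁⁻¹) with h | h
    · rw [h, one_pow]; exact one_le_mul_of_one_le_of_one_le hw1 hQn
    · rw [h]
      rcases max_choice h₁ h₁⁻¹ with h | h
      · rw [h, hh₁m]
        refine hinvdet.trans (mul_le_mul_of_nonneg_right ?_ (by positivity))
        linarith
      · rw [h, inv_pow, hh₁m, inv_inv]
        refine hdetQ.trans (mul_le_mul_of_nonneg_right ?_ (by positivity))
        linarith
  set F := (finite_isBoxPoint x t h₁).toFinset with hF
  have hF0 : (0 : Fin N → ℤ) ∈ F := by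
    rw [hF, Set.Finite.mem_toFinset]
    have h0 : intVec (0 : Fin N → ℤ) = 0 := by ext i; simp [intVec_apply]
    exact ⟨0, 0, by simp, by simp, by simp [h0], by simp [h0]⟩
  have hmain := hB x t h₁ Q Z F (fun k hk v hv W hW => (hgood k hk v hv W hW).trans (by
      gcongr
      exact le_max_left _ _)) hh₁ hQ1 hZ1 ((le_max_left _ _).trans (le_max_right _ _))
    ((le_max_right _ _).trans (le_max_right _ _)) htQ hdet1 ⟨0, hF0⟩
    (fun z hz => (finite_isBoxPoint x t h₁).mem_toFinset.mp hz)
  have hbound : (F.card : ℝ) ^ (N - 2 * n) ≤ D * R ^ (8 * n ^ 2) := by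
    refine hmain.trans ?_
    calc B * (Q ^ n * Z ^ m) ^ (3 * n) * (Z ^ m) ^ (2 * n)
        ≤ B * (Q ^ n * (w * Q ^ n)) ^ (3 * n) * (w * Q ^ n) ^ (2 * n) := by gcongr
      _ = B * (w ^ (5 * n) * Q ^ (8 * n ^ 2)) := by
        rw [show 5 * n = 3 * n + 2 * n by ring,
          show 8 * n ^ 2 = n * (3 * n) + n * (3 * n) + n * (2 * n) by ring]
        simp only [mul_pow, pow_add, pow_mul]
        ring
      _ = _ := by rw [hQ, mul_pow, hD]; ring
  have hF1 : (1 : ℝ) ≤ F.card := by exact_mod_cast Finset.card_pos.mpr ⟨0, hF0⟩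
  rw [← pow_le_pow_iff_left₀ (by positivity) (by positivity) hN0.ne']
  have hexp : (R ^ (16 * ((n : ℝ) ^ 2 / (N : ℝ)))) ^ N = (R ^ (8 * n ^ 2)) ^ 2 := by
    have h : 16 * ((n : ℝ) ^ 2 / N) * N = ((8 * n ^ 2 * 2 : ℕ) : ℝ) := by
      have : (N : ℝ) ≠ 0 := by positivity
      push_cast
      field_simp
      norm_num
    rw [← Real.rpow_natCast, ← Real.rpow_mul hR0.le, h, Real.rpow_natCast, pow_mul]
  -- `4 n ≤ N` gives `N ≤ 2 (N - 2 n)`, which doubles the exponent `8 n²` to `16 n²`.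
  calc (F.card : ℝ) ^ N ≤ (F.card : ℝ) ^ ((N - 2 * n) * 2) := pow_le_pow_right₀ hF1 (by omega)
    _ = ((F.card : ℝ) ^ (N - 2 * n)) ^ 2 := pow_mul _ _ _
    _ ≤ (D * R ^ (8 * n ^ 2)) ^ 2 := by gcongr
    _ = D ^ 2 * (R ^ (8 * n ^ 2)) ^ 2 := mul_pow _ _ _
    _ ≤ (D ^ 2) ^ N * (R ^ (8 * n ^ 2)) ^ 2 := by
        gcongr
        exact le_self_pow₀ (one_le_pow₀ hD1) hN0.ne'
    _ = _ := by rw [mul_pow, hexp]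

/-- The bound for subspaces of a fixed dimension. -/
lemma exists_event_cylinderBound {N n : ℕ} (hN : 0 < N) (hn : n ≤ N) {κ L : ℝ} (hκ : κ < 1)
    (hL : 0 < L) :
    ∃ C : ℝ, ∀ R : ℝ, 1 < R → ∃ E : Set (SO N), MeasurableSet E ∧
      ENNReal.ofReal κ ≤ uniformSO N E ∧ ∀ g ∈ E, CylinderBound (rotatedSubspace n g)
        (1 / (L * R)) (L * R) (C * R ^ (16 * ((n : ℝ) ^ 2 / (N : ℝ)))) := by
  have huniv : ENNReal.ofReal κ ≤ uniformSO N Set.univ := by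
    rw [measure_univ]
    exact ENNReal.ofReal_le_one.mpr hκ.le
  have hN' : (0 : ℝ) < N := by exact_mod_cast hN
  rcases Nat.eq_zero_or_pos n with rfl | hn0
  · obtain ⟨C, hC⟩ := exists_cylinderBound_zero hN
    refine ⟨C, fun R hR => ⟨Set.univ, MeasurableSet.univ, huniv, fun g _ => ?_⟩⟩
    have hR0 : 0 < R := by linarith
    exact (hC g _ _ (by positivity)).mono (by simp)
  rcases le_or_gt (4 * n) N with hn4 | hn4
  · obtain ⟨C, -, G, hG, hGκ, hgood⟩ := exists_good_event (show n < N by omega) κ hκ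
    obtain ⟨B, hB⟩ := exists_cylinderBound_of_good (show n + (N - n) = N by omega) hn0 hn4 C L hL
    refine ⟨B, fun R hR => ⟨G, hG, hGκ, fun g hg => ?_⟩⟩
    obtain ⟨x, hx⟩ := exists_orthonormalBasis_rotatedFrame (show n + (N - n) = N by omega) hn g
    refine hB x R hR ?_ _ (by rw [hx, span_rotatedFrame])
    rw [hx]
    exact hgood g hg
  · refine ⟨(2 * L + 3) ^ N, fun R hR => ⟨Set.univ, MeasurableSet.univ, huniv, fun g _ => ?_⟩⟩
    have hR0 : 0 < R := by linarith
    refine (cylinderBound_trivial _ _ (by positivity)).mono ?_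
    have hexp : (N : ℝ) ≤ 16 * ((n : ℝ) ^ 2 / N) := by
      have : (N : ℝ) < 4 * n := by exact_mod_cast hn4
      rw [← mul_div_assoc, le_div_iff₀ hN']
      nlinarith
    calc (2 * (L * R) + 3) ^ N ≤ ((2 * L + 3) * R) ^ N := by
          gcongr
          nlinarith
      _ = (2 * L + 3) ^ N * R ^ (N : ℝ) := by rw [mul_pow, Real.rpow_natCast]
      _ ≤ _ := by gcongr; exact hR.le

end Assembly

theorem mainTheorem9 :
    ∃ A : ℝ, 0 < A ∧
      ∀ N : ℕ, 0 < N → ∀ κ : ℝ, 0 < κ → κ < 1 → ∀ L : ℝ, 0 < L →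
        ∃ C : ℝ, 0 < C ∧
          ∀ n : ℕ, n ≤ N → ∀ R : ℝ, 1 < R →
            ∃ E : Set (SO N), MeasurableSet E ∧ ENNReal.ofReal κ ≤ uniformSO N E ∧
              ∀ g ∈ E, ∀ K : Set (EuclideanSpace ℝ (Fin N)), Convex ℝ K →
                K ⊆ (rotatedSubspace n g : Set (EuclideanSpace ℝ (Fin N))) →
                ∀ h : ℝ, 0 < h →
                ∀ S : Set (EuclideanSpace ℝ (Fin N)),
                  S = subspaceCylinder (rotatedSubspace n g) K h →
                  (∃ x, Metric.ball x (1 / (L * R)) ⊆ S) →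
                  S ⊆ Metric.ball 0 (L * R) →
                  1 ≤ volume S →
                  (S ∩ integerLattice N).Finite ∧
                    ((S ∩ integerLattice N).ncard : ℝ) / (volume S).toReal ≤
                      C * R ^ (A * ((n : ℝ) ^ 2 / (N : ℝ))) := by
  refine ⟨16, by norm_num, fun N hN κ _ hκ L hL => ?_⟩
  choose φ hφ using fun (n : ℕ) (hn : n ≤ N) => exists_event_cylinderBound hN hn hκ hL
  -- The constants found for each dimension are merged into one, there being finitely many `n ≤ N`;
  -- the default `0` is never used.
  obtain ⟨C, hC1, hC⟩ := exists_uniform_bound N fun n => if hn : n ≤ N then φ n hn else 0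
  refine ⟨C, by linarith, fun n hn R hR => ?_⟩
  obtain ⟨E, hE, hEκ, hbound⟩ := hφ n hn R hR
  refine ⟨E, hE, hEκ, fun g hg => (hbound g hg).mono ?_⟩
  have h1 : φ n hn ≤ C := by simpa [hn] using hC n hn
  exact mul_le_mul_of_nonneg_right h1 (Real.rpow_nonneg (by linarith) _)
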